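/- Consider a Lagrangian gauge system in the (minimal) Batalin--Vilkovisky formalism on $\mathbb R^n$: finitely many fields $\phi^A$ of Grassmann parity $\epsilon_A$ and ghost number $\mathrm{gh}_A\ge 0$ (the original fields $\varphi^i$ have ghost number $0$, the ghosts $C^\alpha$ have ghost number $1$, then come ghosts for ghosts), and antifields $\phi^*_A$ of opposite parity, ghost number $-\mathrm{gh}_A-1$ and antifield number $\mathrm{gh}_A+1$. Local functions are smooth functions of $x^\mu$ and of finitely many derivatives of the fields and antifields (polynomial in all odd variables and in those of nonzero ghost number); densities of fixed ghost number are sums of local functions of antifield number $0,1,2,\dots$; local functionals are densities modulo total divergences $\partial_\mu j^\mu$. Let $$(a,b)=\int d^nx\,\Big(\frac{\delta^R a}{\delta\phi^A}\frac{\delta^L b}{\delta\phi^*_A}-\frac{\delta^R a}{\delta\phi^*_A}\frac{\delta^L b}{\delta\phi^A}\Big)$$ be the antibracket, let $S$ be an even local functional of ghost number $0$ with $\frac12(S,S)=0$, let $s=(\cdot,S)$, and let $H^g(s)$ be the cohomology of $s$ in the space of local functionals of ghost number $g\in\mathbb Z$. (1) The antibracket induces well-defined bilinear maps $(\cdot,\cdot)_M:H^{g_1}(s)\times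 H^{g_2}(s)\to H^{g_1+g_2+1}(s)$. With it, $H^{-1}(s)$ is a ($\mathbb Z/2$-graded, with respect to the shifted Grassmann parity) Lie algebra, and for every $g$ and every (graded) subalgebra $\mathfrak g\subseteq H^{-1}(s)$, the map $(x,m)\mapsto (x,m)_M$ makes $H^g(s)$ a (graded) $\mathfrak g$-module. (2) Suppose moreover that $S$ is proper, i.e. that its Koszul--Tate differential (the part of $s$ that lowers the antifield number by one) has no homology in positive antifield number in the space of local functions. Let $S_0=\int \mathcal L_0$ be the part of $S$ of antifield number $0$ and $L_i=\delta^L \mathcal L_0/\delta\varphi^i$. A variational symmetry is a family $X^i$ of local functions of $x$, $\varphi$ and derivatives of $\varphi$ such that $\delta_X\mathcal L_0=\sum_{i,I}\partial_I X^i\,\partial^L\mathcal L_0/\partial\varphi^i_I$ is a total divergence. It is trivial if it is a sum of a gauge symmetry $R^i_\alpha(f^\alpha)$ with field dependent parameters $f^\alpha$ and of an on-shell vanishing symmetry $X^i=M^{ij}(L_j)$, where $M$ is a (graded) skew-adjoint matrix of differential operators with local functions as coefficients. Then the commutator of symmetries induces a (graded) Lie algebra structure on the space of variational symmetries modulo trivial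 ones, the map $[K]\mapsto[X_K]$, $X_K^i=-\delta^R K_1/\delta\varphi^*_i$ ($K_1$ being the part of $K$ of antifield number $1$), is an isomorphism from $H^{-1}(s)$ onto this graded Lie algebra, and hence for every $g$ and every (graded) subalgebra $\mathfrak h$ of the Lie algebra of equivalence classes of variational symmetries, $H^g(s)$ is an $\mathfrak h$-module under $([X_K],m)\mapsto([K],m)_M$. -/

import Mathlib

open scoped TensorProduct ContDiff BigOperators

noncomputable section

namespace BV

universe u

/-! ## Field content and jets -/

/-- Field content of a (minimal) Batalin-Vilkovisky theory: the index set `Φ` labels all the fields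
`φ^A` (original fields, ghosts, ghosts for ghosts, ...).  `gh A` is the ghost number of `φ^A` (zero
exactly for the original fields) and `par A` its Grassmann parity. -/
structure FieldContent (Φ : Type u) where
  gh : Φ → ℕ
  par : Φ → ZMod 2

/-- Fields (`Sum.inl A`) and antifields (`Sum.inr A`). -/
abbrev Var (Φ : Type u) : Type u := Φ ⊕ Φ

/-- Symmetric multi-indices: `I μ` is the number of derivatives in the direction `x^μ`. -/
abbrev MI (n : ℕ) : Type := Fin n →₀ ℕ

variable {Φ : Type u}

namespace FieldContent

/-- Parity of a field or antifield; an antifield has the parity opposite to that of its field. -/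
def vpar (F : FieldContent Φ) : Var Φ → ZMod 2
  | Sum.inl A => F.par A
  | Sum.inr A => F.par A + 1

/-- Ghost number: `gh φ*_A = - gh φ^A - 1`. -/
def vgh (F : FieldContent Φ) : Var Φ → ℤ
  | Sum.inl A => F.gh A
  | Sum.inr A => -(F.gh A : ℤ) - 1

/-- Antifield number: `0` for the fields, `gh φ^A + 1` for the antifield `φ*_A`. -/
def vaf (F : FieldContent Φ) : Var Φ → ℤ
  | Sum.inl _ => 0
  | Sum.inr A => (F.gh A : ℤ) + 1

end FieldContent

/-- Derivatives of the Grassmann even variables. -/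
abbrev EvenJet (n : ℕ) (F : FieldContent Φ) : Type u := {z : Var Φ // F.vpar z = 0} × MI n

/-- Derivatives of the Grassmann odd variables. -/
abbrev OddJet (n : ℕ) (F : FieldContent Φ) : Type u := {z : Var Φ // ¬ F.vpar z = 0} × MI n

/-- Even coordinates of the jet space: spacetime coordinates and derivatives of the even variables. -/
abbrev Coord (n : ℕ) (F : FieldContent Φ) : Type u := Fin n ⊕ EvenJet n F

/-! ## Local functions -/

/-- Smooth functions of finitely many coordinates. -/
def IsLocalSmooth {ι : Type u} (f : (ι → ℝ) → ℝ) : Prop :=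
  ∃ (s : Finset ι) (g : (s → ℝ) → ℝ), ContDiff ℝ ∞ g ∧ ∀ j, f j = g (fun c => j c)

theorem IsLocalSmooth.extend {ι : Type u} {s t : Finset ι} (hst : s ⊆ t) {g : (s → ℝ) → ℝ}
    (hg : ContDiff ℝ ∞ g) :
    ContDiff ℝ ∞ (fun y : t → ℝ => g (fun c => y ⟨c, hst c.2⟩)) :=
  hg.comp (contDiff_pi.2 fun c => contDiff_apply ℝ ℝ (⟨c, hst c.2⟩ : t))

theorem IsLocalSmooth.map₂ {ι : Type u} {f₁ f₂ : (ι → ℝ) → ℝ} (h₁ : IsLocalSmooth f₁)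
    (h₂ : IsLocalSmooth f₂) (op : ℝ → ℝ → ℝ)
    (hop : ∀ (E : Type u) [NormedAddCommGroup E] [NormedSpace ℝ E] (a b : E → ℝ),
      ContDiff ℝ ∞ a → ContDiff ℝ ∞ b → ContDiff ℝ ∞ fun x => op (a x) (b x)) :
    IsLocalSmooth fun j => op (f₁ j) (f₂ j) := by
  classical
  obtain ⟨s, g, hg, hf⟩ := h₁
  obtain ⟨t, k, hk, hf'⟩ := h₂
  refine ⟨s ∪ t, _, hop _ _ _ (IsLocalSmooth.extend (Finset.subset_union_left) hg)
    (IsLocalSmooth.extend (Finset.subset_union_right) hk), fun j => ?_⟩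
  simp only [hf, hf']

/-- The commutative algebra of smooth functions of finitely many of the coordinates `ι`. -/
def smoothLoc (ι : Type u) : Subalgebra ℝ ((ι → ℝ) → ℝ) where
  carrier := {f | IsLocalSmooth f}
  mul_mem' ha hb := IsLocalSmooth.map₂ ha hb (· * ·) fun _ _ _ _ _ h k => h.mul k
  add_mem' ha hb := IsLocalSmooth.map₂ ha hb (· + ·) fun _ _ _ _ _ h k => h.add k
  algebraMap_mem' r := ⟨∅, fun _ => r, contDiff_const, fun _ => rfl⟩

theorem coord_mem {ι : Type u} (c : ι) : (fun j : ι → ℝ => j c) ∈ smoothLoc ι :=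
  ⟨{c}, fun y => y ⟨c, Finset.mem_singleton_self c⟩, contDiff_apply ℝ ℝ _, fun _ => rfl⟩

theorem const_mem {ι : Type u} (r : ℝ) : (fun _ : ι → ℝ => r) ∈ smoothLoc ι :=
  (smoothLoc ι).algebraMap_mem r

theorem hasDerivAt_line {ι : Type u} {s : Finset ι} {g : (s → ℝ) → ℝ} (hg : ContDiff ℝ ∞ g)
    (j w : ι → ℝ) :
    HasDerivAt (fun t : ℝ => g (fun c : s => (j + t • w) c))
      (fderiv ℝ g (fun c : s => j c) (fun c : s => w c)) 0 := by
  have h1 : HasDerivAt (fun t : ℝ => (fun c : s => (j + t • w) c)) (fun c : s => w c) 0 := by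
    refine hasDerivAt_pi.2 fun c => ?_
    simpa using ((hasDerivAt_id (0 : ℝ)).mul_const (w c)).const_add (j c)
  have h2 : HasFDerivAt g (fderiv ℝ g (fun c : s => j c))
      ((fun t : ℝ => (fun c : s => (j + t • w) c)) 0) := by
    have := (hg.differentiable (by simp)).differentiableAt (x := fun c : s => j c)
    simpa using this.hasFDerivAt
  exact h2.comp_hasDerivAt (0 : ℝ) h1

theorem differentiableAt_line {ι : Type u} (f : smoothLoc ι) (j w : ι → ℝ) :
    DifferentiableAt ℝ (fun t : ℝ => f.1 (j + t • w)) 0 := by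
  obtain ⟨f, s, g, hg, hf⟩ := f
  have : (fun t : ℝ => f (j + t • w)) = fun t : ℝ => g (fun c : s => (j + t • w) c) := by
    funext t; exact hf _
  simp only [this]
  exact (hasDerivAt_line hg j w).differentiableAt

/-- The derivative of smooth local functions along the vector field `v` on the space of
coordinates, the components of `v` being local functions. -/
def lieDeriv {ι : Type u} (v : (ι → ℝ) → ι → ℝ) (hv : ∀ c, (fun j => v j c) ∈ smoothLoc ι) :
    smoothLoc ι →ₗ[ℝ] smoothLoc ι where
  toFun f := ⟨fun j => deriv (fun t : ℝ => f.1 (j + t • v j)) 0, by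
    classical
    obtain ⟨f, s, g, hg, hf⟩ := f
    have key : (fun j => deriv (fun t : ℝ => f (j + t • v j)) 0) =
        ∑ c : s, (fun j => v j c) *
          fun j : ι → ℝ => fderiv ℝ g (fun d : s => j d) (Pi.single c 1) := by
      funext j
      have : (fun t : ℝ => f (j + t • v j)) = fun t : ℝ => g (fun c : s => (j + t • v j) c) := by
        funext t; exact hf _
      rw [this, (hasDerivAt_line hg j (v j)).deriv, Finset.sum_apply]
      conv_lhs => rw [pi_eq_sum_univ' (fun c : s => v j c)]
      rw [map_sum]
      refine Finset.sum_congr rfl fun c _ => ?_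
      rw [map_smul, smul_eq_mul, Pi.mul_apply]
    change (fun j => deriv (fun t : ℝ => f (j + t • v j)) 0) ∈ smoothLoc ι
    rw [key]
    refine Subalgebra.sum_mem _ fun c _ => Subalgebra.mul_mem _ (hv c) ?_
    exact ⟨s, fun y => fderiv ℝ g y (Pi.single c 1),
      (hg.fderiv_right (m := ∞) (by simp)).clm_apply contDiff_const, fun _ => rfl⟩⟩
  map_add' f g := by
    ext j
    exact deriv_add (differentiableAt_line f j (v j)) (differentiableAt_line g j (v j))
  map_smul' r f := by
    ext j
    exact deriv_const_mul r (differentiableAt_line f j (v j))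

/-- The algebra homomorphism `w ↦ w + ε T w` from the exterior algebra to its dual numbers. -/
def extHom {W : Type u} [AddCommGroup W] [Module ℝ W] (T : W →ₗ[ℝ] W) :
    ExteriorAlgebra ℝ W →ₐ[ℝ] DualNumber (ExteriorAlgebra ℝ W) :=
  ExteriorAlgebra.lift ℝ
    ⟨{ toFun := fun w =>
          TrivSqZeroExt.inl (ExteriorAlgebra.ι ℝ w) + TrivSqZeroExt.inr (ExteriorAlgebra.ι ℝ (T w))
       map_add' := fun a b => by
          ext <;> simp
       map_smul' := fun r a => by
          ext <;> simp },
      fun w => by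
        ext
        · simp
        · simp⟩

/-- The derivation of the exterior algebra that extends the linear map `T` on generators: the
coefficient of `ε` in `extHom T`. -/
def extDer {W : Type u} [AddCommGroup W] [Module ℝ W] (T : W →ₗ[ℝ] W) :
    ExteriorAlgebra ℝ W →ₗ[ℝ] ExteriorAlgebra ℝ W where
  toFun a := (extHom T a).snd
  map_add' a b := by rw [map_add, TrivSqZeroExt.snd_add]
  map_smul' r a := by rw [map_smul, TrivSqZeroExt.snd_smul, RingHom.id_apply]

section Alg

variable (n : ℕ) (F : FieldContent Φ)

/-- Smooth functions of the even coordinates. -/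
abbrev EvenAlg : Type u := smoothLoc (Coord n F)

/-- Exterior algebra on the odd jet coordinates. -/
abbrev OddAlg : Type u := ExteriorAlgebra ℝ (OddJet n F →₀ ℝ)

/-- Local functions: the graded commutative algebra of smooth functions of `x^μ` and finitely many
derivatives of the even variables, with values in the exterior algebra on the derivatives of the odd
variables. -/
abbrev LocAlg : Type u := EvenAlg n F ⊗[ℝ] OddAlg n F

instance : Ring (LocAlg n F) := Algebra.TensorProduct.instRing

instance : AddCommGroup (LocAlg n F) := TensorProduct.addCommGroup

instance : Algebra ℝ (LocAlg n F) := Algebra.TensorProduct.leftAlgebra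

instance : Module ℝ (LocAlg n F) := TensorProduct.leftModule

variable {n F}

/-- Parity automorphism: `+1` on Grassmann even, `-1` on Grassmann odd local functions. -/
def parInv : LocAlg n F →ₗ[ℝ] LocAlg n F :=
  LinearMap.lTensor (EvenAlg n F) (CliffordAlgebra.involute (Q := (0 : QuadraticForm ℝ
    (OddJet n F →₀ ℝ)))).toLinearMap

/-- The sign `(-1)^p`. -/
def sgn (p : ZMod 2) : ℝ := if p = 0 then 1 else -1

/-- Local functions of Grassmann parity `p`. -/
def parityPart (p : ZMod 2) : Submodule ℝ (LocAlg n F) :=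
  LinearMap.ker (parInv - sgn p • LinearMap.id)

/-! ### Derivations -/

/-- The total derivative as a vector field on the even coordinates. -/
def totalVF (μ : Fin n) (j : Coord n F → ℝ) : Coord n F → ℝ
  | Sum.inl ν => if ν = μ then 1 else 0
  | Sum.inr (z, I) => j (Sum.inr (z, I + Finsupp.single μ 1))

theorem totalVF_mem (μ : Fin n) (c : Coord n F) :
    (fun j => totalVF μ j c) ∈ smoothLoc (Coord n F) := by
  rcases c with ν | ⟨z, I⟩
  · exact const_mem _
  · exact coord_mem _

/-- The total derivative `∂_μ = ∂/∂x^μ + z_μ ∂/∂z + ...`, the sum being over all even and odd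
variables `z` and their derivatives. -/
def totalD (μ : Fin n) : LocAlg n F →ₗ[ℝ] LocAlg n F :=
  LinearMap.rTensor (OddAlg n F) (lieDeriv (totalVF μ) (totalVF_mem μ)) +
    LinearMap.lTensor (EvenAlg n F)
      (extDer (Finsupp.lmapDomain ℝ ℝ fun q : OddJet n F => (q.1, q.2 + Finsupp.single μ 1)))

/-- Iterated total derivative `∂_I`. -/
def totalDI (I : MI n) : Module.End ℝ (LocAlg n F) :=
  (List.ofFn fun μ : Fin n => (totalD μ : Module.End ℝ (LocAlg n F)) ^ I μ).prod

/-- `(-∂)_I = (-1)^{|I|} ∂_I`. -/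
def adjDI (I : MI n) : Module.End ℝ (LocAlg n F) :=
  (-1 : ℝ) ^ (∑ μ : Fin n, I μ) • totalDI I

/-- The vector field of the number operator on the even coordinates. -/
def weightVF (w : Var Φ → ℤ) (j : Coord n F → ℝ) : Coord n F → ℝ
  | Sum.inl _ => 0
  | Sum.inr (z, I) => (w z : ℝ) * j (Sum.inr (z, I))

theorem weightVF_mem (w : Var Φ → ℤ) (c : Coord n F) :
    (fun j => weightVF w j c) ∈ smoothLoc (Coord n F) := by
  rcases c with ν | ⟨z, I⟩
  · exact const_mem _
  · exact Subalgebra.mul_mem _ (const_mem _) (coord_mem _)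

/-- The number operator `∑ w(z) z_I ∂/∂z_I`. -/
def weightOp (w : Var Φ → ℤ) : LocAlg n F →ₗ[ℝ] LocAlg n F :=
  LinearMap.rTensor (OddAlg n F) (lieDeriv (weightVF w) (weightVF_mem w)) +
    LinearMap.lTensor (EvenAlg n F)
      (extDer (Finsupp.lsum ℝ fun q : OddJet n F => (w q.1.1 : ℝ) • Finsupp.lsingle q))

/-- Local functions of ghost number `g` and antifield number `k`.  A smooth function that is
homogeneous in this sense is automatically polynomial in the (anti)fields of nonzero ghost number
and their derivatives. -/
def bigraded (g k : ℤ) : Submodule ℝ (LocAlg n F) :=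
  LinearMap.ker (weightOp F.vgh - (g : ℝ) • LinearMap.id) ⊓
    LinearMap.ker (weightOp F.vaf - (k : ℝ) • LinearMap.id)

open Classical in
/-- Left partial derivative `∂^L/∂z_I`. -/
def pdL (z : Var Φ) (I : MI n) : LocAlg n F →ₗ[ℝ] LocAlg n F :=
  if h : F.vpar z = 0 then
    LinearMap.rTensor (OddAlg n F)
      (lieDeriv (fun _ => Pi.single (Sum.inr (⟨z, h⟩, I)) 1) (fun _ => const_mem _))
  else
    LinearMap.lTensor (EvenAlg n F)
      (CliffordAlgebra.contractLeft (Q := (0 : QuadraticForm ℝ (OddJet n F →₀ ℝ)))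
        (Finsupp.lapply (⟨z, h⟩, I)))

open Classical in
/-- Right partial derivative `∂^R/∂z_I`. -/
def pdR (z : Var Φ) (I : MI n) : LocAlg n F →ₗ[ℝ] LocAlg n F :=
  if h : F.vpar z = 0 then
    LinearMap.rTensor (OddAlg n F)
      (lieDeriv (fun _ => Pi.single (Sum.inr (⟨z, h⟩, I)) 1) (fun _ => const_mem _))
  else
    LinearMap.lTensor (EvenAlg n F)
      ((CliffordAlgebra.contractRight (Q := (0 : QuadraticForm ℝ (OddJet n F →₀ ℝ)))).flip
        (Finsupp.lapply (⟨z, h⟩, I)))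

/-! ### Each local function depends on finitely many jet coordinates -/

theorem finite_support_of_pure {V : Type u} [AddCommGroup V] [Module ℝ V] {ι : Type*}
    (T : ι → LocAlg n F →ₗ[ℝ] V)
    (h : ∀ (f : EvenAlg n F) (w₀ : OddAlg n F), {i | T i (f ⊗ₜ[ℝ] w₀) ≠ 0}.Finite)
    (a : LocAlg n F) : {i | T i a ≠ 0}.Finite := by
  induction a using TensorProduct.induction_on with
  | zero => simp
  | tmul f w₀ => exact h f w₀
  | add x y hx hy =>
    refine (hx.union hy).subset fun i hi => ?_
    by_contra hc
    simp only [Set.mem_union, Set.mem_ofPred_eq, not_or, not_not] at hc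
    exact hi (by rw [map_add, hc.1, hc.2, add_zero])

open Classical in
theorem finite_lieDeriv_single (z : {z : Var Φ // F.vpar z = 0}) (f : EvenAlg n F) :
    {I : MI n | lieDeriv (fun _ => Pi.single (Sum.inr (z, I) : Coord n F) (1 : ℝ))
      (fun _ => const_mem _) f ≠ 0}.Finite := by
  obtain ⟨f, s, g, hg, hf⟩ := f
  have hfin : {I : MI n | (Sum.inr (z, I) : Coord n F) ∈ s}.Finite :=
    s.finite_toSet.preimage (fun I _ J _ h => by simpa using h)
  refine hfin.subset fun I hI => ?_
  by_contra hns
  refine hI ?_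
  ext j
  change deriv (fun t : ℝ => f (j + t • Pi.single (Sum.inr (z, I)) 1)) 0 = 0
  have : (fun t : ℝ => f (j + t • Pi.single (Sum.inr (z, I)) 1)) = fun _ => f j := by
    funext t
    rw [hf, hf]
    congr 1
    funext c
    have hc : (c : Coord n F) ≠ Sum.inr (z, I) := fun h => hns (by
      have := c.2; rw [h] at this; exact this)
    simp [hc]
  rw [this, deriv_const]

theorem finite_contractLeft (z : {z : Var Φ // ¬ F.vpar z = 0}) (w₀ : OddAlg n F) :
    {I : MI n | CliffordAlgebra.contractLeft (Q := (0 : QuadraticForm ℝ (OddJet n F →₀ ℝ)))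
      (Finsupp.lapply (z, I)) w₀ ≠ 0}.Finite := by
  induction w₀ using CliffordAlgebra.left_induction with
  | algebraMap r => simp
  | add x y hx hy =>
    refine (hx.union hy).subset fun i hi => ?_
    by_contra hc
    simp only [Set.mem_union, Set.mem_ofPred_eq, not_or, not_not] at hc
    exact hi (by rw [map_add, hc.1, hc.2, add_zero])
  | ι_mul x m hx =>
    have hm : {I : MI n | m (z, I) ≠ 0}.Finite :=
      m.hasFiniteSupport.preimage (fun I _ J _ h => by simpa using h)
    refine (hx.union hm).subset fun i hi => ?_
    by_contra hc
    simp only [Set.mem_union, Set.mem_ofPred_eq, not_or, not_not] at hc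
    refine hi ?_
    rw [CliffordAlgebra.contractLeft_ι_mul, hc.1, mul_zero, sub_zero, Finsupp.lapply_apply, hc.2,
      zero_smul]

theorem finite_pdL (z : Var Φ) (a : LocAlg n F) : {I : MI n | pdL z I a ≠ 0}.Finite := by
  classical
  refine finite_support_of_pure _ (fun f w₀ => ?_) a
  by_cases h : F.vpar z = 0
  · refine (finite_lieDeriv_single ⟨z, h⟩ f).subset fun I hI h0 => hI ?_
    simp only [pdL, dif_pos h, LinearMap.rTensor_tmul]
    rw [h0, TensorProduct.zero_tmul]
  · refine (finite_contractLeft ⟨z, h⟩ w₀).subset fun I hI h0 => hI ?_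
    simp only [pdL, dif_neg h, LinearMap.lTensor_tmul]
    rw [h0, TensorProduct.tmul_zero]

theorem finite_pdR (z : Var Φ) (a : LocAlg n F) : {I : MI n | pdR z I a ≠ 0}.Finite := by
  classical
  refine finite_support_of_pure _ (fun f w₀ => ?_) a
  by_cases h : F.vpar z = 0
  · refine (finite_lieDeriv_single ⟨z, h⟩ f).subset fun I hI h0 => hI ?_
    simp only [pdR, dif_pos h, LinearMap.rTensor_tmul]
    rw [h0, TensorProduct.zero_tmul]
  · refine (finite_contractLeft ⟨z, h⟩ (CliffordAlgebra.reverse w₀)).subset fun I hI h0 => hI ?_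
    simp only [pdR, dif_neg h, LinearMap.lTensor_tmul, LinearMap.flip_apply,
      CliffordAlgebra.contractRight_eq]
    rw [h0, map_zero, TensorProduct.tmul_zero]

theorem finite_evo (X : LocAlg n F) (z : Var Φ) (a : LocAlg n F) :
    (Function.support fun I : MI n => totalDI I X * pdL z I a).Finite :=
  (finite_pdL z a).subset fun I hI h0 => hI (by simp only [h0, mul_zero])

/-- The sum of a locally finite family of linear maps. -/
def locSum {V W : Type u} [AddCommGroup V] [Module ℝ V] [AddCommGroup W] [Module ℝ W] {ι : Type*}
    (T : ι → V →ₗ[ℝ] W) (hT : ∀ a, {i | T i a ≠ 0}.Finite) : V →ₗ[ℝ] W where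
  toFun a := ∑ᶠ i, T i a
  map_add' a b := by
    simp only [map_add]
    exact finsum_add_distrib (hT a) (hT b)
  map_smul' r a := by
    simp only [map_smul, RingHom.id_apply]
    exact (smul_finsum' r (hT a)).symm

/-- Left variational (Euler-Lagrange) derivative `δ^L/δz = ∑_I (-∂)_I ∘ ∂^L/∂z_I`. -/
def eulerL (z : Var Φ) : LocAlg n F →ₗ[ℝ] LocAlg n F :=
  locSum (fun I : MI n => adjDI I ∘ₗ pdL z I) fun a =>
    (finite_pdL z a).subset fun I hI h0 => hI (by rw [LinearMap.comp_apply, h0, map_zero])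

/-- Right variational (Euler-Lagrange) derivative `δ^R/δz = ∑_I (-∂)_I ∘ ∂^R/∂z_I`. -/
def eulerR (z : Var Φ) : LocAlg n F →ₗ[ℝ] LocAlg n F :=
  locSum (fun I : MI n => adjDI I ∘ₗ pdR z I) fun a =>
    (finite_pdR z a).subset fun I hI h0 => hI (by rw [LinearMap.comp_apply, h0, map_zero])

/-! ## Local functionals and antibracket -/

variable (n F) in
/-- Expansions `a = a_0 + a_1 + a_2 + ...` of densities according to the antifield number. -/
abbrev Series : Type u := ℕ → LocAlg n F

variable (n F) in
/-- Densities of ghost number `g`: (formal) sums of local functions `a_k` of ghost number `g` and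
antifield number `k`. -/
def density (g : ℤ) : Submodule ℝ (Series n F) :=
  Submodule.pi Set.univ fun k : ℕ => bigraded g k

variable (n F) in
/-- Total divergences `∂_μ j^μ` of ghost number `g`.  Two densities define the same local functional
if they differ by a total divergence. -/
def divergence (g : ℤ) : Submodule ℝ (Series n F) :=
  ⨆ μ : Fin n, (density n F g).map (LinearMap.compLeft (totalD μ) ℕ)

variable (n F) in
/-- Densities of Grassmann parity `p`. -/
def seriesParity (p : ZMod 2) : Submodule ℝ (Series n F) :=
  Submodule.pi Set.univ fun _ : ℕ => parityPart p

/-- The antibracket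
`(a,b) = δ^R a/δφ^A δ^L b/δφ*_A - δ^R a/δφ*_A δ^L b/δφ^A`
on (densities of) local functionals.  Since `φ*_A` has antifield number `gh A + 1`, the terms
`a_k`, `b_l` contribute to the component of antifield number `k + l - gh A - 1`. -/
def antibracket [Fintype Φ] : Series n F →ₗ[ℝ] Series n F →ₗ[ℝ] Series n F :=
  LinearMap.mk₂ ℝ
    (fun a b m => ∑ A : Φ, ∑ kl ∈ Finset.HasAntidiagonal.antidiagonal (m + F.gh A + 1),
      (eulerR (Sum.inl A) (a kl.1) * eulerL (Sum.inr A) (b kl.2) -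
        eulerR (Sum.inr A) (a kl.1) * eulerL (Sum.inl A) (b kl.2)))
    (fun a a' b => by
      funext m
      simp only [Pi.add_apply, map_add, add_mul, ← Finset.sum_add_distrib]
      exact Finset.sum_congr rfl fun _ _ => Finset.sum_congr rfl fun _ _ => by abel)
    (fun r a b => by
      funext m
      simp only [Pi.smul_apply, map_smul, smul_mul_assoc, ← smul_sub, Finset.smul_sum])
    (fun a b b' => by
      funext m
      simp only [Pi.add_apply, map_add, mul_add, ← Finset.sum_add_distrib]
      exact Finset.sum_congr rfl fun _ _ => Finset.sum_congr rfl fun _ _ => by abel)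
    (fun r a b => by
      funext m
      simp only [Pi.smul_apply, map_smul, mul_smul_comm, ← smul_sub, Finset.smul_sum])

/-- `S` is a solution of the master equation: an even local functional of ghost number `0` with
`½ (S,S) = 0`. -/
structure IsMasterAction [Fintype Φ] (S : Series n F) : Prop where
  ghost_zero : S ∈ density n F 0
  even : S ∈ seriesParity n F 0
  master : (2⁻¹ : ℝ) • antibracket S S ∈ divergence n F 1

/-! ## Local BRST cohomology -/

section Cohomology

variable [Fintype Φ] (S : Series n F)

/-- The BRST differential `s = (·, S)`. -/
def brst : Series n F →ₗ[ℝ] Series n F := antibracket.flip S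

/-- Cocycles of ghost number `g`: densities `a` with `s a = ∂_μ j^μ`. -/
def cocycles (g : ℤ) : Submodule ℝ (Series n F) :=
  density n F g ⊓ (divergence n F (g + 1)).comap (brst S)

/-- Coboundaries of ghost number `g`: densities `s b + ∂_μ j^μ`. -/
def coboundaries (g : ℤ) : Submodule ℝ (Series n F) :=
  (density n F (g - 1)).map (brst S) ⊔ divergence n F g

/-- Local BRST cohomology `H^g(s)`, the cohomology of `s` in the space of local functionals. -/
abbrev H (g : ℤ) : Type u := cocycles S g ⧸ (coboundaries S g).comap (cocycles S g).subtype

/-- The cohomology class of a cocycle. -/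
def cls (g : ℤ) : cocycles S g →ₗ[ℝ] H S g := Submodule.mkQ _

/-- Cohomology classes of Grassmann parity `p`. -/
def parityH (g : ℤ) (p : ZMod 2) : Submodule ℝ (H S g) :=
  ((seriesParity n F p).comap (cocycles S g).subtype).map (cls S g)

/-- The grading of `H^{-1}(s)` for which the antibracket is an even operation: the Grassmann parity,
shifted by one. -/
def shiftedParity (p : ZMod 2) : Submodule ℝ (H S (-1)) := parityH S (-1) (p + 1)

end Cohomology

end Alg

/-! ## Graded Lie algebras and their modules -/

/-- The sign `(-1)^{pq}`. -/
def ksgn (p q : ZMod 2) : ℝ := if p = 1 ∧ q = 1 then -1 else 1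

/-- The bracket `br` makes `L = par 0 ⊕ par 1` a graded (`ℤ/2`) Lie algebra.  If `par 1 = 0` this is
an ordinary Lie algebra. -/
structure IsGradedLie {L : Type u} [AddCommGroup L] [Module ℝ L] (par : ZMod 2 → Submodule ℝ L)
    (br : L →ₗ[ℝ] L →ₗ[ℝ] L) : Prop where
  decomp : IsCompl (par 0) (par 1)
  bracket_mem : ∀ p q x y, x ∈ par p → y ∈ par q → br x y ∈ par (p + q)
  skew : ∀ p q x y, x ∈ par p → y ∈ par q → br x y = -(ksgn p q • br y x)
  jacobi : ∀ p q x y z, x ∈ par p → y ∈ par q →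
    br x (br y z) = br (br x y) z + ksgn p q • br y (br x z)

/-- Graded subalgebras. -/
structure GradedSubalgebra {L : Type u} [AddCommGroup L] [Module ℝ L]
    (par : ZMod 2 → Submodule ℝ L) (br : L →ₗ[ℝ] L →ₗ[ℝ] L) where
  carrier : Submodule ℝ L
  graded : carrier = (carrier ⊓ par 0) ⊔ (carrier ⊓ par 1)
  closed : ∀ x ∈ carrier, ∀ y ∈ carrier, br x y ∈ carrier

/-- `act` makes the graded vector space `M = parM 0 ⊕ parM 1` a module over the graded Lie algebra
`𝔤`. -/
structure IsGradedModule {L : Type u} [AddCommGroup L] [Module ℝ L]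
    {par : ZMod 2 → Submodule ℝ L} {br : L →ₗ[ℝ] L →ₗ[ℝ] L} (𝔤 : GradedSubalgebra par br)
    {M : Type u} [AddCommGroup M] [Module ℝ M] (parM : ZMod 2 → Submodule ℝ M)
    (act : 𝔤.carrier →ₗ[ℝ] M →ₗ[ℝ] M) : Prop where
  decomp : IsCompl (parM 0) (parM 1)
  act_mem : ∀ (p q : ZMod 2) (x : 𝔤.carrier) (m : M), (x : L) ∈ par p → m ∈ parM q →
    act x m ∈ parM (p + q)
  act_bracket : ∀ (p q : ZMod 2) (x y : 𝔤.carrier) (m : M), (x : L) ∈ par p → (y : L) ∈ par q →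
    act ⟨br x y, 𝔤.closed x x.2 y y.2⟩ m = act x (act y m) - ksgn p q • act y (act x m)

/-! ## Proper solutions and variational symmetries -/

section Symmetries

variable {n : ℕ} {F : FieldContent Φ} [Fintype Φ]

/-- The Koszul-Tate differential of `S`: the part of `s` that lowers the antifield number by one.  It
is the evolutionary derivation, acting from the right, with `δ φ^A = 0` and
`δ φ*_A = - δ^L S_k/δφ^A`, `k = gh A`.  Thus `δ φ*_i` is minus the Euler-Lagrange
derivative of the Lagrangian `S_0`, and `δ C*_α` encodes the Noether identities of the generating set
of gauge symmetries. -/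
def koszulTate (S : Series n F) (a : LocAlg n F) : LocAlg n F :=
  -∑ A : Φ, ∑ᶠ I : MI n,
    pdR (Sum.inr A) I a * totalDI I (eulerL (Sum.inl A) (S (F.gh A)))

/-- `S` is proper: its Koszul-Tate differential has no homology in positive antifield number in the
space of local functions.  In antifield number one this says that the gauge symmetries read off from
`S` are a generating set (all Noether identities follow from theirs), in higher antifield number that
the ghosts for ghosts account for all the reducibility identities. -/
def IsProper (S : Series n F) : Prop :=
  ∀ (g : ℤ) (k : ℕ), 1 ≤ k → ∀ a ∈ bigraded (n := n) (F := F) g k, koszulTate S a = 0 →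
    ∃ b ∈ bigraded (n := n) (F := F) (g - 1) (k + 1), koszulTate S b = a

/-- The evolutionary vector field `δ_X = ∑_{A,I} ∂_I X^A ∂^L/∂φ^A_I` with characteristic `X`. -/
def evo : (Φ → LocAlg n F) →ₗ[ℝ] LocAlg n F →ₗ[ℝ] LocAlg n F :=
  LinearMap.mk₂ ℝ
    (fun X a => ∑ A : Φ, ∑ᶠ I : MI n, totalDI I (X A) * pdL (Sum.inl A) I a)
    (fun X Y a => by
      simp only [Pi.add_apply, map_add, add_mul, ← Finset.sum_add_distrib]
      exact Finset.sum_congr rfl fun A _ =>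
        finsum_add_distrib (finite_evo (X A) (Sum.inl A) a) (finite_evo (Y A) (Sum.inl A) a))
    (fun r X a => by
      simp only [Pi.smul_apply, map_smul, smul_mul_assoc, Finset.smul_sum]
      exact Finset.sum_congr rfl fun A _ =>
        (smul_finsum' r (finite_evo (X A) (Sum.inl A) a)).symm)
    (fun X a b => by
      simp only [map_add, mul_add, ← Finset.sum_add_distrib]
      exact Finset.sum_congr rfl fun A _ =>
        finsum_add_distrib (finite_evo (X A) (Sum.inl A) a) (finite_evo (X A) (Sum.inl A) b))
    (fun r X a => by
      simp only [map_smul, mul_smul_comm, Finset.smul_sum]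
      exact Finset.sum_congr rfl fun A _ =>
        (smul_finsum' r (finite_evo (X A) (Sum.inl A) a)).symm)

variable (n F) in
/-- Characteristics: local functions `X^i` of `x`, the original fields and their derivatives, one for
each field of ghost number `g` (`g = 0` for the original fields, `g = 1` for gauge parameters). -/
def characteristics (g : ℕ) : Submodule ℝ (Φ → LocAlg n F) :=
  Submodule.pi Set.univ fun A => if F.gh A = g then bigraded 0 0 else ⊥

/-- Variational symmetries: the Lagrangian `S_0` is invariant up to a total divergence. -/
def varSym (S : Series n F) : Submodule ℝ (Φ → LocAlg n F) :=
  characteristics n F 0 ⊓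
    (⨆ μ : Fin n, (bigraded (n := n) (F := F) 0 0).map (totalD μ)).comap (evo.flip (S 0))

/-- The characteristic of the evolutionary vector field generated on the original fields by the
part `K` of antifield number one of a local functional: `X^i = - δ^R K/δφ*_i`, so that
`K = -∫ X^i φ*_i` for `K` of ghost number `-1`. -/
def charOf (K : LocAlg n F) (A : Φ) : LocAlg n F :=
  if F.gh A = 0 then -eulerR (Sum.inr A) K else 0

/-- The gauge symmetry with field dependent gauge parameters `f^α`: the ghosts `C^α_I` in the
characteristic of `S_1` are replaced by `∂_I f^α`. -/
def gaugeSym (S : Series n F) (f : Φ → LocAlg n F) : Φ → LocAlg n F :=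
  fun A => evo f (charOf (S 1) A)

open Classical in
/-- Elementary on-shell vanishing variational symmetry: for a differential operator `b ∂_I`,
`X^i = b ∂_I L_j` and `X^j = -(±) (-∂)_I (b L_i)`, with `L_i` the Euler-Lagrange derivatives of
the Lagrangian `S_0`.  (The two contributions are added if `i = j`.)  Linear combinations are the
graded skew-adjoint matrix differential operators applied to the Euler-Lagrange derivatives. -/
def onShellTrivial (S : Series n F) (i j : Φ) (I : MI n) (b : LocAlg n F) : Φ → LocAlg n F :=
  (Pi.single i (b * totalDI I (eulerL (Sum.inl j) (S 0))) : Φ → LocAlg n F) -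
    ksgn (F.par i) (F.par j) •
      (Pi.single j (adjDI I (b * eulerL (Sum.inl i) (S 0))) : Φ → LocAlg n F)

/-- Trivial symmetries: linear combinations of gauge symmetries with field dependent parameters and
of on-shell vanishing symmetries. -/
def trivialSym (S : Series n F) : Submodule ℝ (Φ → LocAlg n F) :=
  Submodule.span ℝ
    ({X | ∃ f ∈ characteristics n F 1, X = gaugeSym S f} ∪
      {X | ∃ i j I, ∃ b ∈ bigraded (n := n) (F := F) 0 0, F.gh i = 0 ∧ F.gh j = 0 ∧
        X = onShellTrivial S i j I b})

/-- Equivalence classes of variational symmetries. -/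
abbrev SymClass (S : Series n F) : Type u := varSym S ⧸ (trivialSym S).comap (varSym S).subtype

/-- The class of a variational symmetry. -/
def symCls (S : Series n F) : varSym S →ₗ[ℝ] SymClass S := Submodule.mkQ _

/-- Characteristics for which `δ_X` has parity `p`: `X^i` has parity `p + |φ^i|`. -/
def charParity (p : ZMod 2) : Submodule ℝ (Φ → LocAlg n F) :=
  Submodule.pi Set.univ fun A => parityPart (p + F.par A)

/-- Classes of variational symmetries of parity `p`. -/
def symParity (S : Series n F) (p : ZMod 2) : Submodule ℝ (SymClass S) :=
  ((charParity p).comap (varSym S).subtype).map (symCls S)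

/-- Characteristic of the graded commutator `[δ_X, δ_Y]`, for `δ_X`, `δ_Y` of parities `p`, `q`. -/
def charComm (p q : ZMod 2) (X Y : Φ → LocAlg n F) : Φ → LocAlg n F :=
  fun A => evo X (Y A) - ksgn p q • evo Y (X A)

end Symmetries

end BV

end

/-!
Fields and antifields are treated on the same footing, as variables `z : Var Φ`. A family `X` of
local functions indexed by `z` defines an evolutionary vector field `pro X`, which commutes with
total derivatives, and integration by parts (`lf_pro`) identifies `∫ pro X v` with `∫ X^z δ^L v /
δz`; here `lf` is the class of a local function modulo total divergences.

*The antibracket.* The antibracket of `u` and `v` is, modulo divergences, the action of the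
Hamiltonian vector field `ham u` on `v`. The difference of the two sides of the Jacobi identity
consists of second variations, and these are graded symmetric since graded commutators of
evolutionary vector fields are evolutionary (`lf_hess_symm`). The proof works for any weights `t A`
of the pairs `φ^A`, `φ*_A` (`lb_jacobi`), hence also after polarization in `t` (`lb_jacobi_polar`).
This is needed because the pair `φ^A`, `φ*_A` lowers the antifield number by `gh A + 1`: the
polarized identities can be collected according to the total antifield number, which gives the
Jacobi identity for formal sums of local functions of all antifield numbers (`antibracket_jacobi`).
With `(S, S) = 0` it follows that `s` squares to zero and is a derivation of the antibracket, so
that the antibracket passes to cohomology and makes `H⁻¹(s)` a graded Lie algebra that acts on every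
`H^g(s)` (`isGradedLie`, `isGradedModule`).

*Acyclicity modulo divergences.* Local functions of negative antifield number or negative pure ghost
number vanish, since a smooth function homogeneous of negative degree for nonnegative weights blows
up along the flow of the weight vector field unless it is zero (`eq_zero_of_weightOp_neg`).
Therefore the component of `s` that lowers the antifield number by one, the Koszul-Tate differential
`kt`, is the lowest one (`lf_brst_apply`). It commutes up to sign with the Euler-Lagrange
derivatives with respect to ghosts (`eulerR_kt`), because its characteristics contain no ghosts. If
`kt a` is a divergence and `a` has positive pure ghost number and antifield number, then the
derivatives `δa/δC` are `kt`-closed, hence `kt`-exact by properness, and the Euler homogeneity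
formula (`lf_weightOp`) reassembles the primitives to a primitive of `a` modulo divergences
(`exists_kt_sub_mem`). Induction on the antifield number then shows that a cocycle of ghost number
`g` whose components up to antifield number `M` are trivial is a coboundary if `0 ≤ g + M`
(`exists_primitive`).

*Symmetries.* In ghost number `-1` the component of antifield number one is `-∫ X^i φ*_i` modulo
divergences, with `X` its characteristic (`lf_antifieldTerm`, `charOf_antifieldTerm`), and the first
cocycle condition says that `X` is a variational symmetry. The obstructions to extending `X` to a
cocycle vanish by the same acyclicity, so every variational symmetry arises. A cocycle is a
coboundary if and only if its component of antifield number one is a Koszul-Tate boundary modulo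
divergences, and the characteristics of such boundaries are the trivial symmetries: boundaries of
terms linear in `C*_α` give gauge symmetries, those of terms quadratic in `φ*_i` give on-shell
vanishing ones (`charMap_kt_mem_trivialSym`, `exists_charMap_kt_eq`). The characteristic of an
antibracket is the commutator of the characteristics (`charOf_antibracket`), so that the isomorphism
`symEquiv` transports the graded Lie algebra structure and the modules.
-/

noncomputable section

namespace BV

universe u

section

/-! ### Signs -/

theorem zmod_two_cases (p : ZMod 2) : p = 0 ∨ p = 1 := by
  revert p; decide

theorem sgn_zero : sgn 0 = 1 := by simp [sgn]

theorem sgn_one : sgn 1 = -1 := by simp [sgn]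

theorem sgn_add (p q : ZMod 2) : sgn (p + q) = sgn p * sgn q := by
  rcases zmod_two_cases p with rfl | rfl <;> rcases zmod_two_cases q with rfl | rfl <;>
    simp [sgn_zero, sgn_one, CharTwo.add_self_eq_zero]

theorem sgn_mul_self (p : ZMod 2) : sgn p * sgn p = 1 := by
  rw [← sgn_add, CharTwo.add_self_eq_zero, sgn_zero]

theorem ksgn_eq (p q : ZMod 2) : ksgn p q = sgn (p * q) := by
  rcases zmod_two_cases p with rfl | rfl <;> rcases zmod_two_cases q with rfl | rfl <;>
    simp [sgn_zero, sgn_one, ksgn]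

/-! ### Calculus in the exterior algebra -/

section Exterior

variable {W : Type u} [AddCommGroup W] [Module ℝ W]

open CliffordAlgebra in
theorem exterior_induction {P : ExteriorAlgebra ℝ W → Prop} (h0 : ∀ r : ℝ, P (algebraMap ℝ _ r))
    (hadd : ∀ x y, P x → P y → P (x + y))
    (hmul : ∀ (w : W) (x), P x → P (ExteriorAlgebra.ι ℝ w * x)) (x : ExteriorAlgebra ℝ W) : P x :=
  left_induction (Q := (0 : QuadraticForm ℝ W)) (P := P) h0 hadd
    (fun x m hx => hmul m x hx) x

theorem extHom_ι (T : W →ₗ[ℝ] W) (w : W) : extHom T (ExteriorAlgebra.ι ℝ w) =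
    TrivSqZeroExt.inl (ExteriorAlgebra.ι ℝ w) + TrivSqZeroExt.inr (ExteriorAlgebra.ι ℝ (T w)) := by
  simp [extHom]

theorem extHom_fst (T : W →ₗ[ℝ] W) (a : ExteriorAlgebra ℝ W) : (extHom T a).fst = a := by
  induction a using exterior_induction with
  | h0 r => rw [AlgHom.commutes]; rfl
  | hadd x y hx hy => simp [hx, hy]
  | hmul w x hx => rw [map_mul, TrivSqZeroExt.fst_mul, hx, extHom_ι]; simp

theorem extDer_mul (T : W →ₗ[ℝ] W) (a b : ExteriorAlgebra ℝ W) :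
    extDer T (a * b) = extDer T a * b + a * extDer T b := by
  change (extHom T (a * b)).snd = (extHom T a).snd * b + a * (extHom T b).snd
  rw [map_mul, TrivSqZeroExt.snd_mul, extHom_fst, extHom_fst, add_comm]
  simp

theorem extDer_ι (T : W →ₗ[ℝ] W) (w : W) :
    extDer T (ExteriorAlgebra.ι ℝ w) = ExteriorAlgebra.ι ℝ (T w) := by
  change (extHom T _).snd = _
  rw [extHom_ι]; simp

theorem extDer_algebraMap (T : W →ₗ[ℝ] W) (r : ℝ) :
    extDer T (algebraMap ℝ (ExteriorAlgebra ℝ W) r) = 0 := by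
  change (extHom T _).snd = _
  rw [AlgHom.commutes]; rfl

/-- Two derivations of the exterior algebra commute if they commute on generators. -/
theorem extDer_comm {T U : W →ₗ[ℝ] W} (h : ∀ w, T (U w) = U (T w)) (a : ExteriorAlgebra ℝ W) :
    extDer T (extDer U a) = extDer U (extDer T a) := by
  induction a using exterior_induction with
  | h0 r => simp [extDer_algebraMap]
  | hadd x y hx hy => simp [hx, hy]
  | hmul w x hx =>
    simp only [extDer_mul, extDer_ι, map_add, hx, h]
    abel

/-- The parity involution of the exterior algebra. -/
def extInv : ExteriorAlgebra ℝ W →ₐ[ℝ] ExteriorAlgebra ℝ W :=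
  CliffordAlgebra.involute (Q := (0 : QuadraticForm ℝ W))

theorem extInv_ι (w : W) :
    extInv (ExteriorAlgebra.ι ℝ w) = -(ExteriorAlgebra.ι ℝ w) :=
  CliffordAlgebra.involute_ι (Q := (0 : QuadraticForm ℝ W)) w

theorem extInv_extInv (a : ExteriorAlgebra ℝ W) : extInv (extInv a) = a :=
  CliffordAlgebra.involute_involute a

theorem extInv_extDer (T : W →ₗ[ℝ] W) (a : ExteriorAlgebra ℝ W) :
    extInv (extDer T a) = extDer T (extInv a) := by
  induction a using exterior_induction with
  | h0 r => simp [extDer_algebraMap, AlgHom.commutes]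
  | hadd x y hx hy => simp [hx, hy]
  | hmul w x hx => simp [extDer_mul, extDer_ι, extInv_ι, hx, add_comm]

/-- Left contraction with a linear form. -/
def contrL : Module.Dual ℝ W →ₗ[ℝ] ExteriorAlgebra ℝ W →ₗ[ℝ] ExteriorAlgebra ℝ W :=
  CliffordAlgebra.contractLeft (Q := (0 : QuadraticForm ℝ W))

theorem contrL_ι_mul (d : Module.Dual ℝ W) (w : W) (b : ExteriorAlgebra ℝ W) :
    contrL d (ExteriorAlgebra.ι ℝ w * b) = d w • b - ExteriorAlgebra.ι ℝ w * contrL d b :=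
  CliffordAlgebra.contractLeft_ι_mul (Q := (0 : QuadraticForm ℝ W)) d w b

theorem contrL_algebraMap (d : Module.Dual ℝ W) (r : ℝ) :
    contrL d (algebraMap ℝ (ExteriorAlgebra ℝ W) r) = 0 :=
  CliffordAlgebra.contractLeft_algebraMap (Q := (0 : QuadraticForm ℝ W)) d r

theorem contrL_ι (d : Module.Dual ℝ W) (w : W) :
    contrL d (ExteriorAlgebra.ι ℝ w) = algebraMap ℝ (ExteriorAlgebra ℝ W) (d w) :=
  CliffordAlgebra.contractLeft_ι (Q := (0 : QuadraticForm ℝ W)) d w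

theorem contrL_comm (d d' : Module.Dual ℝ W) (b : ExteriorAlgebra ℝ W) :
    contrL d (contrL d' b) = -contrL d' (contrL d b) :=
  CliffordAlgebra.contractLeft_comm (Q := (0 : QuadraticForm ℝ W)) d d' b

/-- Contraction is a graded derivation. -/
theorem contrL_mul (d : Module.Dual ℝ W) (a b : ExteriorAlgebra ℝ W) :
    contrL d (a * b) = contrL d a * b + extInv a * contrL d b := by
  induction a using exterior_induction with
  | h0 r =>
    rw [contrL_algebraMap, zero_mul, zero_add, AlgHom.commutes, ← Algebra.smul_def, map_smul,
      ← Algebra.smul_def]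
  | hadd x y hx hy => simp only [add_mul, map_add, hx, hy]; abel
  | hmul w x hx =>
    rw [mul_assoc, contrL_ι_mul, hx, contrL_ι_mul, map_mul, extInv_ι]
    simp only [mul_add, sub_mul, smul_mul_assoc, neg_mul, mul_assoc]
    abel

theorem extInv_contrL (d : Module.Dual ℝ W) (a : ExteriorAlgebra ℝ W) :
    contrL d (extInv a) = -extInv (contrL d a) := by
  induction a using exterior_induction with
  | h0 r => simp [AlgHom.commutes, contrL_algebraMap]
  | hadd x y hx hy => simp only [map_add, hx, hy]; abel
  | hmul w x hx =>
    rw [map_mul, extInv_ι, neg_mul, map_neg, contrL_ι_mul, contrL_ι_mul, hx]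
    simp [extInv_ι]

theorem contrL_extDer (d : Module.Dual ℝ W) (T : W →ₗ[ℝ] W) (a : ExteriorAlgebra ℝ W) :
    contrL d (extDer T a) = extDer T (contrL d a) + contrL (d ∘ₗ T) a := by
  induction a using exterior_induction with
  | h0 r => simp [extDer_algebraMap, contrL_algebraMap]
  | hadd x y hx hy => simp only [map_add, hx, hy]; abel
  | hmul w x hx =>
    simp only [extDer_mul, extDer_ι, map_add, map_sub, contrL_ι_mul, hx, mul_add, map_smul,
      LinearMap.comp_apply]
    abel

open CliffordAlgebra in
/-- On the exterior algebra right contraction is left contraction followed by the involution. -/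
theorem contractRight_eq_extInv (d : Module.Dual ℝ W) (a : ExteriorAlgebra ℝ W) :
    contractRight (Q := (0 : QuadraticForm ℝ W)) a d = extInv (contrL d a) := by
  induction a using right_induction with
  | algebraMap r =>
    rw [contractRight_algebraMap]
    exact ((congrArg extInv (contrL_algebraMap d r)).trans (map_zero _)).symm
  | add x y hx hy =>
    rw [map_add, LinearMap.add_apply, hx, hy, ← map_add]
    exact congrArg extInv (map_add (contrL d) x y).symm
  | mul_ι m x hx =>
    rw [contractRight_mul_ι, hx]
    have h1 := contrL_mul d x (ExteriorAlgebra.ι ℝ m)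
    have h2 := congrArg extInv h1
    refine Eq.trans ?_ h2.symm
    rw [contrL_ι, map_add, map_mul, map_mul, extInv_extInv, extInv_ι, AlgHom.commutes, mul_neg,
      ← Algebra.commutes, ← Algebra.smul_def, sub_eq_neg_add]

theorem ι_mul_comm (w : W) (b : ExteriorAlgebra ℝ W) :
    ExteriorAlgebra.ι ℝ w * b = extInv b * ExteriorAlgebra.ι ℝ w := by
  induction b using exterior_induction with
  | h0 r => rw [AlgHom.commutes, Algebra.commutes]
  | hadd x y hx hy => simp only [mul_add, hx, hy, map_add, add_mul]
  | hmul v x hx =>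
    have h : ExteriorAlgebra.ι ℝ w * ExteriorAlgebra.ι ℝ v =
        -(ExteriorAlgebra.ι ℝ v * ExteriorAlgebra.ι ℝ w) :=
      eq_neg_of_add_eq_zero_left (ExteriorAlgebra.ι_add_mul_swap w v)
    rw [← mul_assoc, h, neg_mul, mul_assoc, hx, map_mul, extInv_ι, neg_mul, neg_mul, mul_assoc]

/-- Supercommutativity of the exterior algebra, stated without choosing parities. -/
theorem ext_supercomm (a b : ExteriorAlgebra ℝ W) :
    (2 : ℝ) • (a * b) = b * (a + extInv a) + extInv b * (a - extInv a) := by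
  induction a using exterior_induction generalizing b with
  | h0 r =>
    rw [AlgHom.commutes, sub_self, mul_zero, add_zero, ← two_smul ℝ (algebraMap ℝ _ r),
      mul_smul_comm,
      Algebra.commutes]
  | hadd x y hx hy =>
    simp only [add_mul, smul_add, hx, hy, map_add]
    noncomm_ring
  | hmul w x hx =>
    rw [mul_assoc, ← mul_smul_comm, hx]
    simp only [mul_add, mul_sub, map_mul, extInv_ι, ← mul_assoc, ι_mul_comm w b,
      ι_mul_comm w (extInv b), extInv_extInv, mul_neg, neg_mul]
    abel

end Exterior

end

section

/-! ### Smooth functions of finitely many coordinates -/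

section Smooth

variable {ι : Type u}

open Classical in
/-- Partial derivative of smooth local functions. -/
def pdS (c : ι) : smoothLoc ι →ₗ[ℝ] smoothLoc ι :=
  lieDeriv (fun _ => Pi.single c 1) (fun _ => const_mem _)

theorem lieDeriv_apply (v : (ι → ℝ) → ι → ℝ) (hv) (f : smoothLoc ι) (j : ι → ℝ) :
    (lieDeriv v hv f).1 j = deriv (fun t : ℝ => f.1 (j + t • v j)) 0 := rfl

theorem lieDeriv_mul (v : (ι → ℝ) → ι → ℝ) (hv) (f g : smoothLoc ι) :
    lieDeriv v hv (f * g) = lieDeriv v hv f * g + f * lieDeriv v hv g := by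
  ext j
  have := deriv_fun_mul (differentiableAt_line f j (v j)) (differentiableAt_line g j (v j))
  simp only [zero_smul, add_zero] at this
  exact this

theorem lieDeriv_one (v : (ι → ℝ) → ι → ℝ) (hv) : lieDeriv v hv (1 : smoothLoc ι) = 0 := by
  ext j
  exact deriv_const 0 (1 : ℝ)

theorem lieDeriv_coord (v : (ι → ℝ) → ι → ℝ) (hv) (d : ι) :
    lieDeriv v hv ⟨_, coord_mem d⟩ = ⟨_, hv d⟩ := by
  ext j
  change deriv (fun t : ℝ => (j + t • v j) d) 0 = v j d
  simp

theorem exists_rep (f : smoothLoc ι) (t : Finset ι) : ∃ (s : Finset ι) (g : (s → ℝ) → ℝ), t ⊆ s ∧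
    ContDiff ℝ ∞ g ∧ ∀ j, f.1 j = g (fun c => j c) := by
  classical
  obtain ⟨f, s, g, hg, hf⟩ := f
  exact ⟨s ∪ t, _, Finset.subset_union_right,
    IsLocalSmooth.extend (Finset.subset_union_left) hg, hf⟩

theorem lieDeriv_rep {f : smoothLoc ι} {s : Finset ι} {g : (s → ℝ) → ℝ} (hg : ContDiff ℝ ∞ g)
    (hf : ∀ j, f.1 j = g (fun c => j c)) (v : (ι → ℝ) → ι → ℝ) (hv) (j : ι → ℝ) :
    (lieDeriv v hv f).1 j = fderiv ℝ g (fun c : s => j c) (fun c : s => v j c) := by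
  rw [lieDeriv_apply]
  simp only [hf]
  exact (hasDerivAt_line hg j (v j)).deriv

open Classical in
theorem pdS_rep {f : smoothLoc ι} {s : Finset ι} {g : (s → ℝ) → ℝ} (hg : ContDiff ℝ ∞ g)
    (hf : ∀ j, f.1 j = g (fun c => j c)) (c : s) (j : ι → ℝ) :
    (pdS c.1 f).1 j = fderiv ℝ g (fun c : s => j c) (Pi.single c 1) := by
  rw [pdS, lieDeriv_rep hg hf]
  congr 1
  funext d
  simp only [Pi.single_apply, Subtype.ext_iff]

theorem pdS_rep_of_notMem {f : smoothLoc ι} {s : Finset ι} {g : (s → ℝ) → ℝ}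
    (hg : ContDiff ℝ ∞ g)
    (hf : ∀ j, f.1 j = g (fun c => j c)) {c : ι} (hc : c ∉ s) : pdS c f = 0 := by
  classical
  ext j
  rw [pdS, lieDeriv_rep hg hf]
  have : (fun d : s => (Pi.single c 1 : ι → ℝ) d) = 0 := by
    funext d
    have : d.1 ≠ c := fun h => hc (h ▸ d.2)
    simp [this]
  simp [this]

theorem finite_pdS (f : smoothLoc ι) : {c | pdS c f ≠ 0}.Finite := by
  obtain ⟨s, g, -, hg, hf⟩ := exists_rep f ∅
  refine s.finite_toSet.subset fun c hc => ?_
  by_contra h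
  exact hc (pdS_rep_of_notMem hg hf h)

/-- A vector field acts as the sum of its components times the partial derivatives. -/
theorem lieDeriv_eq_sum (v : (ι → ℝ) → ι → ℝ) (hv : ∀ c, (fun j => v j c) ∈ smoothLoc ι)
    (f : smoothLoc ι) (s : Finset ι) (hs : ∀ c ∉ s, pdS c f = 0) :
    lieDeriv v hv f = ∑ c ∈ s, (⟨_, hv c⟩ : smoothLoc ι) * pdS c f := by
  classical
  obtain ⟨t, g, hst, hg, hf⟩ := exists_rep f s
  have h1 : ∑ c ∈ s, (⟨_, hv c⟩ : smoothLoc ι) * pdS c f =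
      ∑ c ∈ t, (⟨_, hv c⟩ : smoothLoc ι) * pdS c f :=
    Finset.sum_subset hst fun c _ hc => by rw [hs c hc, mul_zero]
  rw [h1, ← Finset.sum_coe_sort]
  ext j
  rw [lieDeriv_rep hg hf]
  simp only [AddSubmonoidClass.coe_finsetSum, Finset.sum_apply]
  conv_lhs => rw [pi_eq_sum_univ' (fun c : t => v j c)]
  rw [map_sum]
  refine Finset.sum_congr rfl fun c _ => ?_
  rw [map_smul, smul_eq_mul]
  change _ = v j c * (pdS c.1 f).1 j
  rw [pdS_rep hg hf]

theorem pdS_comm (c d : ι) (f : smoothLoc ι) : pdS c (pdS d f) = pdS d (pdS c f) := by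
  classical
  obtain ⟨s, g, hs, hg, hf⟩ := exists_rep f {c, d}
  have hsm : ∀ e : s, ContDiff ℝ ∞ (fun y => fderiv ℝ g y (Pi.single e 1)) := fun e =>
    (hg.fderiv_right (m := ∞) (by simp)).clm_apply contDiff_const
  have hdf : Differentiable ℝ (fderiv ℝ g) :=
    (hg.fderiv_right (m := ∞) (by simp)).differentiable (by simp)
  have key : ∀ a b : s, ∀ j, (pdS a.1 (pdS b.1 f)).1 j =
      fderiv ℝ (fderiv ℝ g) (fun c : s => j c) (Pi.single a 1) (Pi.single b 1) := by
    intro a b j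
    rw [pdS_rep (f := pdS b.1 f) (hsm b) (fun j => by rw [pdS_rep hg hf])]
    rw [fderiv_clm_apply (hdf _) (differentiableAt_const _)]
    simp
  let c' : s := ⟨c, hs (by simp)⟩
  let d' : s := ⟨d, hs (by simp)⟩
  ext j
  have h := (hg.contDiffAt (x := fun c : s => j c)).isSymmSndFDerivAt (n := ∞)
    (by rw [minSmoothness_of_isRCLikeNormedField]
        exact WithTop.coe_le_coe.2 (le_top (a := (2 : ℕ∞))))
  exact (key c' d' j).trans ((h.eq _ _).trans (key d' c' j).symm)

theorem pdS_lieDeriv (v : (ι → ℝ) → ι → ℝ) (hv : ∀ c, (fun j => v j c) ∈ smoothLoc ι) (c : ι)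
    (f : smoothLoc ι) (s : Finset ι) (hs : ∀ c ∉ s, pdS c f = 0) :
    pdS c (lieDeriv v hv f) = lieDeriv v hv (pdS c f) +
      ∑ d ∈ s, pdS c (⟨_, hv d⟩ : smoothLoc ι) * pdS d f := by
  rw [lieDeriv_eq_sum v hv f s hs, lieDeriv_eq_sum v hv (pdS c f) s
    (fun d hd => by rw [pdS_comm, hs d hd, map_zero]), map_sum, ← Finset.sum_add_distrib]
  refine Finset.sum_congr rfl fun d _ => ?_
  rw [pdS, lieDeriv_mul, ← pdS, pdS_comm c d, add_comm]

/-- Vector fields that commute on the coordinates commute. -/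
theorem lieDeriv_comm (v v' : (ι → ℝ) → ι → ℝ) (hv : ∀ c, (fun j => v j c) ∈ smoothLoc ι)
    (hv' : ∀ c, (fun j => v' j c) ∈ smoothLoc ι)
    (h : ∀ d, lieDeriv v hv ⟨_, hv' d⟩ = lieDeriv v' hv' ⟨_, hv d⟩) (f : smoothLoc ι) :
    lieDeriv v hv (lieDeriv v' hv' f) = lieDeriv v' hv' (lieDeriv v hv f) := by
  obtain ⟨s, hs⟩ : ∃ s : Finset ι, ∀ c ∉ s, pdS c f = 0 :=
    ⟨(finite_pdS f).toFinset, fun c hc => by simpa using hc⟩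
  have hs' : ∀ d, ∀ c ∉ s, pdS c (pdS d f) = 0 := fun d c hc => by
    rw [pdS_comm, hs c hc, map_zero]
  rw [lieDeriv_eq_sum v' hv' f s hs, lieDeriv_eq_sum v hv f s hs, map_sum, map_sum]
  simp only [lieDeriv_mul, Finset.sum_add_distrib, h]
  congr 1
  simp only [fun d => lieDeriv_eq_sum v hv (pdS d f) s (hs' d),
    fun d => lieDeriv_eq_sum v' hv' (pdS d f) s (hs' d), Finset.mul_sum]
  rw [Finset.sum_comm]
  refine Finset.sum_congr rfl fun c _ => Finset.sum_congr rfl fun d _ => ?_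
  rw [pdS_comm c d]
  ring

open Filter Topology in
/-- A smooth function that is homogeneous of negative degree for nonnegative weights vanishes: along
the flow of the weight vector field it would blow up. -/
theorem eq_zero_of_weight_neg (w : ι → ℝ) (hw : ∀ c, 0 ≤ w c) (v : (ι → ℝ) → ι → ℝ) (hv)
    (hvw : ∀ j c, v j c = w c * j c) (r : ℝ) (hr : r < 0) (f : smoothLoc ι)
    (hf : lieDeriv v hv f = r • f) : f = 0 := by
  obtain ⟨s, g, -, hg, hfg⟩ := exists_rep f ∅
  ext j
  set y : ℝ → s → ℝ := fun t c => Real.exp (w c * t) * j c with hy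
  have hyd : ∀ t, HasDerivAt y (fun c => w c * (Real.exp (w c * t) * j c)) t := by
    intro t
    refine hasDerivAt_pi.2 fun c => ?_
    have := ((((hasDerivAt_id t).const_mul (w c)).exp).mul_const (j c))
    refine this.congr_deriv ?_
    simp; ring
  have hgd : ∀ t, HasDerivAt (fun t => g (y t)) (r * g (y t)) t := by
    intro t
    have h1 := ((hg.differentiable (by simp)).differentiableAt (x := y t)).hasFDerivAt
    have h2 := h1.comp_hasDerivAt t (hyd t)
    refine h2.congr_deriv ?_
    have h3 : (lieDeriv v hv f).1 (fun c => Real.exp (w c * t) * j c) =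
      (r • f).1 (fun c => Real.exp (w c * t) * j c) := by rw [hf]
    rw [lieDeriv_rep hg hfg] at h3
    have h4 : (r • f).1 (fun c => Real.exp (w c * t) * j c) =
      r * f.1 (fun c => Real.exp (w c * t) * j c) := rfl
    rw [h4, hfg] at h3
    rw [← h3]
    simp only [hvw]
    rfl
  have hψ : ∀ t, HasDerivAt (fun t => g (y t) * Real.exp (-r * t)) 0 t := by
    intro t
    refine ((hgd t).mul (((hasDerivAt_id t).const_mul (-r)).exp)).congr_deriv ?_
    simp; ring
  have hconst : ∀ t, g (y t) * Real.exp (-r * t) = f.1 j := by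
    intro t
    have := is_const_of_deriv_eq_zero (f := fun t => g (y t) * Real.exp (-r * t))
      (fun t => (hψ t).differentiableAt) (fun t => (hψ t).deriv) t 0
    rw [this, hfg]
    simp [hy]
  have hlim : Tendsto (fun t => g (y t) * Real.exp (-r * t)) atBot (𝓝 0) := by
    have h1 : Tendsto y atBot (𝓝 fun c => if w c = 0 then j c else 0) := by
      refine tendsto_pi_nhds.2 fun c => ?_
      by_cases hc : w c = 0
      · simp [hy, hc]
      · have hc' : 0 < w c := lt_of_le_of_ne (hw c) (Ne.symm hc)
        have h2 : Tendsto (fun t => Real.exp (w c * t)) atBot (𝓝 0) :=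
          Real.tendsto_exp_atBot.comp (tendsto_id.const_mul_atBot hc')
        simpa [hc, hy] using h2.mul_const (j c)
    have h3 : Tendsto (fun t => Real.exp (-r * t)) atBot (𝓝 0) :=
      Real.tendsto_exp_atBot.comp (tendsto_id.const_mul_atBot (by linarith))
    simpa using ((hg.continuous.tendsto _).comp h1).mul h3
  have := tendsto_nhds_unique (hlim.congr hconst) tendsto_const_nhds
  exact this.symm

end Smooth

end

section

variable {Φ : Type u} {n : ℕ} {F : FieldContent Φ}

/-! ### The graded algebra of local functions -/

theorem loc_induction {P : LocAlg n F → Prop} (a : LocAlg n F) (h0 : P 0)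
    (hadd : ∀ x y, P x → P y → P (x + y)) (ht : ∀ f w, P (f ⊗ₜ w)) : P a :=
  TensorProduct.induction_on a h0 ht hadd

theorem tmul_mul (f g : EvenAlg n F) (v w : OddAlg n F) :
    ((f ⊗ₜ v : LocAlg n F) * (g ⊗ₜ w : LocAlg n F)) = (f * g) ⊗ₜ (v * w) :=
  Algebra.TensorProduct.tmul_mul_tmul f g v w

theorem parInv_tmul (f : EvenAlg n F) (w : OddAlg n F) :
    parInv (f ⊗ₜ w : LocAlg n F) = f ⊗ₜ extInv w := rfl

theorem parInv_parInv (a : LocAlg n F) : parInv (parInv a) = a := by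
  induction a using loc_induction with
  | h0 => simp
  | hadd x y hx hy => simp [hx, hy]
  | ht f w => rw [parInv_tmul, parInv_tmul, extInv_extInv]

theorem parInv_mul (a b : LocAlg n F) : parInv (a * b) = parInv a * parInv b := by
  induction a using loc_induction with
  | h0 => simp
  | hadd x y hx hy => simp [hx, hy, add_mul]
  | ht f w =>
    induction b using loc_induction with
    | h0 => simp
    | hadd x y hx hy => simp [hx, hy, mul_add]
    | ht g v => simp only [tmul_mul, parInv_tmul, map_mul]

/-- Supercommutativity of local functions, stated without choosing parities. -/
theorem supercomm (a b : LocAlg n F) :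
    (2 : ℝ) • (a * b) = b * (a + parInv a) + parInv b * (a - parInv a) := by
  induction a using loc_induction with
  | h0 => simp
  | hadd x y hx hy =>
    simp only [add_mul, smul_add, hx, hy, map_add]
    noncomm_ring
  | ht f w =>
    induction b using loc_induction with
    | h0 => simp
    | hadd x y hx hy =>
      simp only [mul_add, smul_add, hx, hy, map_add, add_mul]
      noncomm_ring
    | ht g v =>
      rw [parInv_tmul, parInv_tmul, ← TensorProduct.tmul_add, ← TensorProduct.tmul_sub, tmul_mul,
        tmul_mul, tmul_mul, mul_comm g f, ← TensorProduct.tmul_add, ← ext_supercomm,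
        TensorProduct.tmul_smul]

/-- The `p`-fold parity automorphism. -/
def tw (p : ZMod 2) : LocAlg n F →ₗ[ℝ] LocAlg n F := if p = 0 then LinearMap.id else parInv

theorem tw_zero (a : LocAlg n F) : tw 0 a = a := by rw [tw, if_pos rfl]; rfl

theorem tw_one (a : LocAlg n F) : tw 1 a = parInv a := by rw [tw, if_neg one_ne_zero]

theorem tw_mul (p : ZMod 2) (a b : LocAlg n F) : tw p (a * b) = tw p a * tw p b := by
  rcases zmod_two_cases p with rfl | rfl <;> simp [tw_zero, tw_one, parInv_mul]

theorem tw_add (p q : ZMod 2) (a : LocAlg n F) : tw (p + q) a = tw p (tw q a) := by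
  rcases zmod_two_cases p with rfl | rfl <;> rcases zmod_two_cases q with rfl | rfl <;>
    simp [tw_zero, tw_one, parInv_parInv, CharTwo.add_self_eq_zero]

theorem tw_tw_comm (p q : ZMod 2) (a : LocAlg n F) : tw p (tw q a) = tw q (tw p a) := by
  rw [← tw_add, ← tw_add, add_comm]

theorem mem_parityPart {p : ZMod 2} {a : LocAlg n F} : a ∈ parityPart p ↔ parInv a = sgn p • a := by
  rw [parityPart, LinearMap.mem_ker, LinearMap.sub_apply, sub_eq_zero]; rfl

theorem tw_of_mem {p q : ZMod 2} {a : LocAlg n F} (ha : a ∈ parityPart q) :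
    tw p a = sgn (p * q) • a := by
  rw [mem_parityPart] at ha
  rcases zmod_two_cases p with rfl | rfl <;> simp [tw_zero, tw_one, ha, sgn_zero]

theorem mul_comm_of_mem {p q : ZMod 2} {a b : LocAlg n F} (ha : a ∈ parityPart p)
    (hb : b ∈ parityPart q) : a * b = sgn (p * q) • (b * a) := by
  have h := supercomm a b
  rw [mem_parityPart] at ha hb
  rw [ha, hb] at h
  have h2 : (2 : ℝ) • (a * b) = (2 : ℝ) • (sgn (p * q) • (b * a)) := by
    rw [h]
    rcases zmod_two_cases p with rfl | rfl <;> rcases zmod_two_cases q with rfl | rfl <;>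
      simp [sgn_zero, sgn_one, two_smul, mul_add]
  exact smul_right_injective _ (two_ne_zero) h2

/-- An element of parity `p` can be moved through `b` at the expense of a twist of `b`. -/
theorem mul_eq_tw_mul {p : ZMod 2} {a : LocAlg n F} (ha : a ∈ parityPart p) (b : LocAlg n F) :
    a * b = tw p b * a := by
  have h := supercomm a b
  rw [mem_parityPart] at ha
  rw [ha] at h
  have h2 : (2 : ℝ) • (a * b) = (2 : ℝ) • (tw p b * a) := by
    rw [h]
    rcases zmod_two_cases p with rfl | rfl <;>
      simp [sgn_zero, sgn_one, tw_zero, tw_one, two_smul, mul_add]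
  exact smul_right_injective _ (two_ne_zero) h2

theorem mul_mem_parityPart {p q : ZMod 2} {a b : LocAlg n F} (ha : a ∈ parityPart p)
    (hb : b ∈ parityPart q) : a * b ∈ parityPart (p + q) := by
  rw [mem_parityPart] at *
  rw [parInv_mul, ha, hb, sgn_add, smul_mul_smul_comm]

/-! ### Partial derivatives of local functions -/

theorem pdL_even {z : Var Φ} (h : F.vpar z = 0) (I : MI n) (f : EvenAlg n F) (w : OddAlg n F) :
    pdL z I (f ⊗ₜ w : LocAlg n F) = pdS (Sum.inr (⟨z, h⟩, I) : Coord n F) f ⊗ₜ w := by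
  rw [pdL, dif_pos h, LinearMap.rTensor_tmul, pdS]
  congr!

theorem pdL_odd {z : Var Φ} (h : ¬ F.vpar z = 0) (I : MI n) (f : EvenAlg n F) (w : OddAlg n F) :
    pdL z I (f ⊗ₜ w : LocAlg n F) =
      f ⊗ₜ contrL (Finsupp.lapply ((⟨z, h⟩, I) : OddJet n F)) w := by
  rw [pdL, dif_neg h]
  rfl

theorem pdR_eq (z : Var Φ) (I : MI n) (a : LocAlg n F) :
    pdR z I a = tw (F.vpar z) (pdL z I a) := by
  by_cases h : F.vpar z = 0
  · rw [pdR, dif_pos h, pdL, dif_pos h, h, tw_zero]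
  · have h1 : F.vpar z = 1 := (zmod_two_cases _).resolve_left h
    induction a using loc_induction with
    | h0 => simp
    | hadd x y hx hy => simp only [map_add, hx, hy]
    | ht f w =>
      rw [pdL_odd h, h1, tw_one, parInv_tmul, ← contractRight_eq_extInv, pdR, dif_neg h]
      rfl

theorem pdS_mul {ι : Type u} (c : ι) (f g : smoothLoc ι) :
    pdS c (f * g) = pdS c f * g + f * pdS c g := lieDeriv_mul _ _ f g

theorem pdL_mul (z : Var Φ) (I : MI n) (a b : LocAlg n F) :
    pdL z I (a * b) = pdL z I a * b + tw (F.vpar z) a * pdL z I b := by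
  induction a using loc_induction with
  | h0 => simp
  | hadd x y hx hy => simp only [add_mul, map_add, hx, hy]; abel
  | ht f w =>
    induction b using loc_induction with
    | h0 => simp
    | hadd x y hx hy => simp only [mul_add, map_add, hx, hy]; abel
    | ht g v =>
      by_cases h : F.vpar z = 0
      · rw [h, tw_zero, tmul_mul, pdL_even h, pdL_even h, pdL_even h, tmul_mul, tmul_mul,
          ← TensorProduct.add_tmul, pdS_mul]
      · have h1 : F.vpar z = 1 := (zmod_two_cases _).resolve_left h
        rw [h1, tw_one, tmul_mul, pdL_odd h, pdL_odd h, pdL_odd h, parInv_tmul, tmul_mul, tmul_mul,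
          ← TensorProduct.tmul_add, contrL_mul]

theorem pdL_parInv (z : Var Φ) (I : MI n) (a : LocAlg n F) :
    pdL z I (parInv a) = sgn (F.vpar z) • parInv (pdL z I a) := by
  induction a using loc_induction with
  | h0 => simp
  | hadd x y hx hy => simp only [map_add, hx, hy, smul_add]
  | ht f w =>
    by_cases h : F.vpar z = 0
    · rw [h, sgn_zero, one_smul, parInv_tmul, pdL_even h, pdL_even h, parInv_tmul]
    · have h1 : F.vpar z = 1 := (zmod_two_cases _).resolve_left h
      rw [h1, sgn_one, parInv_tmul, pdL_odd h, pdL_odd h, parInv_tmul, extInv_contrL,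
        TensorProduct.tmul_neg, neg_one_smul]

theorem pdL_tw (z : Var Φ) (I : MI n) (p : ZMod 2) (a : LocAlg n F) :
    pdL z I (tw p a) = sgn (p * F.vpar z) • tw p (pdL z I a) := by
  rcases zmod_two_cases p with rfl | rfl <;> simp [tw_zero, tw_one, pdL_parInv, sgn_zero]

theorem pdL_mem_parityPart {p : ZMod 2} {a : LocAlg n F} (ha : a ∈ parityPart p) (z : Var Φ)
    (I : MI n) : pdL z I a ∈ parityPart (p + F.vpar z) := by
  have h := pdL_parInv z I a
  rw [mem_parityPart] at *
  rw [ha, map_smul] at h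
  rw [add_comm, sgn_add, mul_smul, h, smul_smul, sgn_mul_self, one_smul]

/-- Left partial derivatives commute in the graded sense. -/
theorem pdL_comm (z w : Var Φ) (I J : MI n) (a : LocAlg n F) :
    pdL z I (pdL w J a) = sgn (F.vpar z * F.vpar w) • pdL w J (pdL z I a) := by
  induction a using loc_induction with
  | h0 => simp
  | hadd x y hx hy => simp only [map_add, hx, hy, smul_add]
  | ht f v =>
    by_cases h : F.vpar z = 0 <;> by_cases h' : F.vpar w = 0
    · rw [h, zero_mul, sgn_zero, one_smul, pdL_even h, pdL_even h', pdL_even h, pdL_even h',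
        pdS_comm]
    · rw [h, zero_mul, sgn_zero, one_smul, pdL_even h, pdL_odd h', pdL_even h, pdL_odd h']
    · rw [h', mul_zero, sgn_zero, one_smul, pdL_even h', pdL_odd h, pdL_odd h, pdL_even h']
    · have h1 : F.vpar z = 1 := (zmod_two_cases _).resolve_left h
      have h1' : F.vpar w = 1 := (zmod_two_cases _).resolve_left h'
      rw [h1, h1', mul_one, sgn_one, pdL_odd h, pdL_odd h', pdL_odd h, pdL_odd h', contrL_comm,
        TensorProduct.tmul_neg, neg_one_smul]

theorem pdL_comm_self (z : Var Φ) (I J : MI n) (w : Var Φ) {a : LocAlg n F} (h : pdL z I a = 0) :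
    pdL z I (pdL w J a) = 0 := by
  rw [pdL_comm, h, map_zero, smul_zero]

/-! ### Total derivatives -/

/-- The action of the total derivative on the odd generators. -/
abbrev shiftOdd (μ : Fin n) : (OddJet n F →₀ ℝ) →ₗ[ℝ] (OddJet n F →₀ ℝ) :=
  Finsupp.lmapDomain ℝ ℝ fun q : OddJet n F => (q.1, q.2 + Finsupp.single μ 1)

theorem totalD_tmul (μ : Fin n) (f : EvenAlg n F) (w : OddAlg n F) :
    totalD μ (f ⊗ₜ w : LocAlg n F) =
      lieDeriv (totalVF μ) (totalVF_mem μ) f ⊗ₜ w + f ⊗ₜ extDer (shiftOdd μ) w := rfl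

/-- The action of the number operator on the odd generators. -/
abbrev weightOdd (w : Var Φ → ℤ) : (OddJet n F →₀ ℝ) →ₗ[ℝ] (OddJet n F →₀ ℝ) :=
  Finsupp.lsum ℝ fun q : OddJet n F => (w q.1.1 : ℝ) • Finsupp.lsingle q

theorem weightOp_tmul (w : Var Φ → ℤ) (f : EvenAlg n F) (v : OddAlg n F) :
    weightOp w (f ⊗ₜ v : LocAlg n F) =
      lieDeriv (weightVF w) (weightVF_mem w) f ⊗ₜ v + f ⊗ₜ extDer (weightOdd w) v := rfl

theorem totalD_mul (μ : Fin n) (a b : LocAlg n F) :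
    totalD μ (a * b) = totalD μ a * b + a * totalD μ b := by
  induction a using loc_induction with
  | h0 => simp
  | hadd x y hx hy => simp only [add_mul, map_add, hx, hy]; abel
  | ht f w =>
    induction b using loc_induction with
    | h0 => simp
    | hadd x y hx hy => simp only [mul_add, map_add, hx, hy]; abel
    | ht g v =>
      simp only [tmul_mul, totalD_tmul, add_mul, mul_add, lieDeriv_mul, extDer_mul,
        TensorProduct.add_tmul, TensorProduct.tmul_add]
      abel

theorem weightOp_mul (c : Var Φ → ℤ) (a b : LocAlg n F) :
    weightOp c (a * b) = weightOp c a * b + a * weightOp c b := by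
  induction a using loc_induction with
  | h0 => simp
  | hadd x y hx hy => simp only [add_mul, map_add, hx, hy]; abel
  | ht f w =>
    induction b using loc_induction with
    | h0 => simp
    | hadd x y hx hy => simp only [mul_add, map_add, hx, hy]; abel
    | ht g v =>
      simp only [tmul_mul, weightOp_tmul, add_mul, mul_add, lieDeriv_mul, extDer_mul,
        TensorProduct.add_tmul, TensorProduct.tmul_add]
      abel

theorem totalD_parInv (μ : Fin n) (a : LocAlg n F) :
    totalD μ (parInv a) = parInv (totalD μ a) := by
  induction a using loc_induction with
  | h0 => simp
  | hadd x y hx hy => simp only [map_add, hx, hy]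
  | ht f w => simp only [totalD_tmul, parInv_tmul, map_add, extInv_extDer]

theorem weightOp_parInv (c : Var Φ → ℤ) (a : LocAlg n F) :
    weightOp c (parInv a) = parInv (weightOp c a) := by
  induction a using loc_induction with
  | h0 => simp
  | hadd x y hx hy => simp only [map_add, hx, hy]
  | ht f w => simp only [weightOp_tmul, parInv_tmul, map_add, extInv_extDer]

theorem lieDeriv_const {ι : Type u} (v : (ι → ℝ) → ι → ℝ) (hv) (r : ℝ) :
    lieDeriv v hv ⟨fun _ => r, const_mem r⟩ = 0 := by
  ext j
  exact deriv_const 0 r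

theorem totalVF_comm (μ ν : Fin n) (d : Coord n F) :
    lieDeriv (totalVF μ) (totalVF_mem μ) ⟨_, totalVF_mem ν d⟩ =
      lieDeriv (totalVF ν) (totalVF_mem ν) ⟨_, totalVF_mem μ d⟩ := by
  rcases d with κ | ⟨z, I⟩
  · exact (lieDeriv_const _ _ _).trans (lieDeriv_const _ _ _).symm
  · refine (lieDeriv_coord _ _ _).trans (Eq.trans ?_ (lieDeriv_coord _ _ _).symm)
    ext j
    simp only [totalVF, add_right_comm]

theorem totalD_comm (μ ν : Fin n) (a : LocAlg n F) :
    totalD μ (totalD ν a) = totalD ν (totalD μ a) := by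
  induction a using loc_induction with
  | h0 => simp
  | hadd x y hx hy => simp only [map_add, hx, hy]
  | ht f w =>
    have h1 := lieDeriv_comm _ _ (totalVF_mem (F := F) μ) (totalVF_mem ν) (totalVF_comm μ ν) f
    have h2 : extDer (shiftOdd μ) (extDer (shiftOdd ν) w) =
        extDer (shiftOdd ν) (extDer (shiftOdd μ) w) := by
      refine extDer_comm (fun x => ?_) w
      simp only [shiftOdd, Finsupp.lmapDomain_apply, ← Finsupp.mapDomain_comp]
      congr 1
      funext q
      simp [add_right_comm]
    simp only [totalD_tmul, map_add, h1, h2]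
    abel

theorem weightVF_totalVF_comm (c : Var Φ → ℤ) (μ : Fin n) (d : Coord n F) :
    lieDeriv (weightVF c) (weightVF_mem c) ⟨_, totalVF_mem μ d⟩ =
      lieDeriv (totalVF μ) (totalVF_mem μ) ⟨_, weightVF_mem c d⟩ := by
  rcases d with κ | ⟨z, I⟩
  · exact (lieDeriv_const _ _ _).trans (lieDeriv_const _ _ _).symm
  · refine (lieDeriv_coord _ _ _).trans ?_
    have : (⟨_, weightVF_mem c (Sum.inr (z, I))⟩ : EvenAlg n F) =
      (c z : ℝ) • ⟨_, coord_mem (Sum.inr (z, I))⟩ := rfl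
    rw [this, map_smul, lieDeriv_coord]
    rfl

theorem weightOdd_single (c : Var Φ → ℤ) (q : OddJet n F) (r : ℝ) :
    weightOdd c (Finsupp.single q r) = Finsupp.single q ((c q.1.1 : ℝ) * r) := by
  simp [weightOdd]

theorem weightOp_totalD (c : Var Φ → ℤ) (μ : Fin n) (a : LocAlg n F) :
    weightOp c (totalD μ a) = totalD μ (weightOp c a) := by
  induction a using loc_induction with
  | h0 => simp
  | hadd x y hx hy => simp only [map_add, hx, hy]
  | ht f w =>
    have h1 := lieDeriv_comm _ _ (weightVF_mem (F := F) c) (totalVF_mem μ)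
      (weightVF_totalVF_comm c μ) f
    have h2 : extDer (weightOdd c) (extDer (shiftOdd μ) w) =
        extDer (shiftOdd μ) (extDer (weightOdd c) w) := by
      refine extDer_comm (fun x => ?_) w
      induction x using Finsupp.induction_linear with
      | zero => simp
      | add x y hx hy => simp only [map_add, hx, hy]
      | single q r =>
        rw [weightOdd_single, Finsupp.lmapDomain_apply, Finsupp.lmapDomain_apply,
          Finsupp.mapDomain_single, Finsupp.mapDomain_single, weightOdd_single]
    simp only [totalD_tmul, weightOp_tmul, map_add, h1, h2]
    abel

open Classical in
theorem pdS_coord {ι : Type u} (c d : ι) :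
    pdS c (⟨_, coord_mem d⟩ : smoothLoc ι) = if c = d then 1 else 0 := by
  rw [pdS, lieDeriv_coord]
  ext j
  by_cases h : c = d
  · subst h; simp
  · rw [if_neg h]; simp [Ne.symm h]

theorem pdS_lieDeriv_single {ι : Type u} (v : (ι → ℝ) → ι → ℝ)
    (hv : ∀ c, (fun j => v j c) ∈ smoothLoc ι) (c e : ι) (r : ℝ)
    (h : pdS c (⟨_, hv e⟩ : smoothLoc ι) = r • 1)
    (h' : ∀ d, d ≠ e → pdS c (⟨_, hv d⟩ : smoothLoc ι) = 0) (f : smoothLoc ι) :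
    pdS c (lieDeriv v hv f) = lieDeriv v hv (pdS c f) + r • pdS e f := by
  classical
  rw [pdS_lieDeriv v hv c f (insert e (finite_pdS f).toFinset)
    (fun c hc => by_contra fun h => hc (Finset.mem_insert_of_mem (by simpa using h)))]
  congr 1
  rw [Finset.sum_eq_single e (fun d _ hd => by rw [h' d hd, zero_mul])
    (fun hn => absurd (Finset.mem_insert_self _ _) hn), h, smul_one_mul]

theorem pdS_lieDeriv_zero {ι : Type u} (v : (ι → ℝ) → ι → ℝ)
    (hv : ∀ c, (fun j => v j c) ∈ smoothLoc ι) (c : ι)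
    (h' : ∀ d, pdS c (⟨_, hv d⟩ : smoothLoc ι) = 0) (f : smoothLoc ι) :
    pdS c (lieDeriv v hv f) = lieDeriv v hv (pdS c f) := by
  classical
  rw [pdS_lieDeriv v hv c f (finite_pdS f).toFinset (fun c hc => by simpa using hc)]
  simp [h']

theorem pdS_const {ι : Type u} (c : ι) (r : ℝ) :
    pdS c (⟨fun _ => r, const_mem r⟩ : smoothLoc ι) = 0 := lieDeriv_const _ _ _

theorem pdL_add_totalD (z : Var Φ) (I : MI n) (μ : Fin n) (a : LocAlg n F) :
    pdL z (I + Finsupp.single μ 1) (totalD μ a) =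
      totalD μ (pdL z (I + Finsupp.single μ 1) a) + pdL z I a := by
  classical
  induction a using loc_induction with
  | h0 => simp
  | hadd x y hx hy => simp only [map_add, hx, hy]; abel
  | ht f w =>
    rw [totalD_tmul, map_add]
    by_cases h : F.vpar z = 0
    · have key := pdS_lieDeriv_single (totalVF μ) (totalVF_mem μ)
        (Sum.inr (⟨z, h⟩, I + Finsupp.single μ 1) : Coord n F) (Sum.inr (⟨z, h⟩, I)) 1
        ((pdS_coord _ _).trans (by simp)) (by
          rintro (κ | ⟨z', J⟩) hd
          · exact pdS_const _ _
          · refine (pdS_coord _ _).trans (if_neg fun he => hd ?_)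
            simpa using he.symm) f
      rw [pdL_even h, pdL_even h, pdL_even h, pdL_even h, totalD_tmul, key, one_smul,
        TensorProduct.add_tmul]
      abel
    · have : (Finsupp.lapply ((⟨z, h⟩, I + Finsupp.single μ 1) : OddJet n F) :
          (OddJet n F →₀ ℝ) →ₗ[ℝ] ℝ) ∘ₗ shiftOdd μ = Finsupp.lapply ((⟨z, h⟩, I) : OddJet n F) := by
        ext q
        rw [LinearMap.comp_apply, LinearMap.comp_apply, Finsupp.lsingle_apply,
          Finsupp.lmapDomain_apply, Finsupp.mapDomain_single]
        simp [Finsupp.single_apply, Prod.ext_iff]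
      rw [pdL_odd h, pdL_odd h, pdL_odd h, pdL_odd h, totalD_tmul, contrL_extDer, this,
        TensorProduct.tmul_add, add_assoc]

theorem pdL_totalD_of_eq_zero (z : Var Φ) (I : MI n) (μ : Fin n) (hI : I μ = 0) (a : LocAlg n F) :
    pdL z I (totalD μ a) = totalD μ (pdL z I a) := by
  classical
  have hne : ∀ J : MI n, J + Finsupp.single μ 1 ≠ I := fun J hJ => by
    have := DFunLike.congr_fun hJ μ
    simp [hI] at this
  induction a using loc_induction with
  | h0 => simp
  | hadd x y hx hy => simp only [map_add, hx, hy]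
  | ht f w =>
    rw [totalD_tmul, map_add]
    by_cases h : F.vpar z = 0
    · have key := pdS_lieDeriv_zero (totalVF μ) (totalVF_mem μ)
        (Sum.inr (⟨z, h⟩, I) : Coord n F) (by
          rintro (κ | ⟨z', J⟩)
          · exact pdS_const _ _
          · refine (pdS_coord _ _).trans (if_neg fun he => hne J ?_)
            simp at he
            exact he.2.symm) f
      rw [pdL_even h, pdL_even h, pdL_even h, totalD_tmul, key]
    · rw [pdL_odd h, pdL_odd h, pdL_odd h, totalD_tmul, contrL_extDer]
      have : (Finsupp.lapply ((⟨z, h⟩, I) : OddJet n F) : (OddJet n F →₀ ℝ) →ₗ[ℝ] ℝ) ∘ₗ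
          shiftOdd μ = 0 := by
        ext q
        rw [LinearMap.comp_apply, LinearMap.comp_apply, Finsupp.lsingle_apply,
          Finsupp.lmapDomain_apply, Finsupp.mapDomain_single]
        simp [hne]
      rw [this, map_zero, LinearMap.zero_apply, add_zero]

theorem pdL_weightOp (c : Var Φ → ℤ) (z : Var Φ) (I : MI n) (a : LocAlg n F) :
    pdL z I (weightOp c a) = weightOp c (pdL z I a) + (c z : ℝ) • pdL z I a := by
  classical
  induction a using loc_induction with
  | h0 => simp
  | hadd x y hx hy => simp only [map_add, hx, hy, smul_add]; abel
  | ht f w =>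
    rw [weightOp_tmul, map_add]
    have hc : ∀ d e : EvenJet n F, pdS (Sum.inr d) (⟨_, weightVF_mem c (Sum.inr e)⟩ : EvenAlg n F) =
        (c e.1 : ℝ) • if (Sum.inr d : Coord n F) = Sum.inr e then 1 else 0 := fun d e => by
      have : (⟨_, weightVF_mem c (Sum.inr e)⟩ : EvenAlg n F) =
        (c e.1 : ℝ) • ⟨_, coord_mem (Sum.inr e)⟩ := rfl
      rw [this, map_smul, pdS_coord]
      congr!
    by_cases h : F.vpar z = 0
    · have key := pdS_lieDeriv_single (weightVF c) (weightVF_mem c)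
        (Sum.inr (⟨z, h⟩, I) : Coord n F) (Sum.inr (⟨z, h⟩, I)) (c z)
        ((hc _ _).trans (by simp)) (by
          rintro (κ | ⟨z', J⟩) hd
          · exact pdS_const _ _
          · rw [hc, if_neg (Ne.symm hd), smul_zero]) f
      rw [pdL_even h, pdL_even h, pdL_even h, weightOp_tmul, key,
        TensorProduct.add_tmul, TensorProduct.smul_tmul']
      abel
    · rw [pdL_odd h, pdL_odd h, pdL_odd h, weightOp_tmul, contrL_extDer,
        TensorProduct.tmul_add, add_assoc, ← TensorProduct.tmul_smul]
      have : (Finsupp.lapply ((⟨z, h⟩, I) : OddJet n F) : (OddJet n F →₀ ℝ) →ₗ[ℝ] ℝ) ∘ₗ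
          weightOdd c = (c z : ℝ) • Finsupp.lapply ((⟨z, h⟩, I) : OddJet n F) := by
        ext q
        rw [LinearMap.comp_apply, LinearMap.comp_apply, Finsupp.lsingle_apply, weightOdd_single]
        by_cases hq : q = (⟨z, h⟩, I)
        · subst hq; simp
        · simp [hq]
      rw [this, map_smul, LinearMap.smul_apply]

end

section

variable {Φ : Type u} {n : ℕ} {F : FieldContent Φ}

/-! ### Iterated total derivatives -/

theorem totalD_list_add_single (μ : Fin n) (I : MI n) (l : List (Fin n)) (hl : l.Nodup) :
    (l.map fun ν => (totalD ν : Module.End ℝ (LocAlg n F)) ^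
      (I + Finsupp.single μ 1 : MI n) ν).prod =
      (if μ ∈ l then totalD μ else 1) *
        (l.map fun ν => (totalD ν : Module.End ℝ (LocAlg n F)) ^ I ν).prod := by
  induction l with
  | nil => simp
  | cons κ l ih =>
    obtain ⟨h1, h2⟩ := List.nodup_cons.1 hl
    rw [List.map_cons, List.prod_cons, List.map_cons, List.prod_cons, ih h2]
    by_cases hκ : μ = κ
    · subst hκ
      rw [if_neg h1, if_pos (by simp), one_mul, ← mul_assoc, Finsupp.add_apply,
        Finsupp.single_eq_same, pow_succ']
    · have h3 : (I + Finsupp.single μ 1 : MI n) κ = I κ := by simp [hκ]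
      rw [h3]
      by_cases hm : μ ∈ l
      · have hc : Commute ((totalD κ : Module.End ℝ (LocAlg n F)) ^ I κ) (totalD μ) :=
          Commute.pow_left (LinearMap.ext fun a => totalD_comm κ μ a) _
        rw [if_pos hm, if_pos (by simp [hm]), ← mul_assoc, ← mul_assoc, hc.eq]
      · rw [if_neg hm, if_neg (by simp [hm, hκ]), one_mul, one_mul]

theorem totalDI_zero (a : LocAlg n F) : totalDI 0 a = a := by
  have : (totalDI 0 : Module.End ℝ (LocAlg n F)) = 1 := by
    rw [totalDI, List.ofFn_eq_map]
    exact List.prod_eq_one fun x hx => by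
      obtain ⟨ν, -, rfl⟩ := List.mem_map.1 hx
      simp
  rw [this, Module.End.one_apply]

theorem totalDI_add_single (I : MI n) (μ : Fin n) (a : LocAlg n F) :
    totalDI (I + Finsupp.single μ 1) a = totalD μ (totalDI I a) := by
  have := totalD_list_add_single (F := F) μ I _ (List.nodup_finRange n)
  rw [if_pos (List.mem_finRange μ)] at this
  rw [totalDI, totalDI, List.ofFn_eq_map, List.ofFn_eq_map, this]
  rfl

/-- Induction on multi-indices. -/
theorem mi_induction {P : MI n → Prop} (I : MI n) (h0 : P 0)
    (hs : ∀ I μ, P I → P (I + Finsupp.single μ 1)) : P I := by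
  have key : ∀ (k : ℕ) (μ : Fin n) (I : MI n), P I → P (I + Finsupp.single μ k) := by
    intro k
    induction k with
    | zero => intro μ I h; simpa using h
    | succ k ih =>
      intro μ I h
      rw [Finsupp.single_add, ← add_assoc]
      exact hs _ _ (ih μ I h)
  induction I using Finsupp.induction_linear with
  | zero => exact h0
  | add f g _ _ =>
    have : ∀ g f : MI n, P f → P (f + g) := by
      intro g
      induction g using Finsupp.induction with
      | zero => intro f hf; simpa using hf
      | single_add μ k g _ _ ih =>
        intro f hf
        rw [← add_assoc]
        exact ih _ (key k μ f hf)
    simpa using this (f + g) 0 h0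
  | single μ k => simpa using key k μ 0 h0

/-- An operator commuting with all total derivatives commutes with the iterated ones. -/
theorem comm_totalDI {T : LocAlg n F →ₗ[ℝ] LocAlg n F}
    (h : ∀ μ a, T (totalD μ a) = totalD μ (T a)) (I : MI n) (a : LocAlg n F) :
    T (totalDI I a) = totalDI I (T a) := by
  induction I using mi_induction with
  | h0 => simp only [totalDI_zero]
  | hs I μ ih => rw [totalDI_add_single, totalDI_add_single, h, ih]

theorem adjDI_apply (I : MI n) (a : LocAlg n F) :
    adjDI I a = (-1 : ℝ) ^ (∑ μ : Fin n, I μ) • totalDI I a := rfl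

theorem adjDI_zero (a : LocAlg n F) : adjDI 0 a = a := by
  rw [adjDI_apply, totalDI_zero]; simp only [Finsupp.coe_zero, Pi.zero_apply,
    Finset.sum_const_zero, pow_zero, one_smul]

theorem adjDI_add_single (I : MI n) (μ : Fin n) (a : LocAlg n F) :
    adjDI (I + Finsupp.single μ 1) a = -totalD μ (adjDI I a) := by
  have : ∑ ν : Fin n, (I + Finsupp.single μ 1 : MI n) ν = ∑ ν : Fin n, I ν + 1 := by
    simp [Finset.sum_add_distrib, Finsupp.single_apply]
  rw [adjDI_apply, adjDI_apply, totalDI_add_single, this, pow_succ, map_smul, mul_smul,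
    neg_one_smul, smul_neg]

theorem comm_adjDI {T : LocAlg n F →ₗ[ℝ] LocAlg n F}
    (h : ∀ μ a, T (totalD μ a) = totalD μ (T a)) (I : MI n) (a : LocAlg n F) :
    T (adjDI I a) = adjDI I (T a) := by
  rw [adjDI_apply, map_smul, comm_totalDI h, adjDI_apply]

theorem totalD_adjDI (I : MI n) (μ : Fin n) (a : LocAlg n F) :
    totalD μ (adjDI I a) = adjDI I (totalD μ a) :=
  comm_adjDI (fun ν b => totalD_comm μ ν b) I a

theorem tw_totalD (p : ZMod 2) (μ : Fin n) (a : LocAlg n F) :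
    tw p (totalD μ a) = totalD μ (tw p a) := by
  rcases zmod_two_cases p with rfl | rfl <;> simp only [tw_zero, tw_one, totalD_parInv]

theorem totalDI_mem_parityPart {p : ZMod 2} {a : LocAlg n F} (ha : a ∈ parityPart p) (I : MI n) :
    totalDI I a ∈ parityPart p := by
  rw [mem_parityPart] at *
  rw [comm_totalDI (fun μ b => (totalD_parInv μ b).symm), ha, map_smul]

/-! ### Jet coordinates -/

/-- The (anti)field derivative `z_I` as a local function. -/
def jet (z : Var Φ) (I : MI n) : LocAlg n F :=
  open Classical in
  if h : F.vpar z = 0 then (⟨_, coord_mem (Sum.inr (⟨z, h⟩, I))⟩ : EvenAlg n F) ⊗ₜ (1 : OddAlg n F)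
  else (1 : EvenAlg n F) ⊗ₜ ExteriorAlgebra.ι ℝ (Finsupp.single ((⟨z, h⟩, I) : OddJet n F) 1)

theorem jet_even {z : Var Φ} (h : F.vpar z = 0) (I : MI n) : (jet z I : LocAlg n F) =
    (⟨_, coord_mem (Sum.inr (⟨z, h⟩, I))⟩ : EvenAlg n F) ⊗ₜ (1 : OddAlg n F) := by
  rw [jet, dif_pos h]

theorem jet_odd {z : Var Φ} (h : ¬ F.vpar z = 0) (I : MI n) : (jet z I : LocAlg n F) =
    (1 : EvenAlg n F) ⊗ₜ ExteriorAlgebra.ι ℝ (Finsupp.single ((⟨z, h⟩, I) : OddJet n F) 1) := by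
  rw [jet, dif_neg h]

theorem jet_mem_parityPart (z : Var Φ) (I : MI n) :
    (jet z I : LocAlg n F) ∈ parityPart (F.vpar z) := by
  rw [mem_parityPart]
  by_cases h : F.vpar z = 0
  · rw [jet_even h, h, sgn_zero, one_smul, parInv_tmul, map_one]
  · rw [jet_odd h, (zmod_two_cases _).resolve_left h, sgn_one, parInv_tmul, extInv_ι,
      TensorProduct.tmul_neg, neg_one_smul]

theorem contrL_one {W : Type u} [AddCommGroup W] [Module ℝ W] (d : Module.Dual ℝ W) :
    contrL d (1 : ExteriorAlgebra ℝ W) = 0 := by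
  rw [← map_one (algebraMap ℝ (ExteriorAlgebra ℝ W)), contrL_algebraMap]

theorem extDer_one {W : Type u} [AddCommGroup W] [Module ℝ W] (T : W →ₗ[ℝ] W) :
    extDer T (1 : ExteriorAlgebra ℝ W) = 0 := by
  rw [← map_one (algebraMap ℝ (ExteriorAlgebra ℝ W)), extDer_algebraMap]

theorem pdS_one {ι : Type u} (c : ι) : pdS c (1 : smoothLoc ι) = 0 := lieDeriv_one _ _

open Classical in
theorem pdL_jet (z w : Var Φ) (I J : MI n) :
    pdL z I (jet w J : LocAlg n F) = if w = z ∧ J = I then 1 else 0 := by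
  by_cases h : F.vpar z = 0 <;> by_cases h' : F.vpar w = 0
  · rw [jet_even h', pdL_even h, pdS_coord]
    by_cases hc : w = z ∧ J = I
    · obtain ⟨rfl, rfl⟩ := hc
      simp only [if_true, and_self, Algebra.TensorProduct.one_def]
    · rw [if_neg hc, if_neg (fun he => hc (by simpa [eq_comm] using he)), TensorProduct.zero_tmul]
  · rw [jet_odd h', pdL_even h, pdS_one, TensorProduct.zero_tmul, if_neg]
    rintro ⟨rfl, -⟩
    exact h' h
  · rw [jet_even h', pdL_odd h, contrL_one, TensorProduct.tmul_zero, if_neg]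
    rintro ⟨rfl, -⟩
    exact h h'
  · rw [jet_odd h', pdL_odd h, contrL_ι, Finsupp.lapply_apply, Finsupp.single_apply]
    by_cases hc : w = z ∧ J = I
    · obtain ⟨rfl, rfl⟩ := hc
      simp only [if_true, and_self, Algebra.TensorProduct.one_def, map_one]
    · rw [if_neg hc, if_neg (fun he => hc (by simpa using he)), map_zero, TensorProduct.tmul_zero]

theorem totalD_jet (μ : Fin n) (z : Var Φ) (I : MI n) :
    totalD μ (jet z I : LocAlg n F) = jet z (I + Finsupp.single μ 1) := by
  by_cases h : F.vpar z = 0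
  · rw [jet_even h, jet_even h, totalD_tmul, lieDeriv_coord, extDer_one, TensorProduct.tmul_zero,
      add_zero]
    rfl
  · rw [jet_odd h, jet_odd h, totalD_tmul, lieDeriv_one, TensorProduct.zero_tmul, zero_add,
      extDer_ι, Finsupp.lmapDomain_apply, Finsupp.mapDomain_single]

theorem totalDI_jet (I : MI n) (z : Var Φ) : totalDI I (jet z 0 : LocAlg n F) = jet z I := by
  induction I using mi_induction with
  | h0 => rw [totalDI_zero]
  | hs I μ ih => rw [totalDI_add_single, ih, totalD_jet]

theorem weightOp_jet (c : Var Φ → ℤ) (z : Var Φ) (I : MI n) :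
    weightOp c (jet z I : LocAlg n F) = (c z : ℝ) • jet z I := by
  by_cases h : F.vpar z = 0
  · rw [jet_even h, weightOp_tmul, lieDeriv_coord, extDer_one, TensorProduct.tmul_zero,
      add_zero, TensorProduct.smul_tmul']
    rfl
  · rw [jet_odd h, weightOp_tmul, lieDeriv_one, TensorProduct.zero_tmul, zero_add,
      extDer_ι, weightOdd_single, ← TensorProduct.tmul_smul, ← map_smul, Finsupp.smul_single,
      smul_eq_mul]

/-! ### Vector fields on the jet space -/

/-- Every local function depends on finitely many jet coordinates. -/
theorem exists_pdL_support [Fintype Φ] (a : LocAlg n F) :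
    ∃ s : Finset (Var Φ × MI n), ∀ q ∉ s, pdL q.1 q.2 a = 0 := by
  have h : (⋃ z : Var Φ, Prod.mk z '' {I : MI n | pdL z I a ≠ 0}).Finite :=
    Set.finite_iUnion fun z => (finite_pdL z a).image _
  refine ⟨h.toFinset, fun q hq => ?_⟩
  by_contra hc
  exact hq (h.mem_toFinset.2 (Set.mem_iUnion.2 ⟨q.1, q.2, hc, rfl⟩))

theorem finite_pdL_pair [Fintype Φ] (a : LocAlg n F) :
    {q : Var Φ × MI n | pdL q.1 q.2 a ≠ 0}.Finite := by
  obtain ⟨s, hs⟩ := exists_pdL_support a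
  exact s.finite_toSet.subset fun q hq => by_contra fun h => hq (hs q h)

/-- The vector field `∑ V_q ∂^L/∂q` in the direction of the fields and antifields. -/
def vf [Fintype Φ] (V : Var Φ × MI n → LocAlg n F) : LocAlg n F →ₗ[ℝ] LocAlg n F :=
  locSum (fun q : Var Φ × MI n => LinearMap.mulLeft ℝ (V q) ∘ₗ pdL q.1 q.2) fun a =>
    (finite_pdL_pair a).subset fun q hq h0 => hq (by
      rw [LinearMap.comp_apply, h0, map_zero])

theorem vf_eq_sum [Fintype Φ] (V : Var Φ × MI n → LocAlg n F) (a : LocAlg n F)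
    (s : Finset (Var Φ × MI n)) (hs : ∀ q ∉ s, pdL q.1 q.2 a = 0) :
    vf V a = ∑ q ∈ s, V q * pdL q.1 q.2 a := by
  change ∑ᶠ q : Var Φ × MI n, V q * pdL q.1 q.2 a = _
  refine finsum_eq_sum_of_support_subset _ fun q hq => ?_
  by_contra h
  exact hq (by simp only [hs q h, mul_zero])

theorem vf_mul [Fintype Φ] {V : Var Φ × MI n → LocAlg n F} {p : ZMod 2}
    (hV : ∀ q, V q ∈ parityPart (p + F.vpar q.1)) (a b : LocAlg n F) :
    vf V (a * b) = vf V a * b + tw p a * vf V b := by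
  classical
  obtain ⟨s, hs⟩ := exists_pdL_support a
  obtain ⟨t, ht⟩ := exists_pdL_support b
  have hs' : ∀ q ∉ s ∪ t, pdL q.1 q.2 a = 0 := fun q hq => hs q (by
    simp only [Finset.mem_union, not_or] at hq; exact hq.1)
  have ht' : ∀ q ∉ s ∪ t, pdL q.1 q.2 b = 0 := fun q hq => ht q (by
    simp only [Finset.mem_union, not_or] at hq; exact hq.2)
  rw [vf_eq_sum V a _ hs', vf_eq_sum V b _ ht', vf_eq_sum V (a * b) (s ∪ t) (fun q hq => by
    rw [pdL_mul, hs' q hq, ht' q hq, zero_mul, mul_zero, add_zero]), Finset.sum_mul,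
    Finset.mul_sum, ← Finset.sum_add_distrib]
  refine Finset.sum_congr rfl fun q _ => ?_
  rw [pdL_mul, mul_add, mul_assoc, ← mul_assoc (V q) (tw _ a), mul_eq_tw_mul (hV q) (tw _ a),
    ← tw_add, add_assoc, CharTwo.add_self_eq_zero, add_zero, mul_assoc]

/-- The even derivations of the algebra of local functions are determined by their values on smooth
functions and on the odd generators. -/
theorem derivation_ext {D D' : LocAlg n F →ₗ[ℝ] LocAlg n F}
    (hD : ∀ a b, D (a * b) = D a * b + a * D b) (hD' : ∀ a b, D' (a * b) = D' a * b + a * D' b)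
    (h : ∀ f : EvenAlg n F, D (f ⊗ₜ 1) = D' (f ⊗ₜ 1))
    (h' : ∀ z I, D (jet z I) = D' (jet z I)) (a : LocAlg n F) : D a = D' a := by
  have hodd : ∀ w : OddAlg n F, D ((1 : EvenAlg n F) ⊗ₜ w) = D' ((1 : EvenAlg n F) ⊗ₜ w) := by
    intro w
    induction w using exterior_induction with
    | h0 r =>
      rw [Algebra.algebraMap_eq_smul_one, TensorProduct.tmul_smul, map_smul, map_smul, h]
    | hadd x y hx hy => rw [TensorProduct.tmul_add, map_add, map_add, hx, hy]
    | hmul v x hx =>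
      have h1 : ((1 : EvenAlg n F) ⊗ₜ (ExteriorAlgebra.ι ℝ v * x) : LocAlg n F) =
          (1 : EvenAlg n F) ⊗ₜ ExteriorAlgebra.ι ℝ v * (1 : EvenAlg n F) ⊗ₜ x := by
        rw [tmul_mul, one_mul]
      have h2 : D ((1 : EvenAlg n F) ⊗ₜ ExteriorAlgebra.ι ℝ v) =
          D' ((1 : EvenAlg n F) ⊗ₜ ExteriorAlgebra.ι ℝ v) := by
        induction v using Finsupp.induction_linear with
        | zero => rw [map_zero, TensorProduct.tmul_zero, map_zero, map_zero]
        | add x y hx hy =>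
          rw [map_add, TensorProduct.tmul_add, map_add, map_add, hx (by rw [tmul_mul, one_mul]),
            hy (by rw [tmul_mul, one_mul])]
        | single q r =>
          have h3 := h' q.1.1 q.2
          rw [jet_odd q.1.2] at h3
          have h4 : Finsupp.single q r = r • (Finsupp.single q 1 : OddJet n F →₀ ℝ) := by simp
          rw [h4, map_smul, TensorProduct.tmul_smul, map_smul, map_smul]
          exact congrArg (r • ·) h3
      rw [h1, hD, hD', hx, h2]
  induction a using loc_induction with
  | h0 => rw [map_zero, map_zero]
  | hadd x y hx hy => rw [map_add, map_add, hx, hy]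
  | ht f w =>
    have h1 : (f ⊗ₜ w : LocAlg n F) = f ⊗ₜ (1 : OddAlg n F) * (1 : EvenAlg n F) ⊗ₜ w := by
      rw [tmul_mul, one_mul, mul_one]
    rw [h1, hD, hD', h, hodd]

open Classical in
theorem vf_jet [Fintype Φ] (V : Var Φ × MI n → LocAlg n F) (z : Var Φ) (I : MI n) :
    vf V (jet z I) = V (z, I) := by
  rw [vf_eq_sum V _ {(z, I)} (fun q hq => by
    rw [pdL_jet, if_neg]
    rintro ⟨rfl, rfl⟩
    exact hq (Finset.mem_singleton_self _))]
  rw [Finset.sum_singleton, pdL_jet, if_pos ⟨rfl, rfl⟩, mul_one]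

/-- The number operators count jet coordinates. -/
theorem weightOp_eq_vf [Fintype Φ] (c : Var Φ → ℤ) (a : LocAlg n F) :
    weightOp c a = vf (fun q => (c q.1 : ℝ) • jet q.1 q.2) a := by
  classical
  refine derivation_ext (weightOp_mul c) (fun a b => ?_) (fun f => ?_) (fun z I => ?_) a
  · have := vf_mul (F := F) (p := 0) (V := fun q => (c q.1 : ℝ) • jet q.1 q.2) (fun q => by
      rw [zero_add]; exact Submodule.smul_mem _ _ (jet_mem_parityPart q.1 q.2)) a b
    rwa [tw_zero] at this
  · set t := (finite_pdS f).toFinset with ht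
    have ht' : ∀ c ∉ t, pdS c f = 0 := fun c hc => by simpa [ht] using hc
    have e : Function.Injective fun q : EvenJet n F => ((q.1.1, q.2) : Var Φ × MI n) := by
      rintro ⟨⟨z, hz⟩, I⟩ ⟨⟨w, hw⟩, J⟩ h
      simpa using h
    rw [vf_eq_sum _ _ (t.toRight.image fun q : EvenJet n F => ((q.1.1, q.2) : Var Φ × MI n))]
    · rw [Finset.sum_image e.injOn, weightOp_tmul, extDer_one, TensorProduct.tmul_zero, add_zero,
        lieDeriv_eq_sum _ _ f t ht', ← Finset.toLeft_disjSum_toRight (u := t), Finset.sum_disjSum,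
        Finset.toRight_disjSum]
      have h0 : ∑ x ∈ t.toLeft, (⟨_, weightVF_mem c (Sum.inl x)⟩ : EvenAlg n F) *
          pdS (Sum.inl x) f = 0 := Finset.sum_eq_zero fun x _ => zero_mul _
      rw [h0, zero_add, TensorProduct.sum_tmul]
      refine Finset.sum_congr rfl fun q _ => ?_
      have h1 : (⟨_, weightVF_mem c (Sum.inr q)⟩ : EvenAlg n F) =
        (c q.1.1 : ℝ) • ⟨_, coord_mem (Sum.inr q)⟩ := rfl
      rw [h1, pdL_even q.1.2, jet_even q.1.2, smul_mul_assoc, smul_mul_assoc, tmul_mul, mul_one,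
        TensorProduct.smul_tmul']
    · rintro ⟨z, I⟩ hq
      by_cases h : F.vpar z = 0
      · rw [pdL_even h, ht', TensorProduct.zero_tmul]
        intro hm
        exact hq (Finset.mem_image.2 ⟨(⟨z, h⟩, I), Finset.mem_toRight.2 hm, rfl⟩)
      · rw [pdL_odd h, contrL_one, TensorProduct.tmul_zero]
  · rw [weightOp_jet, vf_jet]

/-! ### Absence of negative degrees -/

/-- The exterior algebra is spanned by weight vectors, of nonnegative weight if the generators have
nonnegative weights. -/
theorem span_weight_vectors (c : Var Φ → ℤ) (hc : ∀ z, 0 ≤ c z) :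
    ⊤ ≤ Submodule.span ℝ
      {w : OddAlg n F | ∃ k : ℝ, 0 ≤ k ∧ extDer (weightOdd c) w = k • w} := by
  intro w _
  induction w using exterior_induction with
  | h0 r => exact Submodule.subset_span ⟨0, le_rfl, by rw [extDer_algebraMap, zero_smul]⟩
  | hadd x y hx hy => exact Submodule.add_mem _ (hx trivial) (hy trivial)
  | hmul v x hx =>
    refine Submodule.span_induction (p := fun x _ => ExteriorAlgebra.ι ℝ v * x ∈ Submodule.span ℝ
      {w : OddAlg n F | ∃ k : ℝ, 0 ≤ k ∧ extDer (weightOdd c) w = k • w}) ?_ ?_ ?_ ?_ (hx trivial)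
    · rintro x ⟨k, hk, hx⟩
      clear * - hx hk hc
      induction v using Finsupp.induction_linear with
      | zero => rw [map_zero, zero_mul]; exact Submodule.zero_mem _
      | add v v' h h' => rw [map_add, add_mul]; exact Submodule.add_mem _ h h'
      | single q r =>
        refine Submodule.subset_span ⟨c q.1.1 + k, by
          have := hc q.1.1
          positivity, ?_⟩
        rw [extDer_mul, extDer_ι, weightOdd_single, hx, ← smul_eq_mul (c q.1.1 : ℝ) r,
          ← Finsupp.smul_single, map_smul, smul_mul_assoc, mul_smul_comm, add_smul]
    · rw [mul_zero]; exact Submodule.zero_mem _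
    · intro x y _ _ h h'; rw [mul_add]; exact Submodule.add_mem _ h h'
    · intro r x _ h; rw [mul_smul_comm]; exact Submodule.smul_mem _ _ h

/-- There are no local functions of negative degree with respect to nonnegative weights. -/
theorem eq_zero_of_weightOp_neg (c : Var Φ → ℤ) (hc : ∀ z, 0 ≤ c z) (r : ℝ) (hr : r < 0)
    (a : LocAlg n F) (ha : weightOp c a = r • a) : a = 0 := by
  classical
  let B := Module.Basis.ofSpan (span_weight_vectors (n := n) (F := F) c hc)
  have hB : ∀ i, ∃ k : ℝ, 0 ≤ k ∧ extDer (weightOdd c) (B i) = k • B i := fun i =>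
    Module.Basis.ofSpan_subset (span_weight_vectors (n := n) (F := F) c hc) ⟨i, rfl⟩
  choose k hk hBk using hB
  let e : LocAlg n F ≃ₗ[ℝ] _ := TensorProduct.equivFinsuppOfBasisRight (M := EvenAlg n F) B
  have hrepr : ∀ i w, B.repr (extDer (weightOdd c) w) i = k i * B.repr w i := by
    intro i w
    have : B.coord i ∘ₗ extDer (weightOdd c) = k i • B.coord i := by
      refine B.ext fun j => ?_
      rw [LinearMap.comp_apply, hBk, LinearMap.smul_apply, map_smul, smul_eq_mul, smul_eq_mul]
      by_cases h : j = i
      · rw [h]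
      · simp [Module.Basis.coord_apply, h]
    exact LinearMap.congr_fun this w
  have hcomp : ∀ i x, e (weightOp c x) i =
      lieDeriv (weightVF c) (weightVF_mem c) (e x i) + k i • e x i := by
    intro i x
    induction x using loc_induction with
    | h0 =>
      rw [map_zero, LinearEquiv.map_zero, Finsupp.coe_zero, Pi.zero_apply, map_zero, smul_zero,
        add_zero]
    | hadd x y hx hy =>
      rw [map_add, LinearEquiv.map_add, LinearEquiv.map_add, Finsupp.add_apply, Finsupp.add_apply,
        hx, hy, map_add, smul_add]
      abel
    | ht f w =>
      rw [weightOp_tmul, LinearEquiv.map_add, Finsupp.add_apply,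
        TensorProduct.equivFinsuppOfBasisRight_apply_tmul_apply,
        TensorProduct.equivFinsuppOfBasisRight_apply_tmul_apply,
        TensorProduct.equivFinsuppOfBasisRight_apply_tmul_apply, hrepr, map_smul, smul_smul]
  have hzero : e a = 0 := by
    ext1 i
    have h1 := hcomp i a
    rw [ha, LinearEquiv.map_smul, Finsupp.smul_apply] at h1
    refine eq_zero_of_weight_neg (fun d : Coord n F => Sum.elim (fun _ => 0) (fun q => c q.1.1) d)
      (fun d => ?_) (weightVF c) (weightVF_mem c) (fun j d => ?_) (r - k i)
      (by have := hk i; linarith) _ ?_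
    · rcases d with d | q
      · exact le_rfl
      · exact Int.cast_nonneg (hc q.1.1)
    · rcases d with d | q
      · exact (zero_mul _).symm
      · rfl
    · rw [sub_smul, h1, add_sub_cancel_right]
  rw [← e.symm_apply_apply a, hzero, LinearEquiv.map_zero]

end

section

variable {Φ : Type u} {n : ℕ} {F : FieldContent Φ}

/-! ### Ghost number and antifield number -/

theorem mem_bigraded {g k : ℤ} {a : LocAlg n F} : a ∈ bigraded g k ↔
    weightOp F.vgh a = (g : ℝ) • a ∧ weightOp F.vaf a = (k : ℝ) • a := by
  rw [bigraded, Submodule.mem_inf, LinearMap.mem_ker, LinearMap.mem_ker, LinearMap.sub_apply,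
    LinearMap.sub_apply, sub_eq_zero, sub_eq_zero]
  rfl

theorem mul_mem_bigraded {g k g' k' : ℤ} {a b : LocAlg n F} (ha : a ∈ bigraded g k)
    (hb : b ∈ bigraded g' k') : a * b ∈ bigraded (g + g') (k + k') := by
  rw [mem_bigraded] at *
  rw [weightOp_mul, weightOp_mul, ha.1, ha.2, hb.1, hb.2]
  simp only [smul_mul_assoc, mul_smul_comm, ← add_smul, Int.cast_add, and_self]

theorem totalD_mem_bigraded {g k : ℤ} {a : LocAlg n F} (ha : a ∈ bigraded g k) (μ : Fin n) :
    totalD μ a ∈ bigraded g k := by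
  rw [mem_bigraded] at *
  rw [weightOp_totalD, weightOp_totalD, ha.1, ha.2, map_smul, map_smul]
  exact ⟨rfl, rfl⟩

theorem totalDI_mem_bigraded {g k : ℤ} {a : LocAlg n F} (ha : a ∈ bigraded g k) (I : MI n) :
    totalDI I a ∈ bigraded g k := by
  induction I using mi_induction with
  | h0 => rwa [totalDI_zero]
  | hs I μ ih => rw [totalDI_add_single]; exact totalD_mem_bigraded ih μ

theorem adjDI_mem_bigraded {g k : ℤ} {a : LocAlg n F} (ha : a ∈ bigraded g k) (I : MI n) :
    adjDI I a ∈ bigraded g k :=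
  Submodule.smul_mem _ _ (totalDI_mem_bigraded ha I)

theorem parInv_mem_bigraded {g k : ℤ} {a : LocAlg n F} (ha : a ∈ bigraded g k) :
    parInv a ∈ bigraded g k := by
  rw [mem_bigraded] at *
  rw [weightOp_parInv, weightOp_parInv, ha.1, ha.2, map_smul, map_smul]
  exact ⟨rfl, rfl⟩

theorem tw_mem_bigraded {g k : ℤ} {a : LocAlg n F} (p : ZMod 2) (ha : a ∈ bigraded g k) :
    tw p a ∈ bigraded g k := by
  rcases zmod_two_cases p with rfl | rfl
  · rwa [tw_zero]
  · rw [tw_one]; exact parInv_mem_bigraded ha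

theorem pdL_mem_bigraded {g k : ℤ} {a : LocAlg n F} (ha : a ∈ bigraded g k) (z : Var Φ) (I : MI n) :
    pdL z I a ∈ bigraded (g - F.vgh z) (k - F.vaf z) := by
  rw [mem_bigraded] at *
  have h1 := pdL_weightOp F.vgh z I a
  have h2 := pdL_weightOp F.vaf z I a
  rw [ha.1, map_smul] at h1
  rw [ha.2, map_smul] at h2
  constructor
  · rw [Int.cast_sub, sub_smul, h1, add_sub_cancel_right]
  · rw [Int.cast_sub, sub_smul, h2, add_sub_cancel_right]

theorem jet_mem_bigraded (z : Var Φ) (I : MI n) :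
    (jet z I : LocAlg n F) ∈ bigraded (F.vgh z) (F.vaf z) :=
  mem_bigraded.2 ⟨weightOp_jet _ _ _, weightOp_jet _ _ _⟩

theorem bigraded_eq_zero_of_af {g k : ℤ} (hk : k < 0) {a : LocAlg n F} (ha : a ∈ bigraded g k) :
    a = 0 := by
  refine eq_zero_of_weightOp_neg F.vaf (fun z => ?_) k (Int.cast_lt_zero.2 hk) a
    (mem_bigraded.1 ha).2
  rcases z with A | A
  · exact le_rfl
  · simp only [FieldContent.vaf]; positivity

/-- The pure ghost number, for which only the fields count. -/
def pureGh (F : FieldContent Φ) (z : Var Φ) : ℤ := F.vgh z + F.vaf z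

theorem pureGh_inl (A : Φ) : pureGh F (Sum.inl A) = F.gh A := by
  simp [pureGh, FieldContent.vgh, FieldContent.vaf]

theorem pureGh_inr (A : Φ) : pureGh F (Sum.inr A) = 0 := by
  simp [pureGh, FieldContent.vgh, FieldContent.vaf]

section Fin

variable [Fintype Φ]

theorem vf_add (V V' : Var Φ × MI n → LocAlg n F) (a : LocAlg n F) :
    vf (fun q => V q + V' q) a = vf V a + vf V' a := by
  obtain ⟨s, hs⟩ := exists_pdL_support a
  rw [vf_eq_sum _ a s hs, vf_eq_sum _ a s hs, vf_eq_sum _ a s hs, ← Finset.sum_add_distrib]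
  exact Finset.sum_congr rfl fun q _ => add_mul _ _ _

theorem vf_smul (r : ℝ) (V : Var Φ × MI n → LocAlg n F) (a : LocAlg n F) :
    vf (fun q => r • V q) a = r • vf V a := by
  obtain ⟨s, hs⟩ := exists_pdL_support a
  rw [vf_eq_sum _ a s hs, vf_eq_sum _ a s hs, Finset.smul_sum]
  exact Finset.sum_congr rfl fun q _ => smul_mul_assoc _ _ _

theorem weightOp_pureGh {g k : ℤ} {a : LocAlg n F} (ha : a ∈ bigraded g k) :
    weightOp (pureGh F) a = ((g + k : ℤ) : ℝ) • a := by
  have h : weightOp (pureGh F) a = weightOp F.vgh a + weightOp F.vaf a := by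
    rw [weightOp_eq_vf, weightOp_eq_vf, weightOp_eq_vf, ← vf_add]
    congr 2
    funext q
    rw [pureGh, Int.cast_add, add_smul]
  rw [h, (mem_bigraded.1 ha).1, (mem_bigraded.1 ha).2, ← add_smul, Int.cast_add]

/-- There are no local functions of negative pure ghost number, the sum of the ghost number and the
antifield number. -/
theorem bigraded_eq_zero_of_pgh {g k : ℤ} (hk : g + k < 0) {a : LocAlg n F}
    (ha : a ∈ bigraded g k) : a = 0 := by
  refine eq_zero_of_weightOp_neg (pureGh F) (fun z => ?_) _ (Int.cast_lt_zero.2 hk) a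
    (weightOp_pureGh ha)
  rcases z with A | A
  · rw [pureGh_inl]; positivity
  · rw [pureGh_inr]

end Fin

/-! ### Total divergences of bounded degree -/

variable (n F) in
/-- Total divergences of local functions of ghost number `g` and antifield number `k`. -/
def locDiv (g k : ℤ) : Submodule ℝ (LocAlg n F) :=
  ⨆ μ : Fin n, (bigraded g k).map (totalD μ)

theorem locDiv_le_bigraded (g k : ℤ) : locDiv n F g k ≤ bigraded g k :=
  iSup_le fun μ => Submodule.map_le_iff_le_comap.2 fun _ ha => totalD_mem_bigraded ha μ

variable (n F) in
/-- Local functions with finitely many components of definite degrees. -/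
def locFin : Submodule ℝ (LocAlg n F) := ⨆ i : ℤ × ℤ, bigraded i.1 i.2

variable (n F) in
/-- Total divergences of elements of `locFin`. -/
def locFinDiv : Submodule ℝ (LocAlg n F) := ⨆ i : ℤ × ℤ, locDiv n F i.1 i.2

theorem bigraded_le_locFin (g k : ℤ) : bigraded g k ≤ locFin n F :=
  le_iSup (fun i : ℤ × ℤ => bigraded (n := n) (F := F) i.1 i.2) (g, k)

theorem locDiv_le_locFinDiv (g k : ℤ) : locDiv n F g k ≤ locFinDiv n F :=
  le_iSup (fun i : ℤ × ℤ => locDiv n F i.1 i.2) (g, k)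

theorem locFin_le {N : Submodule ℝ (LocAlg n F)} (h : ∀ g k, ∀ a ∈ bigraded g k, a ∈ N) :
    locFin n F ≤ N := iSup_le fun i => h i.1 i.2

theorem locFin_map {T : LocAlg n F →ₗ[ℝ] LocAlg n F}
    (h : ∀ g k, ∀ a ∈ bigraded g k, T a ∈ locFin n F) {a : LocAlg n F} (ha : a ∈ locFin n F) :
    T a ∈ locFin n F :=
  locFin_le (N := (locFin n F).comap T) h ha

theorem tw_mem_locFin (p : ZMod 2) {a : LocAlg n F} (ha : a ∈ locFin n F) : tw p a ∈ locFin n F :=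
  locFin_map (fun _ _ _ h => bigraded_le_locFin _ _ (tw_mem_bigraded p h)) ha

theorem pdL_mem_locFin (z : Var Φ) (I : MI n) {a : LocAlg n F} (ha : a ∈ locFin n F) :
    pdL z I a ∈ locFin n F :=
  locFin_map (fun _ _ _ h => bigraded_le_locFin _ _ (pdL_mem_bigraded h z I)) ha

theorem totalD_mem_locFin (μ : Fin n) {a : LocAlg n F} (ha : a ∈ locFin n F) :
    totalD μ a ∈ locFin n F :=
  locFin_map (fun _ _ _ h => bigraded_le_locFin _ _ (totalD_mem_bigraded h μ)) ha

theorem totalDI_mem_locFin (I : MI n) {a : LocAlg n F} (ha : a ∈ locFin n F) :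
    totalDI I a ∈ locFin n F :=
  locFin_map (fun _ _ _ h => bigraded_le_locFin _ _ (totalDI_mem_bigraded h I)) ha

theorem jet_mem_locFin (z : Var Φ) (I : MI n) : (jet z I : LocAlg n F) ∈ locFin n F :=
  bigraded_le_locFin _ _ (jet_mem_bigraded z I)

theorem mul_mem_locFin {a b : LocAlg n F} (ha : a ∈ locFin n F) (hb : b ∈ locFin n F) :
    a * b ∈ locFin n F := by
  have h1 : locFin n F ≤ (locFin n F).comap (LinearMap.mulRight ℝ b) := locFin_le fun g k a ha => by
    have h2 : locFin n F ≤ (locFin n F).comap (LinearMap.mulLeft ℝ a) :=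
      locFin_le fun g' k' b hb => bigraded_le_locFin _ _ (mul_mem_bigraded ha hb)
    exact h2 hb
  exact h1 ha

theorem totalD_mem_locFinDiv (μ : Fin n) {a : LocAlg n F} (ha : a ∈ locFin n F) :
    totalD μ a ∈ locFinDiv n F := by
  have : locFin n F ≤ (locFinDiv n F).comap (totalD μ) := locFin_le fun g k a ha =>
    locDiv_le_locFinDiv g k (Submodule.mem_iSup_of_mem μ ⟨a, ha, rfl⟩)
  exact this ha

theorem locFinDiv_le {N : Submodule ℝ (LocAlg n F)} (h : ∀ μ, ∀ a ∈ locFin n F, totalD μ a ∈ N) :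
    locFinDiv n F ≤ N :=
  iSup_le fun _ => iSup_le fun μ => Submodule.map_le_iff_le_comap.2 fun a ha =>
    h μ a (bigraded_le_locFin _ _ ha)

theorem locFinDiv_map {T : LocAlg n F →ₗ[ℝ] LocAlg n F}
    (hc : ∀ μ a, T (totalD μ a) = totalD μ (T a)) (h : ∀ a ∈ locFin n F, T a ∈ locFin n F)
    {a : LocAlg n F} (ha : a ∈ locFinDiv n F) : T a ∈ locFinDiv n F :=
  locFinDiv_le (N := (locFinDiv n F).comap T)
    (fun μ a ha => by
      rw [Submodule.mem_comap, hc]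
      exact totalD_mem_locFinDiv μ (h a ha)) ha

/-- The components of different bidegrees are linearly independent, although they do not span all
local functions. -/
theorem bigraded_iSupIndep : iSupIndep fun i : ℤ × ℤ => bigraded (n := n) (F := F) i.1 i.2 := by
  -- `(g, k) ↦ g + k √2` is injective, so one operator separates both degrees
  let W : Module.End ℝ (LocAlg n F) := (weightOp F.vgh : Module.End ℝ (LocAlg n F)) +
    Real.sqrt 2 • (weightOp F.vaf : Module.End ℝ (LocAlg n F))
  let e : ℤ × ℤ → ℝ := fun i => i.1 + i.2 * Real.sqrt 2
  have he : Function.Injective e := by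
    rintro ⟨g, k⟩ ⟨g', k'⟩ h
    simp only [e] at h
    by_cases hk : k = k'
    · subst hk
      simpa using h
    · exfalso
      have hk' : ((k - k' : ℤ) : ℝ) ≠ 0 := by exact_mod_cast sub_ne_zero.2 hk
      refine irrational_sqrt_two ⟨(g' - g : ℤ) / (k - k' : ℤ), ?_⟩
      rw [Rat.cast_div, Rat.cast_intCast, Rat.cast_intCast, div_eq_iff hk']
      push_cast
      linarith
  refine ((Module.End.eigenspaces_iSupIndep W).comp he).mono fun i a ha => ?_
  obtain ⟨h1, h2⟩ := mem_bigraded.1 ha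
  refine Module.End.mem_eigenspace_iff.2 ?_
  change weightOp F.vgh a + Real.sqrt 2 • weightOp F.vaf a = _
  rw [h1, h2, smul_smul, ← add_smul, mul_comm]

/-- A divergence of definite degrees is the divergence of a current of the same degrees. -/
theorem mem_locDiv_of_mem_locFinDiv {g k : ℤ} {a : LocAlg n F} (ha : a ∈ bigraded g k)
    (hd : a ∈ locFinDiv n F) : a ∈ locDiv n F g k := by
  have h1 : locFinDiv n F ≤ locDiv n F g k ⊔
      ⨆ (j : ℤ × ℤ) (_ : j ≠ (g, k)), bigraded (n := n) (F := F) j.1 j.2 := by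
    refine iSup_le fun i => ?_
    by_cases h : i = (g, k)
    · subst h; exact le_sup_left
    · exact (locDiv_le_bigraded _ _).trans
        ((le_iSup₂_of_le (f := fun (j : ℤ × ℤ) (_ : j ≠ (g, k)) =>
          bigraded (n := n) (F := F) j.1 j.2) i h le_rfl).trans le_sup_right)
  obtain ⟨x, hx, y, hy, rfl⟩ := Submodule.mem_sup.1 (h1 hd)
  have hy' : y ∈ bigraded g k := by
    have := Submodule.sub_mem _ ha (locDiv_le_bigraded _ _ hx)
    rwa [add_sub_cancel_left] at this
  have := Submodule.disjoint_def.1 (bigraded_iSupIndep (n := n) (F := F) (g, k)) y hy' hy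
  rwa [this, add_zero]

theorem mem_divergence {g : ℤ} {a : Series n F} :
    a ∈ divergence n F g ↔ ∀ k : ℕ, a k ∈ locDiv n F g k := by
  classical
  constructor
  · intro ha k
    have : divergence n F g ≤ (locDiv n F g k).comap (LinearMap.proj k) :=
      iSup_le fun μ => Submodule.map_le_iff_le_comap.2 fun b hb =>
        Submodule.mem_iSup_of_mem μ ⟨b k, hb k trivial, rfl⟩
    exact this ha
  · intro h
    have h' : ∀ k : ℕ, ∃ j : Fin n → LocAlg n F, (∀ μ, j μ ∈ bigraded g k) ∧
        ∑ μ, totalD μ (j μ) = a k := by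
      intro k
      obtain ⟨f, hf⟩ := (Submodule.mem_iSup_finset_iff_exists_sum (s := Finset.univ)
        (fun μ => (bigraded (n := n) (F := F) g k).map (totalD μ)) (a k)).1
        (by have := h k; simpa [locDiv] using this)
      choose j hj hj' using fun μ => (f μ).2
      exact ⟨j, hj, by rw [← hf]; exact Finset.sum_congr rfl fun μ _ => hj' μ⟩
    choose j hj hj' using h'
    have : a = ∑ μ, LinearMap.compLeft (totalD μ) ℕ (fun k => j k μ) := by
      funext k
      rw [Finset.sum_apply, ← hj' k]
      rfl
    rw [this]
    exact Submodule.sum_mem _ fun μ _ => Submodule.mem_iSup_of_mem μ ⟨_, fun k _ => hj k μ, rfl⟩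

theorem mem_density {g : ℤ} {a : Series n F} : a ∈ density n F g ↔ ∀ k : ℕ, a k ∈ bigraded g k := by
  simp [density, Submodule.mem_pi]

theorem divergence_le_density (g : ℤ) : divergence n F g ≤ density n F g := fun _ ha =>
  mem_density.2 fun k => locDiv_le_bigraded _ _ (mem_divergence.1 ha k)

/-! ### Integration by parts and Euler operators -/

theorem totalDI_mul_sub_mem (I : MI n) {a b : LocAlg n F} (ha : a ∈ locFin n F)
    (hb : b ∈ locFin n F) : totalDI I a * b - a * adjDI I b ∈ locFinDiv n F := by
  induction I using mi_induction generalizing b with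
  | h0 => rw [totalDI_zero, adjDI_zero, sub_self]; exact Submodule.zero_mem _
  | hs I μ ih =>
    have h1 := ih (totalD_mem_locFin μ hb)
    have h2 : totalD μ (totalDI I a * b) ∈ locFinDiv n F :=
      totalD_mem_locFinDiv μ (mul_mem_locFin (totalDI_mem_locFin I ha) hb)
    have := Submodule.sub_mem _ h2 h1
    rw [totalDI_add_single, adjDI_add_single, totalD_adjDI, mul_neg, sub_neg_eq_add]
    rw [totalD_mul] at this
    convert this using 1
    abel

theorem mul_totalDI_sub_mem (I : MI n) {a b : LocAlg n F} (ha : a ∈ locFin n F)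
    (hb : b ∈ locFin n F) : a * totalDI I b - adjDI I a * b ∈ locFinDiv n F := by
  induction I using mi_induction generalizing a with
  | h0 => rw [totalDI_zero, adjDI_zero, sub_self]; exact Submodule.zero_mem _
  | hs I μ ih =>
    have h1 := ih (totalD_mem_locFin μ ha)
    have h2 : totalD μ (a * totalDI I b) ∈ locFinDiv n F :=
      totalD_mem_locFinDiv μ (mul_mem_locFin ha (totalDI_mem_locFin I hb))
    have := Submodule.sub_mem _ h2 h1
    rw [totalDI_add_single, adjDI_add_single, totalD_adjDI, neg_mul, sub_neg_eq_add]
    rw [totalD_mul] at this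
    convert this using 1
    abel

theorem exists_pdL_support' (z : Var Φ) (a : LocAlg n F) :
    ∃ s : Finset (MI n), ∀ I ∉ s, pdL z I a = 0 :=
  ⟨(finite_pdL z a).toFinset, fun I hI => by
    rw [Set.Finite.mem_toFinset] at hI
    exact not_not.1 hI⟩

theorem finsum_pdL_eq_sum {M : Type*} [AddCommGroup M] (L : MI n → LocAlg n F →+ M) (z : Var Φ)
    (a : LocAlg n F) (s : Finset (MI n)) (hs : ∀ I ∉ s, pdL z I a = 0) :
    ∑ᶠ I, L I (pdL z I a) = ∑ I ∈ s, L I (pdL z I a) :=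
  finsum_eq_sum_of_support_subset _ fun I hI => by
    by_contra h
    exact hI (by simp only [hs I h, map_zero])

/-- Rearrangement of a sum over the partial derivatives of a total derivative. -/
theorem finsum_pdL_totalD {M : Type*} [AddCommGroup M] (L : MI n → LocAlg n F →+ M) (z : Var Φ)
    (μ : Fin n) (a : LocAlg n F) (s : Finset (MI n)) (hs : ∀ I ∉ s, pdL z I a = 0) :
    ∑ᶠ I, L I (pdL z I (totalD μ a)) =
      ∑ I ∈ s, (L I (totalD μ (pdL z I a)) + L (I + Finsupp.single μ 1) (pdL z I a)) := by
  classical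
  let sh : MI n → MI n := fun I => I + Finsupp.single μ 1
  have hsh : Function.Injective sh := fun I J h => add_right_cancel h
  let d : MI n → LocAlg n F := fun J => pdL z J (totalD μ a) - totalD μ (pdL z J a)
  have hd1 : ∀ I, d (sh I) = pdL z I a := fun I => by
    simp only [d, sh]; rw [pdL_add_totalD, add_sub_cancel_left]
  have hd2 : ∀ J ∉ s.image sh, d J = 0 := by
    intro J hJ
    by_cases h : J μ = 0
    · simp only [d]; rw [pdL_totalD_of_eq_zero z J μ h, sub_self]
    · have hle : Finsupp.single μ 1 ≤ J := by
        rw [Finsupp.single_le_iff]; omega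
      have hJ' : J = sh (J - Finsupp.single μ 1) := (tsub_add_cancel_of_le hle).symm
      rw [hJ', hd1]
      refine hs _ fun hm => hJ ?_
      rw [hJ']
      exact Finset.mem_image_of_mem _ hm
  have h0 : ∀ J, pdL z J (totalD μ a) = totalD μ (pdL z J a) + d J := fun J => by
    simp only [d]; abel
  rw [finsum_pdL_eq_sum L z _ (s ∪ s.image sh)]
  · simp only [h0, map_add, Finset.sum_add_distrib]
    congr 1
    · refine (Finset.sum_subset Finset.subset_union_left fun J _ hJ => ?_).symm
      rw [hs J hJ, map_zero, map_zero]
    · rw [← Finset.sum_subset Finset.subset_union_right (fun J _ hJ => by rw [hd2 J hJ, map_zero]),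
        Finset.sum_image hsh.injOn]
      exact Finset.sum_congr rfl fun I _ => by rw [hd1]
  · intro J hJ
    simp only [Finset.mem_union, not_or] at hJ
    rw [h0, hs J hJ.1, map_zero, hd2 J hJ.2, add_zero]

theorem eulerL_eq_sum (z : Var Φ) (a : LocAlg n F) (s : Finset (MI n))
    (hs : ∀ I ∉ s, pdL z I a = 0) : eulerL z a = ∑ I ∈ s, adjDI I (pdL z I a) :=
  finsum_pdL_eq_sum (fun I => (adjDI I).toAddMonoidHom) z a s hs

/-- Euler operators annihilate total derivatives. -/
theorem eulerL_totalD (z : Var Φ) (μ : Fin n) (a : LocAlg n F) : eulerL z (totalD μ a) = 0 := by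
  obtain ⟨s, hs⟩ := exists_pdL_support' z a
  refine (finsum_pdL_totalD (fun I => (adjDI I).toAddMonoidHom) z μ a s hs).trans ?_
  refine Finset.sum_eq_zero fun I _ => ?_
  change adjDI I (totalD μ (pdL z I a)) + adjDI (I + Finsupp.single μ 1) (pdL z I a) = 0
  rw [adjDI_add_single, totalD_adjDI, add_neg_cancel]

theorem eulerL_of_mem_locFinDiv (z : Var Φ) {a : LocAlg n F} (ha : a ∈ locFinDiv n F) :
    eulerL z a = 0 :=
  locFinDiv_le (N := LinearMap.ker (eulerL z)) (fun μ a _ => eulerL_totalD z μ a) ha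

theorem eulerR_eq (z : Var Φ) (a : LocAlg n F) : eulerR z a = tw (F.vpar z) (eulerL z a) := by
  obtain ⟨s, hs⟩ := exists_pdL_support' z a
  rw [eulerL_eq_sum z a s hs, map_sum]
  refine (finsum_eq_sum_of_support_subset (s := s) _ fun I hI => ?_).trans ?_
  · by_contra h
    refine hI ?_
    change adjDI I (pdR z I a) = 0
    rw [pdR_eq, hs I h, map_zero, map_zero]
  · refine Finset.sum_congr rfl fun I _ => ?_
    change adjDI I (pdR z I a) = _
    rw [pdR_eq, comm_adjDI (fun μ b => tw_totalD _ μ b)]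

theorem eulerR_of_mem_locFinDiv (z : Var Φ) {a : LocAlg n F} (ha : a ∈ locFinDiv n F) :
    eulerR z a = 0 := by
  rw [eulerR_eq, eulerL_of_mem_locFinDiv z ha, map_zero]

theorem eulerL_mem_bigraded {g k : ℤ} {a : LocAlg n F} (ha : a ∈ bigraded g k) (z : Var Φ) :
    eulerL z a ∈ bigraded (g - F.vgh z) (k - F.vaf z) := by
  obtain ⟨s, hs⟩ := exists_pdL_support' z a
  rw [eulerL_eq_sum z a s hs]
  exact Submodule.sum_mem _ fun I _ => adjDI_mem_bigraded (pdL_mem_bigraded ha z I) I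

theorem eulerR_mem_bigraded {g k : ℤ} {a : LocAlg n F} (ha : a ∈ bigraded g k) (z : Var Φ) :
    eulerR z a ∈ bigraded (g - F.vgh z) (k - F.vaf z) := by
  rw [eulerR_eq]; exact tw_mem_bigraded _ (eulerL_mem_bigraded ha z)

theorem eulerL_mem_locFin (z : Var Φ) {a : LocAlg n F} (ha : a ∈ locFin n F) :
    eulerL z a ∈ locFin n F :=
  locFin_map (fun _ _ _ h => bigraded_le_locFin _ _ (eulerL_mem_bigraded h z)) ha

theorem eulerL_mem_parityPart {p : ZMod 2} {a : LocAlg n F} (ha : a ∈ parityPart p) (z : Var Φ) :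
    eulerL z a ∈ parityPart (p + F.vpar z) := by
  obtain ⟨s, hs⟩ := exists_pdL_support' z a
  rw [eulerL_eq_sum z a s hs]
  exact Submodule.sum_mem _ fun I _ =>
    Submodule.smul_mem _ _ (totalDI_mem_parityPart (pdL_mem_parityPart ha z I) I)

theorem eulerL_parInv (z : Var Φ) (a : LocAlg n F) :
    eulerL z (parInv a) = sgn (F.vpar z) • parInv (eulerL z a) := by
  obtain ⟨s, hs⟩ := exists_pdL_support' z a
  rw [eulerL_eq_sum z a s hs, eulerL_eq_sum z (parInv a) s (fun I hI => by
    rw [pdL_parInv, hs I hI, map_zero, smul_zero]), map_sum, Finset.smul_sum]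
  refine Finset.sum_congr rfl fun I _ => ?_
  rw [pdL_parInv, map_smul, comm_adjDI (fun μ b => (totalD_parInv μ b).symm)]

end

section

variable {Φ : Type u} {n : ℕ} {F : FieldContent Φ} [Fintype Φ]

/-! ### Evolutionary vector fields -/

theorem zmod_two_add_add (p r c : ZMod 2) : p + c + (r + c) = p + r := by
  revert p r c; decide

/-- The evolutionary vector field with characteristic `X`, on fields and antifields. -/
def pro (X : Var Φ → LocAlg n F) : LocAlg n F →ₗ[ℝ] LocAlg n F :=
  vf fun q => totalDI q.2 (X q.1)

/-- The characteristic `X` defines an evolutionary vector field of parity `p`. -/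
def HasCharParity (p : ZMod 2) (X : Var Φ → LocAlg n F) : Prop :=
  ∀ z, X z ∈ parityPart (p + F.vpar z)

theorem pro_eq_sum (X : Var Φ → LocAlg n F) (a : LocAlg n F) (s : Finset (Var Φ × MI n))
    (hs : ∀ q ∉ s, pdL q.1 q.2 a = 0) :
    pro X a = ∑ q ∈ s, totalDI q.2 (X q.1) * pdL q.1 q.2 a := vf_eq_sum _ a s hs

/-- A finite set of multi-indices sufficient for the partial derivatives with respect to all the
variables. -/
theorem exists_pdL_support_mi (a : LocAlg n F) :
    ∃ s : Finset (MI n), ∀ z, ∀ I ∉ s, pdL z I a = 0 := by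
  classical
  obtain ⟨s, hs⟩ := exists_pdL_support a
  refine ⟨s.image Prod.snd, fun z I hI => hs (z, I) fun h => hI ?_⟩
  exact Finset.mem_image.2 ⟨_, h, rfl⟩

theorem pro_eq_sum_mi (X : Var Φ → LocAlg n F) (a : LocAlg n F) (s : Finset (MI n))
    (hs : ∀ z, ∀ I ∉ s, pdL z I a = 0) :
    pro X a = ∑ z, ∑ I ∈ s, totalDI I (X z) * pdL z I a := by
  rw [pro_eq_sum X a (Finset.univ ×ˢ s) (fun q hq => hs q.1 q.2 (by simpa using hq)),
    Finset.sum_product]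

theorem pro_add (X Y : Var Φ → LocAlg n F) (a : LocAlg n F) :
    pro (fun z => X z + Y z) a = pro X a + pro Y a := by
  rw [pro, pro, pro, ← vf_add]
  simp only [map_add]

theorem pro_smul (r : ℝ) (X : Var Φ → LocAlg n F) (a : LocAlg n F) :
    pro (fun z => r • X z) a = r • pro X a := by
  rw [pro, pro, ← vf_smul]
  simp only [map_smul]

theorem pro_sub_smul (r : ℝ) (X Y : Var Φ → LocAlg n F) (a : LocAlg n F) :
    pro (fun z => X z - r • Y z) a = pro X a - r • pro Y a := by
  have := pro_add X (fun z => (-r) • Y z) a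
  rw [pro_smul, neg_smul, ← sub_eq_add_neg] at this
  rw [← this]
  simp only [neg_smul, sub_eq_add_neg]

theorem pro_totalD (X : Var Φ → LocAlg n F) (μ : Fin n) (a : LocAlg n F) :
    pro X (totalD μ a) = totalD μ (pro X a) := by
  obtain ⟨s, hs⟩ := exists_pdL_support_mi a
  obtain ⟨t, ht⟩ := exists_pdL_support_mi (totalD μ a)
  rw [pro_eq_sum_mi X a s hs, pro_eq_sum_mi X _ t ht, map_sum]
  refine Finset.sum_congr rfl fun z _ => ?_
  let L : MI n → LocAlg n F →+ LocAlg n F := fun I =>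
    (LinearMap.mulLeft ℝ (totalDI I (X z))).toAddMonoidHom
  refine ((finsum_pdL_eq_sum L z _ t (ht z)).symm.trans
    (finsum_pdL_totalD L z μ a s (hs z))).trans ?_
  rw [map_sum]
  refine Finset.sum_congr rfl fun I _ => ?_
  change totalDI I (X z) * totalD μ (pdL z I a) +
    totalDI (I + Finsupp.single μ 1) (X z) * pdL z I a = _
  rw [totalD_mul, totalDI_add_single, add_comm]

theorem pro_totalDI (X : Var Φ → LocAlg n F) (I : MI n) (a : LocAlg n F) :
    pro X (totalDI I a) = totalDI I (pro X a) := comm_totalDI (pro_totalD X) I a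

theorem pro_mul {p : ZMod 2} {X : Var Φ → LocAlg n F} (hX : HasCharParity p X) (a b : LocAlg n F) :
    pro X (a * b) = pro X a * b + tw p a * pro X b :=
  vf_mul (fun q => totalDI_mem_parityPart (hX q.1) q.2) a b

theorem pro_jet (X : Var Φ → LocAlg n F) (z : Var Φ) (I : MI n) :
    pro X (jet z I) = totalDI I (X z) := vf_jet _ z I

theorem pro_mem_parityPart {p r : ZMod 2} {X : Var Φ → LocAlg n F} (hX : HasCharParity p X)
    {a : LocAlg n F} (ha : a ∈ parityPart r) : pro X a ∈ parityPart (p + r) := by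
  obtain ⟨s, hs⟩ := exists_pdL_support a
  rw [pro_eq_sum X a s hs]
  refine Submodule.sum_mem _ fun q _ => ?_
  have := mul_mem_parityPart (totalDI_mem_parityPart (hX q.1) q.2)
    (pdL_mem_parityPart ha q.1 q.2)
  rwa [zmod_two_add_add] at this

theorem pro_mem_locFin {X : Var Φ → LocAlg n F} (hX : ∀ z, X z ∈ locFin n F)
    {a : LocAlg n F} (ha : a ∈ locFin n F) : pro X a ∈ locFin n F := by
  obtain ⟨s, hs⟩ := exists_pdL_support a
  rw [pro_eq_sum X a s hs]
  exact Submodule.sum_mem _ fun q _ =>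
    mul_mem_locFin (totalDI_mem_locFin q.2 (hX q.1)) (pdL_mem_locFin q.1 q.2 ha)

theorem pro_mem_locFinDiv {X : Var Φ → LocAlg n F} (hX : ∀ z, X z ∈ locFin n F)
    {a : LocAlg n F} (ha : a ∈ locFinDiv n F) : pro X a ∈ locFinDiv n F :=
  locFinDiv_map (pro_totalD X) (fun _ h => pro_mem_locFin hX h) ha

variable (n F) in
/-- The class of a local function modulo total divergences. -/
abbrev lf : LocAlg n F →ₗ[ℝ] LocAlg n F ⧸ locFinDiv n F := (locFinDiv n F).mkQ

omit [Fintype Φ] in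
theorem lf_eq {a b : LocAlg n F} : lf n F a = lf n F b ↔ a - b ∈ locFinDiv n F := by
  rw [Submodule.mkQ_apply, Submodule.mkQ_apply, Submodule.Quotient.eq]

/-- Integration by parts. -/
theorem lf_pro {X : Var Φ → LocAlg n F} (hX : ∀ z, X z ∈ locFin n F)
    {a : LocAlg n F} (ha : a ∈ locFin n F) :
    lf n F (pro X a) = lf n F (∑ z, X z * eulerL z a) := by
  obtain ⟨s, hs⟩ := exists_pdL_support_mi a
  rw [lf_eq, pro_eq_sum_mi X a s hs, ← Finset.sum_sub_distrib]
  refine Submodule.sum_mem _ fun z _ => ?_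
  rw [eulerL_eq_sum z a s (hs z), Finset.mul_sum, ← Finset.sum_sub_distrib]
  exact Submodule.sum_mem _ fun I _ => totalDI_mul_sub_mem I (hX z) (pdL_mem_locFin z I ha)

theorem lf_pro_congr {X : Var Φ → LocAlg n F} (hX : ∀ z, X z ∈ locFin n F)
    {a b : LocAlg n F} (h : lf n F a = lf n F b) : lf n F (pro X a) = lf n F (pro X b) := by
  rw [lf_eq] at *
  rw [← map_sub]
  exact pro_mem_locFinDiv hX h

/-- The graded commutator of evolutionary vector fields is evolutionary. -/
theorem pro_pro {p q : ZMod 2} {X Y : Var Φ → LocAlg n F} (hX : HasCharParity p X)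
    (hY : HasCharParity q Y) (a : LocAlg n F) :
    pro X (pro Y a) - sgn (p * q) • pro Y (pro X a) =
      pro (fun z => pro X (Y z) - sgn (p * q) • pro Y (X z)) a := by
  obtain ⟨s, hs⟩ := exists_pdL_support a
  have hs' : ∀ z I, ∀ r ∉ s, pdL r.1 r.2 (pdL z I a) = 0 := fun z I r hr =>
    pdL_comm_self _ _ _ _ (hs r hr)
  have key : ∀ {p q : ZMod 2} {X Y : Var Φ → LocAlg n F}, HasCharParity p X → HasCharParity q Y →
      pro X (pro Y a) = pro (fun z => pro X (Y z)) a +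
        ∑ c ∈ s, ∑ d ∈ s, sgn (p * (q + F.vpar c.1)) •
          (totalDI c.2 (Y c.1) * (totalDI d.2 (X d.1) * pdL d.1 d.2 (pdL c.1 c.2 a))) := by
    intro p q X Y hX hY
    rw [pro_eq_sum Y a s hs, pro_eq_sum _ a s hs, map_sum, ← Finset.sum_add_distrib]
    refine Finset.sum_congr rfl fun c _ => ?_
    rw [pro_mul hX, pro_totalDI, tw_of_mem (totalDI_mem_parityPart (hY c.1) c.2),
      pro_eq_sum X _ s (hs' c.1 c.2), Finset.mul_sum]
    simp only [smul_mul_assoc]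
  rw [key hX hY, key hY hX, pro_sub_smul, smul_add, Finset.smul_sum]
  simp only [Finset.smul_sum]
  rw [Finset.sum_comm (s := s) (t := s) (f := fun c d => sgn (p * q) • sgn (q * (p + F.vpar c.1)) •
          (totalDI c.2 (X c.1) * (totalDI d.2 (Y d.1) * pdL d.1 d.2 (pdL c.1 c.2 a))))]
  have : ∀ c ∈ s, ∀ d ∈ s, sgn (p * q) • sgn (q * (p + F.vpar d.1)) •
      (totalDI d.2 (X d.1) * (totalDI c.2 (Y c.1) * pdL c.1 c.2 (pdL d.1 d.2 a))) =
      sgn (p * (q + F.vpar c.1)) •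
          (totalDI c.2 (Y c.1) * (totalDI d.2 (X d.1) * pdL d.1 d.2 (pdL c.1 c.2 a))) := by
    intro c _ d _
    rw [← mul_assoc, mul_comm_of_mem (totalDI_mem_parityPart (hX d.1) d.2)
      (totalDI_mem_parityPart (hY c.1) c.2), pdL_comm c.1 d.1, mul_smul_comm, smul_mul_assoc,
      smul_smul, smul_smul, smul_smul, ← sgn_add, ← sgn_add, ← sgn_add, mul_assoc]
    have aux : ∀ p q c d : ZMod 2,
        p * q + q * (p + d) + c * d + (p + d) * (q + c) = p * (q + c) := by decide
    rw [aux]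
  rw [Finset.sum_congr rfl fun c hc => Finset.sum_congr rfl (this c hc)]
  abel

/-! ### The second variation -/

/-- The second variation `∑ ± Y^z δ_X (δ^L v/δz)` of `v`, for `X`, `Y` of parities `p`, `q`. -/
def hess (v : LocAlg n F) (p q : ZMod 2) (X Y : Var Φ → LocAlg n F) : LocAlg n F :=
  ∑ z, sgn (p * (q + F.vpar z)) • (Y z * pro X (eulerL z v))

theorem lf_hess {p q : ZMod 2} {X Y : Var Φ → LocAlg n F} (hX : HasCharParity p X)
    (hY : HasCharParity q Y) (hX' : ∀ z, X z ∈ locFin n F) (hY' : ∀ z, Y z ∈ locFin n F)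
    {v : LocAlg n F} (hv : v ∈ locFin n F) :
    lf n F (hess v p q X Y) =
      lf n F (pro X (pro Y v)) - lf n F (pro (fun z => pro X (Y z)) v) := by
  rw [lf_pro_congr hX' (lf_pro hY' hv), lf_pro (fun z => pro_mem_locFin hX' (hY' z)) hv, ← map_sub]
  congr 1
  rw [map_sum, ← Finset.sum_sub_distrib]
  refine Finset.sum_congr rfl fun z _ => ?_
  rw [pro_mul hX, tw_of_mem (hY z), add_sub_cancel_left, smul_mul_assoc]

/-- The second variation is symmetric up to a total divergence (the Helmholtz conditions for Euler
derivatives), because evolutionary vector fields form a Lie algebra. -/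
theorem lf_hess_symm {p q : ZMod 2} {X Y : Var Φ → LocAlg n F} (hX : HasCharParity p X)
    (hY : HasCharParity q Y) (hX' : ∀ z, X z ∈ locFin n F) (hY' : ∀ z, Y z ∈ locFin n F)
    {v : LocAlg n F} (hv : v ∈ locFin n F) :
    lf n F (hess v p q X Y) = sgn (p * q) • lf n F (hess v q p Y X) := by
  rw [lf_hess hX hY hX' hY' hv, lf_hess hY hX hY' hX' hv]
  have h := congrArg (lf n F) (pro_pro hX hY v)
  rw [pro_sub_smul] at h
  simp only [map_sub, map_smul] at h
  rw [smul_sub]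
  rw [sub_eq_sub_iff_sub_eq_sub]
  exact h

/-! ### The antibracket of local functions -/

omit [Fintype Φ] in
theorem vpar_swap (F : FieldContent Φ) (z : Var Φ) : F.vpar z.swap = F.vpar z + 1 := by
  rcases z with A | A
  · rfl
  · simp [FieldContent.vpar, add_assoc, CharTwo.add_self_eq_zero]

/-- The sign `1` on fields and `-1` on antifields. -/
def sympSgn : Var Φ → ℝ := Sum.elim (fun _ => 1) fun _ => -1

/-- The weight `t` of a field-antifield pair. -/
def pairWt (t : Φ → ℝ) : Var Φ → ℝ := Sum.elim t t

omit [Fintype Φ] in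
theorem sympSgn_swap (z : Var Φ) : sympSgn z.swap = -sympSgn z := by
  rcases z with A | A <;> simp [sympSgn]

omit [Fintype Φ] in
theorem pairWt_swap (t : Φ → ℝ) (z : Var Φ) : pairWt t z.swap = pairWt t z := by
  rcases z with A | A <;> rfl

/-- The antibracket density of local functions, with the contribution of the pair `φ^A`, `φ*_A`
weighted by `t A`. -/
def lb (t : Φ → ℝ) : LocAlg n F →ₗ[ℝ] LocAlg n F →ₗ[ℝ] LocAlg n F :=
  ∑ A, t A • ((LinearMap.mul ℝ (LocAlg n F)).compl₁₂ (eulerR (Sum.inl A)) (eulerL (Sum.inr A)) -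
    (LinearMap.mul ℝ (LocAlg n F)).compl₁₂ (eulerR (Sum.inr A)) (eulerL (Sum.inl A)))

theorem lb_apply (t : Φ → ℝ) (u v : LocAlg n F) : lb t u v =
    ∑ A, t A • (eulerR (Sum.inl A) u * eulerL (Sum.inr A) v -
      eulerR (Sum.inr A) u * eulerL (Sum.inl A) v) := by
  simp only [lb, LinearMap.sum_apply, LinearMap.smul_apply, LinearMap.sub_apply,
    LinearMap.compl₁₂_apply, LinearMap.mul_apply']

theorem lb_eq_sum (t : Φ → ℝ) (u v : LocAlg n F) : lb t u v =
    ∑ z : Var Φ, (pairWt t z * sympSgn z) • (tw (F.vpar z) (eulerL z u) * eulerL z.swap v) := by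
  rw [lb_apply, Fintype.sum_sum_type, ← Finset.sum_add_distrib]
  refine Finset.sum_congr rfl fun A _ => ?_
  simp only [eulerR_eq, pairWt, sympSgn, Sum.elim_inl, Sum.elim_inr, Sum.swap_inl, Sum.swap_inr,
    mul_one, mul_neg, neg_smul, smul_add, smul_neg, sub_eq_add_neg]

/-- The characteristic of the Hamiltonian vector field of `u`. -/
def ham (t : Φ → ℝ) (u : LocAlg n F) (z : Var Φ) : LocAlg n F :=
  -((pairWt t z * sympSgn z) • tw (F.vpar z.swap) (eulerL z.swap u))

theorem sum_swap {M : Type*} [AddCommMonoid M] (f : Var Φ → M) :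
    ∑ z, f (Sum.swap z) = ∑ z, f z :=
  (Equiv.sumComm Φ Φ).sum_comp f

theorem lb_eq_ham (t : Φ → ℝ) (u v : LocAlg n F) : lb t u v = ∑ z, ham t u z * eulerL z v := by
  rw [lb_eq_sum, ← sum_swap]
  refine Finset.sum_congr rfl fun z _ => ?_
  rw [ham, pairWt_swap, sympSgn_swap, Sum.swap_swap, mul_neg, neg_smul, neg_mul, smul_mul_assoc]

omit [Fintype Φ] in
theorem ham_parity (t : Φ → ℝ) {p : ZMod 2} {u : LocAlg n F} (hu : u ∈ parityPart (p + 1)) :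
    HasCharParity p (ham t u) := by
  intro z
  have h := eulerL_mem_parityPart hu z.swap
  refine Submodule.neg_mem _ (Submodule.smul_mem _ _ ?_)
  rw [tw_of_mem h]
  rw [vpar_swap, add_add_add_comm, CharTwo.add_self_eq_zero, add_zero] at h ⊢
  exact Submodule.smul_mem _ _ h

omit [Fintype Φ] in
theorem ham_mem_locFin (t : Φ → ℝ) {u : LocAlg n F} (hu : u ∈ locFin n F) (z : Var Φ) :
    ham t u z ∈ locFin n F :=
  Submodule.neg_mem _ (Submodule.smul_mem _ _ (tw_mem_locFin _ (eulerL_mem_locFin _ hu)))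

theorem lf_lb (t : Φ → ℝ) {u v : LocAlg n F} (hu : u ∈ locFin n F) (hv : v ∈ locFin n F) :
    lf n F (lb t u v) = lf n F (pro (ham t u) v) := by
  rw [lf_pro (ham_mem_locFin t hu) hv, lb_eq_ham]

theorem lb_mem_locFin (t : Φ → ℝ) {u v : LocAlg n F} (hu : u ∈ locFin n F) (hv : v ∈ locFin n F) :
    lb t u v ∈ locFin n F := by
  rw [lb_eq_ham]
  exact Submodule.sum_mem _ fun z _ =>
    mul_mem_locFin (ham_mem_locFin t hu z) (eulerL_mem_locFin z hv)

theorem lb_mem_parityPart (t : Φ → ℝ) {p q : ZMod 2} {u v : LocAlg n F}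
    (hu : u ∈ parityPart (p + 1)) (hv : v ∈ parityPart q) : lb t u v ∈ parityPart (p + q) := by
  rw [lb_eq_ham]
  refine Submodule.sum_mem _ fun z _ => ?_
  have := mul_mem_parityPart (ham_parity t hu z) (eulerL_mem_parityPart hv z)
  rwa [add_add_add_comm, CharTwo.add_self_eq_zero, add_zero] at this

/-- Graded antisymmetry of the antibracket. -/
theorem lb_antisymm (t : Φ → ℝ) {p q : ZMod 2} {u v : LocAlg n F}
    (hu : u ∈ parityPart (p + 1)) (hv : v ∈ parityPart (q + 1)) :
    lb t u v = -(sgn (p * q) • lb t v u) := by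
  rw [lb_eq_sum, lb_eq_sum, ← sum_swap, Finset.smul_sum, ← Finset.sum_neg_distrib]
  refine Finset.sum_congr rfl fun z _ => ?_
  have h1 := eulerL_mem_parityPart hu z.swap
  have h2 := eulerL_mem_parityPart hv z
  rw [Sum.swap_swap, pairWt_swap, sympSgn_swap, tw_of_mem h1, tw_of_mem h2, smul_mul_assoc,
    smul_mul_assoc, mul_comm_of_mem h1 h2, smul_smul, smul_smul, smul_smul, smul_smul, ← neg_smul]
  congr 1
  rw [vpar_swap]
  generalize F.vpar z = c
  rcases zmod_two_cases p with rfl | rfl <;> rcases zmod_two_cases q with rfl | rfl <;>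
    rcases zmod_two_cases c with rfl | rfl <;>
    simp [sgn_zero, sgn_one, CharTwo.add_self_eq_zero]

/-- The first variation of a Hamiltonian vector field is a second variation of its Hamiltonian. -/
theorem sum_pro_ham_mul (t : Φ → ℝ) {p q r : ZMod 2} {X : Var Φ → LocAlg n F}
    (hX : HasCharParity p X) {v w : LocAlg n F} (hv : v ∈ parityPart (q + 1))
    (hw : w ∈ parityPart (r + 1)) :
    ∑ z, pro X (ham t v z) * eulerL z w = -(sgn (q * r) • hess v p r X (ham t w)) := by
  rw [hess, ← sum_swap, Finset.smul_sum, ← Finset.sum_neg_distrib]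
  refine Finset.sum_congr rfl fun z _ => ?_
  have h1 := eulerL_mem_parityPart hv z
  have h2 := eulerL_mem_parityPart hw z.swap
  have h3 := pro_mem_parityPart hX h1
  rw [ham, ham, Sum.swap_swap, pairWt_swap, sympSgn_swap, tw_of_mem h1, tw_of_mem h2, map_neg,
    map_smul, map_smul]
  simp only [neg_mul, smul_mul_assoc, mul_comm_of_mem h2 h3, smul_neg, neg_neg, mul_neg, neg_smul,
    smul_smul]
  congr 1
  rw [vpar_swap]
  generalize F.vpar z = c
  rcases zmod_two_cases p with rfl | rfl <;> rcases zmod_two_cases q with rfl | rfl <;>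
    rcases zmod_two_cases r with rfl | rfl <;> rcases zmod_two_cases c with rfl | rfl <;>
    simp [sgn_zero, sgn_one, CharTwo.add_self_eq_zero]

theorem lb_jacobi_of_mem (t : Φ → ℝ) {p q r : ZMod 2} {u v w : LocAlg n F}
    (hu : u ∈ parityPart (p + 1)) (hv : v ∈ parityPart (q + 1)) (hw : w ∈ parityPart (r + 1))
    (hu' : u ∈ locFin n F) (hv' : v ∈ locFin n F) (hw' : w ∈ locFin n F) :
    lf n F (lb t u (lb t v w)) =
      lf n F (lb t (lb t u v) w) + sgn (p * q) • lf n F (lb t v (lb t u w)) := by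
  have X := ham_parity t hu
  have Y := ham_parity t hv
  have W := ham_parity t hw
  have X' := ham_mem_locFin t hu'
  have Y' := ham_mem_locFin t hv'
  have W' := ham_mem_locFin t hw'
  have huv : lb t u v ∈ parityPart (p + q + 1) := by
    rw [add_assoc]; exact lb_mem_parityPart t hu hv
  -- both sides are second variations of `u` and `v`
  have h1 : lf n F (lb t u (lb t v w)) = lf n F (pro (ham t u) (pro (ham t v) w)) :=
    (lf_lb t hu' (lb_mem_locFin t hv' hw')).trans (lf_pro_congr X' (lf_lb t hv' hw'))
  have h2 : lf n F (lb t v (lb t u w)) = lf n F (pro (ham t v) (pro (ham t u) w)) :=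
    (lf_lb t hv' (lb_mem_locFin t hu' hw')).trans (lf_pro_congr Y' (lf_lb t hu' hw'))
  have h3 : lf n F (lb t (lb t u v) w) =
      -(sgn ((p + q) * r) • lf n F (pro (ham t w) (pro (ham t u) v))) := by
    rw [lb_antisymm t huv hw, map_neg, map_smul, lf_lb t hw' (lb_mem_locFin t hu' hv'),
      lf_pro_congr W' (lf_lb t hu' hv')]
  have h4 : lf n F (pro (ham t u) (pro (ham t v) w)) -
      sgn (p * q) • lf n F (pro (ham t v) (pro (ham t u) w)) =
      -(sgn (q * r) • lf n F (hess v p r (ham t u) (ham t w))) +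
        sgn (p * q) • sgn (p * r) • lf n F (hess u q r (ham t v) (ham t w)) := by
    rw [← map_smul, ← map_sub, pro_pro X Y, pro_sub_smul, map_sub, map_smul,
      lf_pro (fun z => pro_mem_locFin X' (Y' z)) hw',
      lf_pro (fun z => pro_mem_locFin Y' (X' z)) hw',
      sum_pro_ham_mul t X hv hw, sum_pro_ham_mul t Y hu hw]
    simp only [map_neg, map_smul, smul_neg, sub_neg_eq_add]
  have h5 : lf n F (pro (ham t w) (pro (ham t u) v)) =
      sgn (r * p) • lf n F (hess v p r (ham t u) (ham t w)) -
        sgn (p * q) • sgn (r * q) • lf n F (hess u q r (ham t v) (ham t w)) := by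
    have h6 := lf_hess W X W' X' hv'
    rw [lf_hess_symm W X W' X' hv', lf_pro (fun z => pro_mem_locFin W' (X' z)) hv',
      sum_pro_ham_mul t W hu hv, map_neg, map_smul, lf_hess_symm W Y W' Y' hu',
      sub_neg_eq_add] at h6
    rw [h6, add_sub_cancel_right]
  rw [h1, h2, h3, ← sub_eq_iff_eq_add, h4, h5]
  rw [smul_sub, neg_sub]
  simp only [smul_smul, ← sgn_add]
  have e1 : ∀ p q r : ZMod 2, (p + q) * r + r * p = q * r := by decide
  have e2 : ∀ p q r : ZMod 2, (p + q) * r + (p * q + r * q) = p * q + p * r := by decide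
  rw [e1, e2, sub_eq_neg_add]

omit [Fintype Φ] in
theorem exists_parity_decomp_locFin {a : LocAlg n F} (ha : a ∈ locFin n F) :
    ∃ b c, b ∈ parityPart (n := n) (F := F) 0 ∧ c ∈ parityPart (n := n) (F := F) 1 ∧
      b ∈ locFin n F ∧ c ∈ locFin n F ∧ a = b + c := by
  have h1 : parInv a ∈ locFin n F := by rw [← tw_one]; exact tw_mem_locFin 1 ha
  refine ⟨(2⁻¹ : ℝ) • (a + parInv a), (2⁻¹ : ℝ) • (a - parInv a), ?_, ?_,
    Submodule.smul_mem _ _ (Submodule.add_mem _ ha h1),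
    Submodule.smul_mem _ _ (Submodule.sub_mem _ ha h1), ?_⟩
  · rw [mem_parityPart, map_smul, map_add, parInv_parInv, sgn_zero, one_smul, add_comm]
  · rw [mem_parityPart, map_smul, map_sub, parInv_parInv, sgn_one, neg_one_smul, ← smul_neg,
      neg_sub]
  · rw [← smul_add, add_add_sub_cancel, ← two_smul ℝ a, smul_smul]; norm_num

/-- The graded Jacobi identity of the antibracket, up to total divergences. -/
theorem lb_jacobi (t : Φ → ℝ) {p q : ZMod 2} {u v w : LocAlg n F}
    (hu : u ∈ parityPart (p + 1)) (hv : v ∈ parityPart (q + 1))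
    (hu' : u ∈ locFin n F) (hv' : v ∈ locFin n F) (hw' : w ∈ locFin n F) :
    lf n F (lb t u (lb t v w)) =
      lf n F (lb t (lb t u v) w) + sgn (p * q) • lf n F (lb t v (lb t u w)) := by
  obtain ⟨w₀, w₁, h0, h1, h0', h1', rfl⟩ := exists_parity_decomp_locFin hw'
  have e0 := lb_jacobi_of_mem t (r := 1) hu hv (by rwa [CharTwo.add_self_eq_zero]) hu' hv' h0'
  have e1 := lb_jacobi_of_mem t (r := 0) hu hv (by rwa [zero_add]) hu' hv' h1'
  simp only [map_add, e0, e1, smul_add]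
  abel

end

section

variable {Φ : Type u} {n : ℕ} {F : FieldContent Φ} [Fintype Φ]

/-! ### The antibracket of densities -/

open Classical in
/-- The contribution of the pair `φ^A`, `φ*_A` to the antibracket. -/
def lp (A : Φ) : LocAlg n F →ₗ[ℝ] LocAlg n F →ₗ[ℝ] LocAlg n F := lb (Pi.single A 1)

theorem lp_apply (A : Φ) (u v : LocAlg n F) : lp A u v =
    eulerR (Sum.inl A) u * eulerL (Sum.inr A) v - eulerR (Sum.inr A) u * eulerL (Sum.inl A) v := by
  classical
  rw [lp, lb_apply, Finset.sum_eq_single A (fun B _ hB => by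
    rw [Pi.single_eq_of_ne hB, zero_smul]) (fun h => absurd (Finset.mem_univ A) h),
    Pi.single_eq_same, one_smul]

theorem antibracket_apply (a b : Series n F) (m : ℕ) : antibracket a b m =
    ∑ A : Φ, ∑ kl ∈ Finset.HasAntidiagonal.antidiagonal (m + F.gh A + 1),
      lp A (a kl.1) (b kl.2) := by
  simp only [lp_apply]
  rfl

theorem lb_add (t t' : Φ → ℝ) (u v : LocAlg n F) : lb (t + t') u v = lb t u v + lb t' u v := by
  simp only [lb_apply, Pi.add_apply, add_smul, Finset.sum_add_distrib]

/-- The Jacobi identity, polarized in the weights of the field-antifield pairs. -/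
theorem lb_jacobi_polar (t t' : Φ → ℝ) {p q : ZMod 2} {u v w : LocAlg n F}
    (hu : u ∈ parityPart (p + 1)) (hv : v ∈ parityPart (q + 1))
    (hu' : u ∈ locFin n F) (hv' : v ∈ locFin n F) (hw' : w ∈ locFin n F) :
    lf n F (lb t u (lb t' v w) - lb t (lb t' u v) w - sgn (p * q) • lb t v (lb t' u w) +
      (lb t' u (lb t v w) - lb t' (lb t u v) w - sgn (p * q) • lb t' v (lb t u w))) = 0 := by
  have h0 := lb_jacobi (t + t') hu hv hu' hv' hw'
  have h1 := lb_jacobi t hu hv hu' hv' hw'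
  have h2 := lb_jacobi t' hu hv hu' hv' hw'
  simp only [lb_add, map_add, LinearMap.add_apply, smul_add] at h0
  rw [h1, h2] at h0
  simp only [map_add, map_sub, map_smul]
  rw [← sub_eq_zero] at h0
  rw [← h0]
  abel

theorem lp_mem_bigraded (A : Φ) {g k g' k' : ℤ} {u v : LocAlg n F} (hu : u ∈ bigraded g k)
    (hv : v ∈ bigraded g' k') :
    lp A u v ∈ bigraded (g + g' + 1) (k + k' - F.gh A - 1) := by
  rw [lp_apply]
  refine Submodule.sub_mem _ ?_ ?_
  · have := mul_mem_bigraded (eulerR_mem_bigraded hu (Sum.inl A))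
      (eulerL_mem_bigraded hv (Sum.inr A))
    convert this using 1
    simp only [FieldContent.vgh, FieldContent.vaf]
    congr 1 <;> ring
  · have := mul_mem_bigraded (eulerR_mem_bigraded hu (Sum.inr A))
      (eulerL_mem_bigraded hv (Sum.inl A))
    convert this using 1
    simp only [FieldContent.vgh, FieldContent.vaf]
    congr 1 <;> ring

theorem lp_eq_zero {A : Φ} {g g' : ℤ} {k k' : ℕ} {u v : LocAlg n F} (hu : u ∈ bigraded g k)
    (hv : v ∈ bigraded g' k') (h : k + k' < F.gh A + 1) : lp A u v = 0 :=
  bigraded_eq_zero_of_af (by omega) (lp_mem_bigraded A hu hv)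

theorem antibracket_mem_density {g g' g'' : ℤ} (hg : g + g' + 1 = g'') {a b : Series n F}
    (ha : a ∈ density n F g) (hb : b ∈ density n F g') : antibracket a b ∈ density n F g'' := by
  rw [mem_density] at *
  intro m
  rw [antibracket_apply]
  refine Submodule.sum_mem _ fun A _ => Submodule.sum_mem _ fun kl hkl => ?_
  have := lp_mem_bigraded A (ha kl.1) (hb kl.2)
  rw [Finset.HasAntidiagonal.mem_antidiagonal] at hkl
  have e : (kl.1 : ℤ) + kl.2 - F.gh A - 1 = m := by omega
  rwa [hg, e] at this

theorem antibracket_of_left_mem_divergence {g : ℤ} {a b : Series n F} (ha : a ∈ divergence n F g) :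
    antibracket a b = 0 := by
  rw [mem_divergence] at ha
  funext m
  rw [antibracket_apply]
  refine Finset.sum_eq_zero fun A _ => Finset.sum_eq_zero fun kl _ => ?_
  have := locDiv_le_locFinDiv _ _ (ha kl.1)
  rw [lp_apply, eulerR_of_mem_locFinDiv _ this, eulerR_of_mem_locFinDiv _ this, zero_mul, zero_mul,
    sub_zero]

theorem antibracket_of_right_mem_divergence {g : ℤ} {a b : Series n F} (hb : b ∈ divergence n F g) :
    antibracket a b = 0 := by
  rw [mem_divergence] at hb
  funext m
  rw [antibracket_apply]
  refine Finset.sum_eq_zero fun A _ => Finset.sum_eq_zero fun kl _ => ?_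
  have := locDiv_le_locFinDiv _ _ (hb kl.2)
  rw [lp_apply, eulerL_of_mem_locFinDiv _ this, eulerL_of_mem_locFinDiv _ this, mul_zero, mul_zero,
    sub_zero]

omit [Fintype Φ] in
theorem mem_seriesParity {p : ZMod 2} {a : Series n F} :
    a ∈ seriesParity n F p ↔ ∀ k, a k ∈ parityPart p := by
  simp [seriesParity, Submodule.mem_pi]

theorem antibracket_mem_seriesParity {p q : ZMod 2} {a b : Series n F}
    (ha : a ∈ seriesParity n F (p + 1)) (hb : b ∈ seriesParity n F q) :
    antibracket a b ∈ seriesParity n F (p + q) := by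
  rw [mem_seriesParity] at *
  intro m
  rw [antibracket_apply]
  exact Submodule.sum_mem _ fun A _ => Submodule.sum_mem _ fun kl _ =>
    lb_mem_parityPart _ (ha _) (hb _)

theorem antibracket_antisymm {p q : ZMod 2} {a b : Series n F}
    (ha : a ∈ seriesParity n F (p + 1)) (hb : b ∈ seriesParity n F (q + 1)) :
    antibracket a b = -(sgn (p * q) • antibracket b a) := by
  rw [mem_seriesParity] at *
  funext m
  rw [Pi.neg_apply, Pi.smul_apply, antibracket_apply, antibracket_apply, Finset.smul_sum,
    ← Finset.sum_neg_distrib]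
  refine Finset.sum_congr rfl fun A _ => ?_
  rw [← Finset.Nat.sum_antidiagonal_swap, Finset.smul_sum, ← Finset.sum_neg_distrib]
  exact Finset.sum_congr rfl fun kl _ => lb_antisymm _ (ha _) (hb _)

theorem sum_antidiagonal_eq_box {M : Type*} [AddCommMonoid M] (f : ℕ → ℕ → M) {K N : ℕ}
    (hN : K < N) : ∑ kl ∈ Finset.HasAntidiagonal.antidiagonal K, f kl.1 kl.2 =
      ∑ k ∈ Finset.range N, ∑ l ∈ Finset.range N, if k + l = K then f k l else 0 := by
  rw [← Finset.sum_product', ← Finset.sum_filter]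
  refine Finset.sum_congr ?_ fun _ _ => rfl
  ext ⟨k, l⟩
  simp only [Finset.HasAntidiagonal.mem_antidiagonal, Finset.mem_filter, Finset.mem_product,
    Finset.mem_range]
  omega

/-- Two nested sums over antidiagonals as one sum over a box: the ranges may be enlarged because the
terms with `l + p < g` vanish. -/
theorem sum_antidiagonal_triple {M : Type*} [AddCommMonoid M] (f : ℕ → ℕ → ℕ → M) {K N g : ℕ}
    (hf : ∀ k l p, l + p < g → f k l p = 0) (hN : K < N) :
    ∑ kq ∈ Finset.HasAntidiagonal.antidiagonal K, ∑ l ∈ Finset.range N, ∑ p ∈ Finset.range N,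
      (if l + p = kq.2 + g then f kq.1 l p else 0) =
    ∑ k ∈ Finset.range N, ∑ l ∈ Finset.range N, ∑ p ∈ Finset.range N,
      if k + l + p = K + g then f k l p else 0 := by
  rw [sum_antidiagonal_eq_box (fun k q => ∑ l ∈ Finset.range N, ∑ p ∈ Finset.range N,
      (if l + p = q + g then f k l p else 0)) hN]
  refine Finset.sum_congr rfl fun k _ => ?_
  have h1 : ∀ q ∈ Finset.range N, (if k + q = K then ∑ l ∈ Finset.range N, ∑ p ∈ Finset.range N,
      (if l + p = q + g then f k l p else 0) else 0) = ∑ l ∈ Finset.range N, ∑ p ∈ Finset.range N,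
      if k + q = K ∧ l + p = q + g then f k l p else 0 := by
    intro q _
    split_ifs with h <;> simp [h]
  rw [Finset.sum_congr rfl h1, Finset.sum_comm]
  refine Finset.sum_congr rfl fun l _ => ?_
  rw [Finset.sum_comm]
  refine Finset.sum_congr rfl fun p _ => ?_
  by_cases hlp : l + p < g
  · simp [hf k l p hlp]
  · by_cases h : k + l + p = K + g
    · rw [if_pos h, Finset.sum_eq_single (K - k)]
      · rw [if_pos (by omega)]
      · intro q _ hq
        rw [if_neg (by omega)]
      · intro hn
        rw [Finset.mem_range] at hn
        omega
    · rw [if_neg h]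
      exact Finset.sum_eq_zero fun q _ => if_neg (by omega)

theorem antibracket_box (a b : Series n F) {m N : ℕ} (hN : ∀ A, m + F.gh A + 1 < N) :
    antibracket a b m = ∑ A : Φ, ∑ k ∈ Finset.range N, ∑ l ∈ Finset.range N,
      if k + l = m + (F.gh A + 1) then lp A (a k) (b l) else 0 := by
  rw [antibracket_apply]
  exact Finset.sum_congr rfl fun A _ =>
    sum_antidiagonal_eq_box (fun k l => lp A (a k) (b l)) (hN A)

theorem antibracket_antibracket_right {g₂ g₃ : ℤ} {a b c : Series n F}
    (hb : b ∈ density n F g₂) (hc : c ∈ density n F g₃) {m N : ℕ}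
    (hN : ∀ A B, m + F.gh A + F.gh B + 2 < N) :
    antibracket a (antibracket b c) m = ∑ A : Φ, ∑ B : Φ, ∑ k ∈ Finset.range N,
      ∑ l ∈ Finset.range N, ∑ p ∈ Finset.range N,
        if k + l + p = m + F.gh A + 1 + (F.gh B + 1) then lp A (a k) (lp B (b l) (c p)) else 0 := by
  rw [mem_density] at *
  rw [antibracket_apply]
  refine Finset.sum_congr rfl fun A _ => ?_
  have h1 : ∀ kq ∈ Finset.HasAntidiagonal.antidiagonal (m + F.gh A + 1),
      lp A (a kq.1) (antibracket b c kq.2) = ∑ B : Φ, ∑ l ∈ Finset.range N, ∑ p ∈ Finset.range N,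
        if l + p = kq.2 + (F.gh B + 1) then lp A (a kq.1) (lp B (b l) (c p)) else 0 := by
    intro kq hkq
    rw [Finset.HasAntidiagonal.mem_antidiagonal] at hkq
    rw [antibracket_box b c (fun B => by have := hN A B; omega : ∀ B, kq.2 + F.gh B + 1 < N)]
    simp only [map_sum, apply_ite (lp A (a kq.1)), map_zero]
  rw [Finset.sum_congr rfl h1, Finset.sum_comm]
  refine Finset.sum_congr rfl fun B _ => ?_
  exact sum_antidiagonal_triple (fun k l p => lp A (a k) (lp B (b l) (c p)))
    (fun k l p h => by rw [lp_eq_zero (hb l) (hc p) h, map_zero]) (by have := hN A B; omega)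

theorem antibracket_antibracket_left {g₁ g₂ : ℤ} {a b c : Series n F}
    (ha : a ∈ density n F g₁) (hb : b ∈ density n F g₂) {m N : ℕ}
    (hN : ∀ A B, m + F.gh A + F.gh B + 2 < N) :
    antibracket (antibracket a b) c m = ∑ A : Φ, ∑ B : Φ, ∑ p ∈ Finset.range N,
      ∑ k ∈ Finset.range N, ∑ l ∈ Finset.range N,
        if p + k + l = m + F.gh A + 1 + (F.gh B + 1) then lp A (lp B (a k) (b l)) (c p) else 0 := by
  rw [mem_density] at *
  rw [antibracket_apply]
  refine Finset.sum_congr rfl fun A _ => ?_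
  rw [← Finset.Nat.sum_antidiagonal_swap]
  have h1 : ∀ kq ∈ Finset.HasAntidiagonal.antidiagonal (m + F.gh A + 1),
      lp A (antibracket a b kq.swap.1) (c kq.swap.2) =
        ∑ B : Φ, ∑ k ∈ Finset.range N, ∑ l ∈ Finset.range N,
        if k + l = kq.2 + (F.gh B + 1) then lp A (lp B (a k) (b l)) (c kq.1) else 0 := by
    intro kq hkq
    rw [Finset.HasAntidiagonal.mem_antidiagonal] at hkq
    rw [Prod.fst_swap, Prod.snd_swap,
      antibracket_box a b (fun B => by have := hN A B; omega : ∀ B, kq.2 + F.gh B + 1 < N)]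
    simp only [map_sum, LinearMap.sum_apply]
    refine Finset.sum_congr rfl fun B _ => Finset.sum_congr rfl fun k _ =>
      Finset.sum_congr rfl fun l _ => ?_
    split_ifs
    · rfl
    · rw [map_zero, LinearMap.zero_apply]
  rw [Finset.sum_congr rfl h1, Finset.sum_comm]
  refine Finset.sum_congr rfl fun B _ => ?_
  exact sum_antidiagonal_triple (fun p k l => lp A (lp B (a k) (b l)) (c p))
    (fun p k l h => by rw [lp_eq_zero (ha k) (hb l) h, map_zero, LinearMap.zero_apply])
    (by have := hN A B; omega)

/-- The graded Jacobi identity of the antibracket of local functionals. -/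
theorem antibracket_jacobi {p q : ZMod 2} {g₁ g₂ g₃ g₄ : ℤ} (hg : g₁ + g₂ + g₃ + 2 = g₄)
    {a b c : Series n F} (ha : a ∈ density n F g₁) (hb : b ∈ density n F g₂)
    (hc : c ∈ density n F g₃) (ha' : a ∈ seriesParity n F (p + 1))
    (hb' : b ∈ seriesParity n F (q + 1)) :
    antibracket a (antibracket b c) - antibracket (antibracket a b) c -
      sgn (p * q) • antibracket b (antibracket a c) ∈ divergence n F g₄ := by
  have hd : antibracket a (antibracket b c) - antibracket (antibracket a b) c -
      sgn (p * q) • antibracket b (antibracket a c) ∈ density n F g₄ := by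
    refine Submodule.sub_mem _ (Submodule.sub_mem _ ?_ ?_) (Submodule.smul_mem _ _ ?_)
    · exact antibracket_mem_density (by omega) ha (antibracket_mem_density rfl hb hc)
    · exact antibracket_mem_density (by omega) (antibracket_mem_density rfl ha hb) hc
    · exact antibracket_mem_density (by omega) hb (antibracket_mem_density rfl ha hc)
  rw [mem_divergence]
  intro m
  refine mem_locDiv_of_mem_locFinDiv (mem_density.1 hd m) ?_
  rw [← Submodule.Quotient.mk_eq_zero]
  change lf n F _ = 0
  -- a box of side `N` contains every triple of antifield numbers that occurs
  obtain ⟨N, hN⟩ : ∃ N, ∀ A B, m + F.gh A + F.gh B + 2 < N := by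
    refine ⟨m + 2 * (∑ A, F.gh A) + 3, fun A B => ?_⟩
    have h1 := Finset.single_le_sum (f := F.gh) (fun _ _ => Nat.zero_le _) (Finset.mem_univ A)
    have h2 := Finset.single_le_sum (f := F.gh) (fun _ _ => Nat.zero_le _) (Finset.mem_univ B)
    omega
  rw [Pi.sub_apply, Pi.sub_apply, Pi.smul_apply,
    antibracket_antibracket_right hb hc hN, antibracket_antibracket_left ha hb hN,
    antibracket_antibracket_right ha hc hN]
  let J : Φ → Φ → ℕ → ℕ → ℕ → LocAlg n F := fun A B k l r =>
    lp A (a k) (lp B (b l) (c r)) - lp A (lp B (a k) (b l)) (c r) -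
      sgn (p * q) • lp A (b l) (lp B (a k) (c r))
  have key : ∀ A B, (∑ k ∈ Finset.range N, ∑ l ∈ Finset.range N, ∑ r ∈ Finset.range N,
      if k + l + r = m + F.gh A + 1 + (F.gh B + 1) then lp A (a k) (lp B (b l) (c r)) else 0) -
      (∑ r ∈ Finset.range N, ∑ k ∈ Finset.range N, ∑ l ∈ Finset.range N,
        if r + k + l = m + F.gh A + 1 + (F.gh B + 1) then lp A (lp B (a k) (b l)) (c r) else 0) -
      sgn (p * q) • (∑ l ∈ Finset.range N, ∑ k ∈ Finset.range N, ∑ r ∈ Finset.range N,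
      if l + k + r = m + F.gh A + 1 + (F.gh B + 1) then lp A (b l) (lp B (a k) (c r)) else 0) =
      ∑ k ∈ Finset.range N, ∑ l ∈ Finset.range N, ∑ r ∈ Finset.range N,
        if k + l + r = m + F.gh A + 1 + (F.gh B + 1) then J A B k l r else 0 := by
    intro A B
    have h1 : (∑ r ∈ Finset.range N, ∑ k ∈ Finset.range N, ∑ l ∈ Finset.range N,
        if r + k + l = m + F.gh A + 1 + (F.gh B + 1) then lp A (lp B (a k) (b l)) (c r) else 0) =
        ∑ k ∈ Finset.range N, ∑ l ∈ Finset.range N, ∑ r ∈ Finset.range N,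
        if k + l + r = m + F.gh A + 1 + (F.gh B + 1) then lp A (lp B (a k) (b l)) (c r) else 0 := by
      rw [Finset.sum_comm]
      refine Finset.sum_congr rfl fun k _ => ?_
      rw [Finset.sum_comm]
      refine Finset.sum_congr rfl fun l _ => Finset.sum_congr rfl fun r _ => ?_
      rw [show r + k + l = k + l + r by omega]
    rw [h1, Finset.sum_comm (s := Finset.range N) (t := Finset.range N) (f := fun l k =>
      ∑ r ∈ Finset.range N,
        if l + k + r = m + F.gh A + 1 + (F.gh B + 1) then lp A (b l) (lp B (a k) (c r)) else 0)]
    simp only [Finset.smul_sum, ← Finset.sum_sub_distrib]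
    refine Finset.sum_congr rfl fun k _ => Finset.sum_congr rfl fun l _ =>
      Finset.sum_congr rfl fun r _ => ?_
    rw [show l + k + r = k + l + r by omega]
    split_ifs
    · rfl
    · rw [smul_zero, sub_zero, sub_zero]
  rw [Finset.smul_sum, ← Finset.sum_sub_distrib, ← Finset.sum_sub_distrib]
  simp only [Finset.smul_sum (s := Finset.univ), ← Finset.sum_sub_distrib (s := Finset.univ), key]
  -- the condition on `k + l + r` is symmetric in `A`, `B`, so that the polarized identity applies
  have hJ : ∀ A B k l r, lf n F (J A B k l r) + lf n F (J B A k l r) = 0 := by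
    intro A B k l r
    rw [← map_add]
    exact lb_jacobi_polar _ _ (mem_seriesParity.1 ha' k) (mem_seriesParity.1 hb' l)
      (bigraded_le_locFin _ _ (mem_density.1 ha k)) (bigraded_le_locFin _ _ (mem_density.1 hb l))
      (bigraded_le_locFin _ _ (mem_density.1 hc r))
  set T : Φ → Φ → LocAlg n F := fun A B => ∑ k ∈ Finset.range N, ∑ l ∈ Finset.range N,
    ∑ r ∈ Finset.range N,
      if k + l + r = m + F.gh A + 1 + (F.gh B + 1) then J A B k l r else 0 with hT
  have hTT : ∀ A B, lf n F (T A B) + lf n F (T B A) = 0 := by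
    intro A B
    simp only [hT, map_sum, ← Finset.sum_add_distrib]
    refine Finset.sum_eq_zero fun k _ => Finset.sum_eq_zero fun l _ =>
      Finset.sum_eq_zero fun r _ => ?_
    rw [show m + F.gh B + 1 + (F.gh A + 1) = m + F.gh A + 1 + (F.gh B + 1) by omega]
    split_ifs
    · exact hJ A B k l r
    · rw [map_zero, add_zero]
  change lf n F (∑ A, ∑ B, T A B) = 0
  simp only [map_sum]
  have h2 : (2 : ℝ) • ∑ A, ∑ B, lf n F (T A B) = 0 := by
    rw [two_smul]
    nth_rw 2 [Finset.sum_comm]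
    simp only [← Finset.sum_add_distrib, hTT, Finset.sum_const_zero]
  rw [← one_smul ℝ (∑ A, ∑ B, lf n F (T A B)), ← inv_mul_cancel₀ (two_ne_zero' ℝ), mul_smul, h2,
    smul_zero]

end

section

variable {Φ : Type u} {n : ℕ} {F : FieldContent Φ}

/-! ### Parity components of densities -/

/-- Projection of local functions to the component of parity `p`. -/
def parProj (p : ZMod 2) : LocAlg n F →ₗ[ℝ] LocAlg n F :=
  (2⁻¹ : ℝ) • (LinearMap.id + sgn p • parInv)

theorem parProj_apply (p : ZMod 2) (a : LocAlg n F) :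
    parProj p a = (2⁻¹ : ℝ) • (a + sgn p • parInv a) := rfl

theorem parProj_mem (p : ZMod 2) (a : LocAlg n F) : parProj p a ∈ parityPart p := by
  rw [mem_parityPart, parProj_apply, map_smul, map_add, map_smul, parInv_parInv,
    smul_comm (sgn p) (2⁻¹ : ℝ), smul_add (sgn p), smul_smul (sgn p) (sgn p), sgn_mul_self,
    one_smul, add_comm]

theorem parProj_of_mem {p : ZMod 2} {a : LocAlg n F} (ha : a ∈ parityPart p) : parProj p a = a := by
  rw [mem_parityPart] at ha
  rw [parProj_apply, ha, smul_smul, sgn_mul_self, one_smul, ← two_smul ℝ a, smul_smul]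
  norm_num

theorem parProj_of_mem_add_one {p : ZMod 2} {a : LocAlg n F} (ha : a ∈ parityPart p) :
    parProj (p + 1) a = 0 := by
  rw [mem_parityPart] at ha
  rw [parProj_apply, ha, smul_smul, sgn_add, mul_right_comm, sgn_mul_self, sgn_one, one_mul,
    neg_one_smul, add_neg_cancel, smul_zero]

theorem parProj_add_parProj (p : ZMod 2) (a : LocAlg n F) :
    parProj p a + parProj (p + 1) a = a := by
  rw [parProj_apply, parProj_apply, sgn_add, sgn_one, mul_neg_one, neg_smul, ← smul_add,
    add_add_add_comm, add_neg_cancel, add_zero, ← two_smul ℝ a, smul_smul]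
  norm_num

theorem parProj_mem_bigraded (p : ZMod 2) {g k : ℤ} {a : LocAlg n F} (ha : a ∈ bigraded g k) :
    parProj p a ∈ bigraded g k :=
  Submodule.smul_mem _ _ (Submodule.add_mem _ ha (Submodule.smul_mem _ _ (parInv_mem_bigraded ha)))

theorem parProj_totalD (p : ZMod 2) (μ : Fin n) (a : LocAlg n F) :
    parProj p (totalD μ a) = totalD μ (parProj p a) := by
  rw [parProj_apply, parProj_apply, map_smul, map_add, map_smul, totalD_parInv]

theorem parProj_mem_locDiv (p : ZMod 2) {g k : ℤ} {a : LocAlg n F} (ha : a ∈ locDiv n F g k) :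
    parProj p a ∈ locDiv n F g k := by
  have : locDiv n F g k ≤ (locDiv n F g k).comap (parProj p) :=
    iSup_le fun μ => Submodule.map_le_iff_le_comap.2 fun b hb => by
      rw [Submodule.mem_comap, Submodule.mem_comap, parProj_totalD]
      exact Submodule.mem_iSup_of_mem μ ⟨_, parProj_mem_bigraded p hb, rfl⟩
  exact this ha

/-- Projection of densities to the component of parity `p`. -/
def serProj (p : ZMod 2) : Series n F →ₗ[ℝ] Series n F := LinearMap.compLeft (parProj p) ℕ

theorem serProj_apply (p : ZMod 2) (a : Series n F) (k : ℕ) : serProj p a k = parProj p (a k) := rfl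

theorem serProj_mem (p : ZMod 2) (a : Series n F) : serProj p a ∈ seriesParity n F p :=
  mem_seriesParity.2 fun k => parProj_mem p (a k)

theorem serProj_of_mem {p : ZMod 2} {a : Series n F} (ha : a ∈ seriesParity n F p) :
    serProj p a = a :=
  funext fun k => parProj_of_mem (mem_seriesParity.1 ha k)

theorem serProj_of_mem_add_one {p : ZMod 2} {a : Series n F} (ha : a ∈ seriesParity n F p) :
    serProj (p + 1) a = 0 :=
  funext fun k => parProj_of_mem_add_one (mem_seriesParity.1 ha k)

theorem serProj_add_serProj (p : ZMod 2) (a : Series n F) :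
    serProj p a + serProj (p + 1) a = a := funext fun k => parProj_add_parProj p (a k)

theorem serProj_mem_density (p : ZMod 2) {g : ℤ} {a : Series n F} (ha : a ∈ density n F g) :
    serProj p a ∈ density n F g :=
  mem_density.2 fun k => parProj_mem_bigraded p (mem_density.1 ha k)

theorem serProj_mem_divergence (p : ZMod 2) {g : ℤ} {a : Series n F} (ha : a ∈ divergence n F g) :
    serProj p a ∈ divergence n F g :=
  mem_divergence.2 fun k => parProj_mem_locDiv p (mem_divergence.1 ha k)

/-- To prove a linear property of elements of a submodule stable under the parity projections, one
may assume a definite parity. -/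
theorem mem_of_serProj {M : Type*} [AddCommGroup M] [Module ℝ M] (T : Series n F →ₗ[ℝ] M)
    {N : Submodule ℝ M} (a : Series n F) (h : ∀ p, T (serProj p a) ∈ N) : T a ∈ N := by
  rw [← serProj_add_serProj 0 a, map_add]
  exact Submodule.add_mem _ (h _) (h _)

/-! ### The antibracket in cohomology -/

variable [Fintype Φ] {S : Series n F}

theorem brst_apply (a : Series n F) : brst S a = antibracket a S := rfl

theorem mem_cocycles {g : ℤ} {a : Series n F} :
    a ∈ cocycles S g ↔ a ∈ density n F g ∧ antibracket a S ∈ divergence n F (g + 1) := Iff.rfl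

theorem mem_coboundaries {g : ℤ} {a : Series n F} : a ∈ coboundaries S g ↔
    ∃ b ∈ density n F (g - 1), a - antibracket b S ∈ divergence n F g := by
  constructor
  · intro h
    obtain ⟨_, ⟨b, hb, rfl⟩, d, hd, rfl⟩ := Submodule.mem_sup.1 h
    exact ⟨b, hb, by rw [brst_apply, add_sub_cancel_left]; exact hd⟩
  · rintro ⟨b, hb, h⟩
    exact Submodule.mem_sup.2 ⟨_, ⟨b, hb, rfl⟩, _, h, by rw [brst_apply, add_sub_cancel]⟩

namespace IsMasterAction

variable (hS : IsMasterAction S)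
include hS

theorem even' : S ∈ seriesParity n F (1 + 1) := hS.even

theorem self_mem : antibracket S S ∈ divergence n F 1 := by
  have := Submodule.smul_mem _ (2 : ℝ) hS.master
  rwa [smul_smul, mul_inv_cancel₀ two_ne_zero, one_smul] at this

theorem brst_mem_density {g g' : ℤ} (h : g + 1 = g') {a : Series n F} (ha : a ∈ density n F g) :
    antibracket a S ∈ density n F g' :=
  antibracket_mem_density (by omega) ha hS.ghost_zero

theorem brst_mem_seriesParity {p : ZMod 2} {a : Series n F} (ha : a ∈ seriesParity n F (p + 1)) :
    antibracket a S ∈ seriesParity n F p := by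
  have := antibracket_mem_seriesParity ha hS.even
  rwa [add_zero] at this

theorem brst_serProj (p : ZMod 2) (a : Series n F) :
    antibracket (serProj (p + 1) a) S = serProj p (antibracket a S) := by
  have h1 := hS.brst_mem_seriesParity (serProj_mem (p + 1) a)
  have h2 : antibracket (serProj (p + 1 + 1) a) S ∈ seriesParity n F (p + 1) :=
    hS.brst_mem_seriesParity (serProj_mem _ a)
  have h3 := serProj_of_mem_add_one h2
  rw [add_assoc p 1 1, CharTwo.add_self_eq_zero, add_zero] at h3
  nth_rw 2 [← serProj_add_serProj (p + 1) a]
  rw [map_add, LinearMap.add_apply, map_add, serProj_of_mem h1, add_assoc,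
    CharTwo.add_self_eq_zero, add_zero, h3, add_zero]

/-- The BRST differential squares to zero on local functionals. -/
theorem brst_brst {g g' : ℤ} (hg : g + 2 = g') {a : Series n F} (ha : a ∈ density n F g) :
    antibracket (antibracket a S) S ∈ divergence n F g' := by
  refine mem_of_serProj ((brst S) ∘ₗ (brst S)) a fun p => ?_
  obtain ⟨p, rfl⟩ : ∃ q, p = q + 1 := ⟨p + 1, by
    rw [add_assoc, CharTwo.add_self_eq_zero, add_zero]⟩
  have hp := serProj_mem (p + 1) a
  have hd := serProj_mem_density (p + 1) ha
  have h := antibracket_jacobi (by omega : g + 0 + 0 + 2 = g') hd hS.ghost_zero hS.ghost_zero hp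
    hS.even'
  rw [antibracket_of_right_mem_divergence hS.self_mem, zero_sub, mul_one] at h
  have hq : antibracket (serProj (p + 1) a) S ∈ seriesParity n F (p + 1 + 1) := by
    rw [add_assoc, CharTwo.add_self_eq_zero, add_zero]
    exact hS.brst_mem_seriesParity hp
  rw [antibracket_antisymm hS.even' hq, one_mul, smul_neg, smul_smul, ← sgn_add, sub_neg_eq_add,
    ← add_assoc, CharTwo.add_self_eq_zero, zero_add, sgn_one, neg_one_smul, ← neg_add,
    Submodule.neg_mem_iff, ← two_smul ℝ] at h
  have := Submodule.smul_mem _ (2⁻¹ : ℝ) h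
  rwa [smul_smul, inv_mul_cancel₀ two_ne_zero, one_smul] at this

omit hS in
theorem divergence_le_cocycles (g : ℤ) : divergence n F g ≤ cocycles S g := fun a ha =>
  mem_cocycles.2 ⟨divergence_le_density g ha, by
    rw [antibracket_of_left_mem_divergence ha]; exact Submodule.zero_mem _⟩

omit hS in
theorem divergence_le_coboundaries (g : ℤ) : divergence n F g ≤ coboundaries S g := le_sup_right

theorem brst_mem_cocycles {g g' : ℤ} (hg : g + 1 = g') {b : Series n F} (hb : b ∈ density n F g) :
    antibracket b S ∈ cocycles S g' :=
  mem_cocycles.2 ⟨hS.brst_mem_density hg hb, hS.brst_brst (by omega) hb⟩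

omit hS in
theorem brst_mem_coboundaries {g g' : ℤ} (hg : g + 1 = g') {b : Series n F}
    (hb : b ∈ density n F g) : antibracket b S ∈ coboundaries S g' :=
  mem_coboundaries.2 ⟨b, by rwa [← hg, add_sub_cancel_right], by
    rw [sub_self]; exact Submodule.zero_mem _⟩

theorem coboundaries_le_cocycles (g : ℤ) : coboundaries S g ≤ cocycles S g := by
  intro a ha
  obtain ⟨b, hb, h⟩ := mem_coboundaries.1 ha
  rw [← sub_add_cancel a (antibracket b S)]
  exact Submodule.add_mem _ (divergence_le_cocycles g h) (hS.brst_mem_cocycles (by omega) hb)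

theorem serProj_mem_cocycles (p : ZMod 2) {g : ℤ} {a : Series n F} (ha : a ∈ cocycles S g) :
    serProj p a ∈ cocycles S g := by
  rw [mem_cocycles] at *
  obtain ⟨p, rfl⟩ : ∃ q, p = q + 1 := ⟨p + 1, by
    rw [add_assoc, CharTwo.add_self_eq_zero, add_zero]⟩
  exact ⟨serProj_mem_density _ ha.1, by
    rw [hS.brst_serProj]; exact serProj_mem_divergence _ ha.2⟩

theorem serProj_mem_coboundaries (p : ZMod 2) {g : ℤ} {a : Series n F} (ha : a ∈ coboundaries S g) :
    serProj p a ∈ coboundaries S g := by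
  rw [mem_coboundaries] at *
  obtain ⟨b, hb, h⟩ := ha
  refine ⟨serProj (p + 1) b, serProj_mem_density _ hb, ?_⟩
  rw [hS.brst_serProj, ← map_sub]
  exact serProj_mem_divergence _ h

/-- By the Jacobi identity, applied to the components of definite parity, `s` is a derivation of the
antibracket. -/
theorem antibracket_mem_cocycles {g₁ g₂ g₃ : ℤ} (hg : g₁ + g₂ + 1 = g₃) {a b : Series n F}
    (ha : a ∈ cocycles S g₁) (hb : b ∈ cocycles S g₂) : antibracket a b ∈ cocycles S g₃ := by
  refine mem_cocycles.2 ⟨antibracket_mem_density hg ha.1 hb.1, ?_⟩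
  have key : ∀ p q, antibracket (antibracket (serProj p a) (serProj q b)) S ∈
      divergence n F (g₃ + 1) := by
    intro p q
    obtain ⟨p, rfl⟩ : ∃ p', p = p' + 1 := ⟨p + 1, by
      rw [add_assoc, CharTwo.add_self_eq_zero, add_zero]⟩
    obtain ⟨q, rfl⟩ : ∃ p', q = p' + 1 := ⟨q + 1, by
      rw [add_assoc, CharTwo.add_self_eq_zero, add_zero]⟩
    have h1 := mem_cocycles.1 (hS.serProj_mem_cocycles (p + 1) ha)
    have h2 := mem_cocycles.1 (hS.serProj_mem_cocycles (q + 1) hb)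
    have h := antibracket_jacobi (by omega : g₁ + g₂ + 0 + 2 = g₃ + 1) h1.1 h2.1 hS.ghost_zero
      (serProj_mem _ _) (serProj_mem _ _)
    rwa [antibracket_of_right_mem_divergence h1.2, antibracket_of_right_mem_divergence h2.2,
      smul_zero, sub_zero, zero_sub, Submodule.neg_mem_iff] at h
  rw [← serProj_add_serProj 0 a, ← serProj_add_serProj 0 b]
  simp only [map_add, LinearMap.add_apply]
  exact Submodule.add_mem _ (Submodule.add_mem _ (key _ _) (key _ _))
    (Submodule.add_mem _ (key _ _) (key _ _))

/-- The antibracket `(b, s c)` of a cocycle with a coboundary is `± s (b, c)`. -/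
theorem antibracket_brst_mem_coboundaries {g₁ g₂ g₃ : ℤ} (hg : g₁ + g₂ + 2 = g₃) {b c : Series n F}
    (hb : b ∈ cocycles S g₁) (hc : c ∈ density n F g₂) :
    antibracket b (antibracket c S) ∈ coboundaries S g₃ ∧
      antibracket (antibracket c S) b ∈ coboundaries S g₃ := by
  have key : ∀ p q, antibracket (serProj p b) (antibracket (serProj q c) S) ∈ coboundaries S g₃ ∧
      antibracket (antibracket (serProj q c) S) (serProj p b) ∈ coboundaries S g₃ := by
    intro p q
    obtain ⟨p, rfl⟩ : ∃ p', p = p' + 1 := ⟨p + 1, by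
      rw [add_assoc, CharTwo.add_self_eq_zero, add_zero]⟩
    obtain ⟨q, rfl⟩ : ∃ p', q = p' + 1 := ⟨q + 1, by
      rw [add_assoc, CharTwo.add_self_eq_zero, add_zero]⟩
    have h1 := hS.serProj_mem_cocycles (p + 1) hb
    have h2 := serProj_mem_density (q + 1) hc
    have h := antibracket_jacobi (by omega : g₁ + g₂ + 0 + 2 = g₃) h1.1 h2 hS.ghost_zero
      (serProj_mem _ _) (serProj_mem _ _)
    rw [(antibracket_of_right_mem_divergence (mem_cocycles.1 h1).2 :
      antibracket (serProj (q + 1) c) _ = 0), smul_zero, sub_zero] at h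
    have h3 : antibracket (antibracket (serProj (p + 1) b) (serProj (q + 1) c)) S ∈
        coboundaries S g₃ :=
      brst_mem_coboundaries (by omega) (antibracket_mem_density rfl h1.1 h2)
    have h4 := Submodule.add_mem _ (divergence_le_coboundaries _ h) h3
    rw [sub_add_cancel] at h4
    have hq : antibracket (serProj (q + 1) c) S ∈ seriesParity n F (q + 1 + 1) := by
      rw [add_assoc, CharTwo.add_self_eq_zero, add_zero]
      exact hS.brst_mem_seriesParity (serProj_mem _ _)
    refine ⟨h4, ?_⟩
    rw [antibracket_antisymm hq (serProj_mem _ _)]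
    exact Submodule.neg_mem _ (Submodule.smul_mem _ _ h4)
  rw [← serProj_add_serProj 0 b, ← serProj_add_serProj 0 c]
  simp only [map_add, LinearMap.add_apply]
  exact ⟨Submodule.add_mem _ (Submodule.add_mem _ (key _ _).1 (key _ _).1)
      (Submodule.add_mem _ (key _ _).1 (key _ _).1),
    Submodule.add_mem _ (Submodule.add_mem _ (key _ _).2 (key _ _).2)
      (Submodule.add_mem _ (key _ _).2 (key _ _).2)⟩

theorem antibracket_mem_coboundaries_right {g₁ g₂ g₃ : ℤ} (hg : g₁ + g₂ + 1 = g₃) {a b : Series n F}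
    (ha : a ∈ cocycles S g₁) (hb : b ∈ coboundaries S g₂) :
    antibracket a b ∈ coboundaries S g₃ := by
  obtain ⟨c, hc, h⟩ := mem_coboundaries.1 hb
  rw [← sub_add_cancel b (antibracket c S), map_add,
    antibracket_of_right_mem_divergence h, zero_add]
  exact (hS.antibracket_brst_mem_coboundaries (by omega) ha hc).1

theorem antibracket_mem_coboundaries_left {g₁ g₂ g₃ : ℤ} (hg : g₁ + g₂ + 1 = g₃) {a b : Series n F}
    (ha : a ∈ coboundaries S g₁) (hb : b ∈ cocycles S g₂) :
    antibracket a b ∈ coboundaries S g₃ := by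
  obtain ⟨c, hc, h⟩ := mem_coboundaries.1 ha
  rw [← sub_add_cancel a (antibracket c S), map_add, LinearMap.add_apply,
    antibracket_of_left_mem_divergence h, zero_add]
  exact (hS.antibracket_brst_mem_coboundaries (by omega) hb hc).2

omit hS in
theorem cls_eq_zero {g : ℤ} {a : cocycles S g} :
    cls S g a = 0 ↔ (a : Series n F) ∈ coboundaries S g :=
  (Submodule.Quotient.mk_eq_zero _).trans Iff.rfl

omit hS in
theorem cls_surjective (g : ℤ) (x : H S g) : ∃ a, cls S g a = x := Submodule.mkQ_surjective _ x

end IsMasterAction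

end

section

variable {Φ : Type u} {n : ℕ} {F : FieldContent Φ} [Fintype Φ] {S : Series n F}

/-! ### Graded Lie algebra and module structures -/

namespace IsMasterAction

variable (hS : IsMasterAction S)
include hS

/-- The antibracket of cocycles, with values in cohomology. -/
def cocycleBracket {g₁ g₂ g₃ : ℤ} (hg : g₁ + g₂ + 1 = g₃) :
    cocycles S g₁ →ₗ[ℝ] cocycles S g₂ →ₗ[ℝ] H S g₃ :=
  LinearMap.mk₂ ℝ (fun a b => cls S g₃ ⟨antibracket (a : Series n F) b,
      hS.antibracket_mem_cocycles hg a.2 b.2⟩)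
    (fun a a' b => by
      rw [← map_add]; congr 1; ext1
      exact LinearMap.congr_fun (map_add antibracket (a : Series n F) a') (b : Series n F))
    (fun r a b => by
      rw [← map_smul]; congr 1; ext1
      exact LinearMap.congr_fun (map_smul antibracket r (a : Series n F)) (b : Series n F))
    (fun a b b' => by
      rw [← map_add]; congr 1; ext1
      exact map_add (antibracket (a : Series n F)) (b : Series n F) b')
    (fun r a b => by
      rw [← map_smul]; congr 1; ext1
      exact map_smul (antibracket (a : Series n F)) r (b : Series n F))

theorem cocycleBracket_apply {g₁ g₂ g₃ : ℤ} (hg : g₁ + g₂ + 1 = g₃) (a : cocycles S g₁)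
    (b : cocycles S g₂) : hS.cocycleBracket hg a b =
      cls S g₃ ⟨antibracket (a : Series n F) b, hS.antibracket_mem_cocycles hg a.2 b.2⟩ := rfl

theorem comap_coboundaries_le_ker {g₁ g₂ g₃ : ℤ} (hg : g₁ + g₂ + 1 = g₃) :
    (coboundaries S g₁).comap (cocycles S g₁).subtype ≤ LinearMap.ker (hS.cocycleBracket hg) := by
  intro a ha
  have ha' : (a : Series n F) ∈ coboundaries S g₁ := ha
  rw [LinearMap.mem_ker]
  refine LinearMap.ext fun b => ?_
  rw [cocycleBracket_apply, LinearMap.zero_apply, cls_eq_zero]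
  exact hS.antibracket_mem_coboundaries_left hg ha' b.2

theorem comap_coboundaries_le_ker_flip {g₁ g₂ g₃ : ℤ} (hg : g₁ + g₂ + 1 = g₃) :
    (coboundaries S g₂).comap (cocycles S g₂).subtype ≤
      LinearMap.ker (hS.cocycleBracket hg).flip := by
  intro b hb
  have hb' : (b : Series n F) ∈ coboundaries S g₂ := hb
  rw [LinearMap.mem_ker]
  refine LinearMap.ext fun a => ?_
  rw [LinearMap.flip_apply, cocycleBracket_apply, LinearMap.zero_apply, cls_eq_zero]
  exact hS.antibracket_mem_coboundaries_right hg a.2 hb'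

/-- The antibracket map in cohomology. -/
def cohomBracket {g₁ g₂ g₃ : ℤ} (hg : g₁ + g₂ + 1 = g₃) : H S g₁ →ₗ[ℝ] H S g₂ →ₗ[ℝ] H S g₃ :=
  LinearMap.liftQ₂ ((coboundaries S g₁).comap (cocycles S g₁).subtype)
    ((coboundaries S g₂).comap (cocycles S g₂).subtype) (hS.cocycleBracket hg)
    (hS.comap_coboundaries_le_ker hg) (hS.comap_coboundaries_le_ker_flip hg)

theorem cohomBracket_cls {g₁ g₂ g₃ : ℤ} (hg : g₁ + g₂ + 1 = g₃) (a : cocycles S g₁)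
    (b : cocycles S g₂) : hS.cohomBracket hg (cls S g₁ a) (cls S g₂ b) =
      cls S g₃ ⟨antibracket (a : Series n F) b, hS.antibracket_mem_cocycles hg a.2 b.2⟩ := rfl

omit hS in
theorem mem_parityH {g : ℤ} {p : ZMod 2} {x : H S g} : x ∈ parityH S g p ↔
    ∃ a : cocycles S g, (a : Series n F) ∈ seriesParity n F p ∧ cls S g a = x := Iff.rfl

omit hS in
theorem cls_mem_parityH {g : ℤ} {p : ZMod 2} {a : Series n F} (h : a ∈ cocycles S g)
    (ha : a ∈ seriesParity n F p) : cls S g ⟨a, h⟩ ∈ parityH S g p := ⟨⟨a, h⟩, ha, rfl⟩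

theorem parityH_isCompl (g : ℤ) (p : ZMod 2) : IsCompl (parityH S g p) (parityH S g (p + 1)) := by
  constructor
  · rw [Submodule.disjoint_def]
    intro x hx hx'
    obtain ⟨a, ha, rfl⟩ := mem_parityH.1 hx
    obtain ⟨b, hb, h⟩ := mem_parityH.1 hx'
    have h1 : cls S g (a - b) = 0 := by rw [map_sub, h, sub_self]
    rw [cls_eq_zero] at h1 ⊢
    have h2 := hS.serProj_mem_coboundaries p h1
    have h3 : serProj p (b : Series n F) = 0 := by
      have := serProj_of_mem_add_one (p := p + 1) hb
      rwa [add_assoc, CharTwo.add_self_eq_zero, add_zero] at this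
    have h4 : ((a - b : cocycles S g) : Series n F) = a - b := rfl
    rw [h4, map_sub, h3, sub_zero, serProj_of_mem ha] at h2
    exact h2
  · rw [codisjoint_iff, eq_top_iff]
    rintro x -
    obtain ⟨a, rfl⟩ := cls_surjective g x
    have h1 := hS.serProj_mem_cocycles p a.2
    have h2 := hS.serProj_mem_cocycles (p + 1) a.2
    have : a = ⟨serProj p a, h1⟩ + ⟨serProj (p + 1) a, h2⟩ :=
      Subtype.ext (serProj_add_serProj p (a : Series n F)).symm
    have h3 := Submodule.add_mem_sup (cls_mem_parityH h1 (serProj_mem p (a : Series n F)))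
      (cls_mem_parityH h2 (serProj_mem (p + 1) (a : Series n F)))
    rwa [← map_add, ← this] at h3

theorem cohomBracket_mem_parityH {g₁ g₂ g₃ : ℤ} (hg : g₁ + g₂ + 1 = g₃) {p q : ZMod 2}
    {x : H S g₁} {y : H S g₂} (hx : x ∈ parityH S g₁ (p + 1)) (hy : y ∈ parityH S g₂ q) :
    hS.cohomBracket hg x y ∈ parityH S g₃ (p + q) := by
  obtain ⟨a, ha, rfl⟩ := mem_parityH.1 hx
  obtain ⟨b, hb, rfl⟩ := mem_parityH.1 hy
  rw [cohomBracket_cls]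
  exact cls_mem_parityH _ (antibracket_mem_seriesParity ha hb)

theorem cohomBracket_jacobi {g₁ g₂ g₃ g₁₂ g₂₃ g₁₃ g : ℤ} (h₁₂ : g₁ + g₂ + 1 = g₁₂)
    (h₂₃ : g₂ + g₃ + 1 = g₂₃) (h₁₃ : g₁ + g₃ + 1 = g₁₃) (h : g₁ + g₂₃ + 1 = g)
    (h' : g₁₂ + g₃ + 1 = g) (h'' : g₂ + g₁₃ + 1 = g) {p q : ZMod 2}
    {x : H S g₁} {y : H S g₂} (hx : x ∈ parityH S g₁ (p + 1)) (hy : y ∈ parityH S g₂ (q + 1))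
    (z : H S g₃) :
    hS.cohomBracket h x (hS.cohomBracket h₂₃ y z) =
      hS.cohomBracket h' (hS.cohomBracket h₁₂ x y) z +
        ksgn p q • hS.cohomBracket h'' y (hS.cohomBracket h₁₃ x z) := by
  obtain ⟨a, ha, rfl⟩ := mem_parityH.1 hx
  obtain ⟨b, hb, rfl⟩ := mem_parityH.1 hy
  obtain ⟨c, rfl⟩ := cls_surjective g₃ z
  simp only [cohomBracket_cls]
  rw [← map_smul, ← map_add, ← sub_eq_zero, ← map_sub, cls_eq_zero]
  refine divergence_le_coboundaries _ ?_
  have := antibracket_jacobi (by omega : g₁ + g₂ + g₃ + 2 = g) a.2.1 b.2.1 c.2.1 ha hb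
  rw [sub_sub, ← ksgn_eq] at this
  exact this

theorem isGradedLie : IsGradedLie (shiftedParity S)
    (hS.cohomBracket (by norm_num : (-1 : ℤ) + -1 + 1 = -1)) where
  decomp := hS.parityH_isCompl (-1) (0 + 1)
  bracket_mem p q x y hx hy := by
    have := hS.cohomBracket_mem_parityH (by norm_num : (-1 : ℤ) + -1 + 1 = -1) hx hy
    rwa [← add_assoc] at this
  skew p q x y hx hy := by
    obtain ⟨a, ha, rfl⟩ := mem_parityH.1 hx
    obtain ⟨b, hb, rfl⟩ := mem_parityH.1 hy
    rw [cohomBracket_cls, cohomBracket_cls, ← map_smul, ← map_neg]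
    congr 1
    ext1
    rw [ksgn_eq]
    exact antibracket_antisymm ha hb
  jacobi p q x y z hx hy := hS.cohomBracket_jacobi _ _ _ _ _ _ hx hy z

/-- `H^g(s)` is a module over every graded Lie algebra that is mapped homomorphically to
`H^{-1}(s)`. -/
theorem isGradedModule {L : Type u} [AddCommGroup L] [Module ℝ L] {par : ZMod 2 → Submodule ℝ L}
    {br : L →ₗ[ℝ] L →ₗ[ℝ] L} (ψ : L →ₗ[ℝ] H S (-1))
    (hpar : ∀ p, ∀ x ∈ par p, ψ x ∈ shiftedParity S p)
    (hbr : ∀ x y, ψ (br x y) =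
      hS.cohomBracket (by norm_num : (-1 : ℤ) + -1 + 1 = -1) (ψ x) (ψ y))
    (g : ℤ) (h : -1 + g + 1 = g) (𝔤 : GradedSubalgebra par br) :
    IsGradedModule 𝔤 (parityH S g) ((hS.cohomBracket h ∘ₗ ψ).domRestrict 𝔤.carrier) where
  decomp := hS.parityH_isCompl g 0
  act_mem p q x m hx hm := hS.cohomBracket_mem_parityH h (hpar p _ hx) hm
  act_bracket p q x y m hx hy := by
    rw [eq_sub_iff_add_eq]
    have := hS.cohomBracket_jacobi (by norm_num) h h h h h (hpar p _ hx) (hpar q _ hy) m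
    refine Eq.trans ?_ this.symm
    rw [← hbr]
    rfl

end IsMasterAction

end

section

variable {Φ : Type u} {n : ℕ} {F : FieldContent Φ} [Fintype Φ]

/-! ### Evolutionary derivations of definite degree -/

theorem pro_mem_bigraded {X : Var Φ → LocAlg n F} {d e : ℤ}
    (hX : ∀ z, X z ∈ bigraded (F.vgh z + d) (F.vaf z + e)) {g k : ℤ} {a : LocAlg n F}
    (ha : a ∈ bigraded g k) : pro X a ∈ bigraded (g + d) (k + e) := by
  obtain ⟨s, hs⟩ := exists_pdL_support a
  rw [pro_eq_sum X a s hs]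
  refine Submodule.sum_mem _ fun q _ => ?_
  have := mul_mem_bigraded (totalDI_mem_bigraded (hX q.1) q.2) (pdL_mem_bigraded ha q.1 q.2)
  convert this using 1
  congr 1 <;> ring

omit [Fintype Φ] in
theorem tw_tw (p : ZMod 2) (a : LocAlg n F) : tw p (tw p a) = a := by
  rw [← tw_add, CharTwo.add_self_eq_zero, tw_zero]

/-- Right derivatives with respect to a variable on which a characteristic does not depend commute
with the evolutionary derivation. -/
theorem pdR_pro {X : Var Φ → LocAlg n F} {z : Var Φ} {J : MI n}
    (h : ∀ w I, pdL z J (totalDI I (X w)) = 0) (a : LocAlg n F) :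
    pdR z J (pro X a) = pro X (pdR z J a) := by
  obtain ⟨s, hs⟩ := exists_pdL_support a
  have hs' : ∀ q ∉ s, pdL q.1 q.2 (pdR z J a) = 0 := fun q hq => by
    rw [pdR_eq, pdL_tw, pdL_comm, hs q hq, map_zero, smul_zero, map_zero, smul_zero]
  rw [pro_eq_sum X a s hs, pro_eq_sum X _ s hs', pdR_eq, map_sum, map_sum]
  refine Finset.sum_congr rfl fun q _ => ?_
  rw [pdL_mul, h, zero_mul, zero_add, tw_mul, tw_tw, pdR_eq, pdL_tw, pdL_comm z q.1, map_smul]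

theorem eulerR_pro {X : Var Φ → LocAlg n F} {z : Var Φ}
    (h : ∀ J w I, pdL z J (totalDI I (X w)) = 0) (a : LocAlg n F) :
    eulerR z (pro X a) = pro X (eulerR z a) := by
  obtain ⟨s, hs⟩ := exists_pdL_support' z a
  have hR : ∀ b : LocAlg n F, (∀ I ∉ s, pdR z I b = 0) →
      eulerR z b = ∑ I ∈ s, adjDI I (pdR z I b) := fun b hb => by
    change ∑ᶠ I, adjDI I (pdR z I b) = _
    refine finsum_eq_finsetSum_of_support_subset _ fun I hI => ?_
    by_contra hc
    exact hI (by simp only [hb I hc, map_zero])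
  have h1 : ∀ I ∉ s, pdR z I a = 0 := fun I hI => by rw [pdR_eq, hs I hI, map_zero]
  rw [hR a h1, hR (pro X a) fun I hI => by rw [pdR_pro (h I), h1 I hI, map_zero], map_sum]
  refine Finset.sum_congr rfl fun I _ => ?_
  rw [pdR_pro (h I), comm_adjDI (pro_totalD X)]

theorem pro_of_bigraded_zero {X : Var Φ → LocAlg n F} (hX : ∀ A, X (Sum.inl A) = 0)
    {g : ℤ} {a : LocAlg n F} (ha : a ∈ bigraded g 0) : pro X a = 0 := by
  obtain ⟨s, hs⟩ := exists_pdL_support a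
  rw [pro_eq_sum X a s hs]
  refine Finset.sum_eq_zero fun q _ => ?_
  rcases q with ⟨A | A, I⟩
  · rw [hX, map_zero, zero_mul]
  · rw [bigraded_eq_zero_of_af (by simp only [FieldContent.vaf]; omega)
      (pdL_mem_bigraded ha (Sum.inr A) I), mul_zero]

/-- Euler's homogeneity relation, modulo total divergences. -/
theorem lf_weightOp (c : Var Φ → ℤ) {a : LocAlg n F} (ha : a ∈ locFin n F) :
    lf n F (weightOp c a) = lf n F (∑ z, (c z : ℝ) • (eulerR z a * jet z 0)) := by
  have h1 : weightOp c a = pro (fun z => (c z : ℝ) • jet z 0) a := by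
    obtain ⟨s, hs⟩ := exists_pdL_support a
    rw [weightOp_eq_vf, vf_eq_sum _ a s hs, pro_eq_sum _ a s hs]
    refine Finset.sum_congr rfl fun q _ => ?_
    rw [map_smul, totalDI_jet]
  rw [h1, lf_pro (fun z => Submodule.smul_mem _ _ (jet_mem_locFin z 0)) ha]
  congr 1
  refine Finset.sum_congr rfl fun z _ => ?_
  rw [smul_mul_assoc, mul_eq_tw_mul (jet_mem_parityPart z 0), eulerR_eq]

/-! ### The Koszul-Tate differential -/

/-- The characteristic of the Koszul-Tate differential. -/
def ktChar (S : Series n F) : Var Φ → LocAlg n F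
  | Sum.inl _ => 0
  | Sum.inr A => sgn (F.par A) • eulerL (Sum.inl A) (S (F.gh A))

/-- The Koszul-Tate differential as a linear map; being a derivation from the right, it is an
evolutionary derivation from the left precomposed with the parity automorphism. -/
def kt (S : Series n F) : LocAlg n F →ₗ[ℝ] LocAlg n F := pro (ktChar S) ∘ₗ parInv

theorem kt_apply (S : Series n F) (a : LocAlg n F) : kt S a = pro (ktChar S) (parInv a) := rfl

theorem kt_totalD (S : Series n F) (μ : Fin n) (a : LocAlg n F) :
    kt S (totalD μ a) = totalD μ (kt S a) := by
  rw [kt_apply, ← totalD_parInv, pro_totalD, kt_apply]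

namespace IsMasterAction

variable {S : Series n F} (hS : IsMasterAction S)
include hS

theorem comp_mem_bigraded (k : ℕ) : S k ∈ bigraded 0 k := mem_density.1 hS.ghost_zero k

theorem comp_mem_parityPart (k : ℕ) : S k ∈ parityPart 0 := mem_seriesParity.1 hS.even k

theorem eulerL_comp_mem_parityPart (A : Φ) :
    eulerL (Sum.inl A) (S (F.gh A)) ∈ parityPart (F.par A) := by
  have := eulerL_mem_parityPart (hS.comp_mem_parityPart (F.gh A)) (Sum.inl A)
  rwa [zero_add] at this

theorem eulerL_comp_mem_bigraded (A : Φ) :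
    eulerL (Sum.inl A) (S (F.gh A)) ∈ bigraded (-F.gh A) (F.gh A) := by
  have := eulerL_mem_bigraded (hS.comp_mem_bigraded (F.gh A)) (Sum.inl A)
  simpa only [FieldContent.vgh, FieldContent.vaf, zero_sub, sub_zero] using this

theorem ktChar_parity : HasCharParity 1 (ktChar S) := by
  rintro (A | A)
  · exact Submodule.zero_mem _
  · refine Submodule.smul_mem _ _ ?_
    have : (1 : ZMod 2) + F.vpar (Sum.inr A) = F.par A := by
      change (1 : ZMod 2) + (F.par A + 1) = F.par A
      rw [add_comm, add_assoc, CharTwo.add_self_eq_zero, add_zero]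
    rw [this]
    exact hS.eulerL_comp_mem_parityPart A

theorem ktChar_mem_bigraded (z : Var Φ) :
    ktChar S z ∈ bigraded (F.vgh z + 1) (F.vaf z + -1) := by
  rcases z with A | A
  · exact Submodule.zero_mem _
  · refine Submodule.smul_mem _ _ ?_
    convert hS.eulerL_comp_mem_bigraded A using 1
    simp only [FieldContent.vgh, FieldContent.vaf]
    congr 1 <;> ring

theorem koszulTate_eq (a : LocAlg n F) : koszulTate S a = kt S a := by
  obtain ⟨s, hs⟩ := exists_pdL_support_mi a
  have hs' : ∀ z, ∀ I ∉ s, pdL z I (parInv a) = 0 := fun z I hI => by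
    rw [pdL_parInv, hs z I hI, map_zero, smul_zero]
  rw [kt_apply, pro_eq_sum_mi _ _ s hs', Fintype.sum_sum_type, koszulTate, ← Finset.sum_neg_distrib]
  simp only [ktChar, map_zero, zero_mul, Finset.sum_const_zero, zero_add]
  refine Finset.sum_congr rfl fun A _ => ?_
  rw [finsum_eq_finsetSum_of_support_subset (s := s) _ fun I hI => by
    by_contra hc
    exact hI (by simp only [pdR_eq, hs _ I hc, map_zero, zero_mul]), ← Finset.sum_neg_distrib]
  refine Finset.sum_congr rfl fun I _ => ?_
  have hL := totalDI_mem_parityPart (hS.eulerL_comp_mem_parityPart A) I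
  have hv : F.vpar (Sum.inr A) = F.par A + 1 := rfl
  rw [pdL_parInv, map_smul, smul_mul_assoc, mul_smul_comm, smul_smul, mul_eq_tw_mul hL, pdR_eq, hv,
    tw_add, tw_one, sgn_add, ← mul_assoc, sgn_mul_self, sgn_one, one_mul, neg_one_smul]

theorem kt_mul (a b : LocAlg n F) : kt S (a * b) = kt S a * parInv b + a * kt S b := by
  rw [kt_apply, parInv_mul, pro_mul hS.ktChar_parity, tw_one, parInv_parInv]
  rfl

omit hS in
theorem kt_of_bigraded_zero {g : ℤ} {a : LocAlg n F} (ha : a ∈ bigraded g 0) : kt S a = 0 :=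
  pro_of_bigraded_zero (fun _ => rfl) (parInv_mem_bigraded ha)

omit hS in
theorem kt_jet_inl (A : Φ) (I : MI n) : kt S (jet (Sum.inl A) I) = 0 := by
  rw [kt_apply, mem_parityPart.1 (jet_mem_parityPart _ _), map_smul, pro_jet, ktChar, map_zero,
    smul_zero]

omit hS in
theorem kt_jet_inr (A : Φ) (I : MI n) :
    kt S (jet (Sum.inr A) I) = -totalDI I (eulerL (Sum.inl A) (S (F.gh A))) := by
  have hv : F.vpar (Sum.inr A) = F.par A + 1 := rfl
  rw [kt_apply, mem_parityPart.1 (jet_mem_parityPart _ _), map_smul, pro_jet, ktChar, map_smul,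
    smul_smul, hv, sgn_add, mul_right_comm, sgn_mul_self, sgn_one, one_mul, neg_one_smul]

theorem ktChar_mem_locFin (z : Var Φ) : ktChar S z ∈ locFin n F :=
  bigraded_le_locFin _ _ (hS.ktChar_mem_bigraded z)

/-- Up to total divergences, the Koszul-Tate differential only sees the Euler-Lagrange derivatives
with respect to the antifields. -/
theorem lf_kt {a : LocAlg n F} (ha : a ∈ locFin n F) : lf n F (kt S a) =
    lf n F (-∑ A, eulerR (Sum.inr A) a * eulerL (Sum.inl A) (S (F.gh A))) := by
  have ha' : parInv a ∈ locFin n F := by rw [← tw_one]; exact tw_mem_locFin 1 ha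
  rw [kt_apply, lf_pro hS.ktChar_mem_locFin ha', Fintype.sum_sum_type, ← Finset.sum_neg_distrib]
  simp only [ktChar, zero_mul, Finset.sum_const_zero, zero_add]
  congr 1
  refine Finset.sum_congr rfl fun A _ => ?_
  have hv : F.vpar (Sum.inr A) = F.par A + 1 := rfl
  rw [eulerL_parInv, smul_mul_assoc, mul_smul_comm, smul_smul,
    mul_eq_tw_mul (hS.eulerL_comp_mem_parityPart A), eulerR_eq, hv, tw_add, tw_one, sgn_add,
    ← mul_assoc, sgn_mul_self, sgn_one, one_mul, neg_one_smul]

omit hS in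
theorem kt_mem_locFinDiv (hS : IsMasterAction S) {a : LocAlg n F} (ha : a ∈ locFinDiv n F) :
    kt S a ∈ locFinDiv n F := by
  refine locFinDiv_map (kt_totalD S) (fun b hb => ?_) ha
  exact pro_mem_locFin hS.ktChar_mem_locFin (by rw [← tw_one]; exact tw_mem_locFin 1 hb)

/-- The lowest component of `s a`, if the components of `a` up to antifield number `m` are
trivial. -/
theorem lf_brst_apply {g : ℤ} {a : Series n F} (ha : a ∈ density n F g) {m : ℕ}
    (h : ∀ k ≤ m, a k ∈ locFinDiv n F) :
    lf n F (antibracket a S m) = lf n F (kt S (a (m + 1))) := by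
  rw [hS.lf_kt (bigraded_le_locFin _ _ (mem_density.1 ha (m + 1))), antibracket_apply,
    ← Finset.sum_neg_distrib]
  congr 1
  refine Finset.sum_congr rfl fun A _ => ?_
  rw [Finset.sum_eq_single (m + 1, F.gh A)]
  · have h0 : eulerL (Sum.inr A) (S (F.gh A)) = 0 :=
      bigraded_eq_zero_of_af (by simp only [FieldContent.vaf]; omega)
        (eulerL_mem_bigraded (hS.comp_mem_bigraded (F.gh A)) (Sum.inr A))
    rw [lp_apply, h0, mul_zero, zero_sub]
  · rintro ⟨k, l⟩ hkl hne
    rw [Finset.HasAntidiagonal.mem_antidiagonal] at hkl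
    dsimp only at hkl ⊢
    rw [lp_apply]
    by_cases hk : k ≤ m
    · rw [eulerR_of_mem_locFinDiv _ (h k hk), eulerR_of_mem_locFinDiv _ (h k hk), zero_mul,
        zero_mul, sub_zero]
    · have hl : l < F.gh A := by
        rcases Nat.lt_or_ge l (F.gh A) with h1 | h1
        · exact h1
        · exact absurd (Prod.ext (by dsimp only; omega) (by dsimp only; omega)) hne
      have h0 : eulerL (Sum.inr A) (S l) = 0 :=
        bigraded_eq_zero_of_af (by simp only [FieldContent.vaf]; omega)
          (eulerL_mem_bigraded (hS.comp_mem_bigraded l) (Sum.inr A))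
      have h1 : eulerL (Sum.inl A) (S l) = 0 :=
        bigraded_eq_zero_of_pgh (by simp only [FieldContent.vaf, FieldContent.vgh]; omega)
          (eulerL_mem_bigraded (hS.comp_mem_bigraded l) (Sum.inl A))
      rw [h0, h1, mul_zero, mul_zero, sub_zero]
  · intro h
    exact absurd (Finset.HasAntidiagonal.mem_antidiagonal.2 (by omega)) h

/-- Right Euler-Lagrange derivatives with respect to ghosts commute with the Koszul-Tate
differential up to sign, because the equations of motion that define it do not contain ghosts. -/
theorem eulerR_kt {C : Φ} (hC : 0 < F.gh C) (a : LocAlg n F) :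
    eulerR (Sum.inl C) (kt S a) = sgn (F.par C) • kt S (eulerR (Sum.inl C) a) := by
  have hv : F.vpar (Sum.inl C) = F.par C := rfl
  rw [kt_apply, eulerR_pro, eulerR_eq, eulerL_parInv, map_smul, map_smul, hv, kt_apply, eulerR_eq,
    hv, ← tw_one, tw_tw_comm, tw_one]
  intro J w I
  rcases w with A | A
  · rw [ktChar, map_zero, map_zero]
  · refine bigraded_eq_zero_of_pgh ?_
      (pdL_mem_bigraded (totalDI_mem_bigraded (hS.ktChar_mem_bigraded _) I) (Sum.inl C) J)
    simp only [FieldContent.vaf, FieldContent.vgh]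
    omega

/-- In positive pure ghost number, the Koszul-Tate differential of a proper solution is also acyclic
modulo total divergences. -/
theorem exists_kt_sub_mem (hP : IsProper S) {g : ℤ} {k : ℕ} (hk : 1 ≤ k) (hg : 1 ≤ g + k)
    {a : LocAlg n F} (ha : a ∈ bigraded g k) (hd : kt S a ∈ locFinDiv n F) :
    ∃ b ∈ bigraded (n := n) (F := F) (g - 1) (k + 1), a - kt S b ∈ locFinDiv n F := by
  have hex : ∀ C : Φ, ∃ b ∈ bigraded (n := n) (F := F) (g - F.gh C - 1) (k + 1), 0 < F.gh C →
      kt S b = eulerR (Sum.inl C) a := by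
    intro C
    by_cases hC : 0 < F.gh C
    · have h1 := hS.eulerR_kt hC a
      rw [eulerR_of_mem_locFinDiv _ hd] at h1
      have h2 : kt S (eulerR (Sum.inl C) a) = 0 := by
        have := congrArg (fun x => sgn (F.par C) • x) h1.symm
        simpa only [smul_smul, sgn_mul_self, one_smul, smul_zero] using this
      have h3 := eulerR_mem_bigraded ha (Sum.inl C)
      simp only [FieldContent.vaf, FieldContent.vgh, sub_zero] at h3
      obtain ⟨b, hb, hb'⟩ := hP _ k hk _ h3 (by rw [hS.koszulTate_eq, h2])
      exact ⟨b, hb, fun _ => by rw [← hS.koszulTate_eq, hb']⟩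
    · exact ⟨0, Submodule.zero_mem _, fun h => absurd h hC⟩
  choose b hb hb' using hex
  refine ⟨((g + k : ℤ) : ℝ)⁻¹ • ∑ C, ((F.gh C : ℝ) * sgn (F.par C)) • (b C * jet (Sum.inl C) 0),
    Submodule.smul_mem _ _ (Submodule.sum_mem _ fun C _ => Submodule.smul_mem _ _ ?_), ?_⟩
  · have := mul_mem_bigraded (hb C) (jet_mem_bigraded (Sum.inl C) 0)
    simp only [FieldContent.vaf, FieldContent.vgh] at this
    convert this using 1
    congr 1; ring
  · have h1 := lf_weightOp (pureGh F) (bigraded_le_locFin _ _ ha)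
    rw [weightOp_pureGh ha, map_smul, Fintype.sum_sum_type] at h1
    simp only [pureGh_inl, pureGh_inr, Int.cast_zero, zero_smul, Finset.sum_const_zero,
      add_zero] at h1
    have hne : ((g + k : ℤ) : ℝ) ≠ 0 := by
      have : g + k ≠ 0 := by omega
      exact_mod_cast this
    rw [← lf_eq, map_smul, map_smul, map_sum, eq_inv_smul_iff₀ hne, h1]
    congr 1
    refine Finset.sum_congr rfl fun C _ => ?_
    rcases Nat.eq_zero_or_pos (F.gh C) with hC | hC
    · simp only [hC, Nat.cast_zero, Int.cast_zero, zero_smul, zero_mul, map_zero]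
    · have hv : F.vpar (Sum.inl C) = F.par C := rfl
      rw [map_smul, hS.kt_mul, kt_jet_inl, mul_zero, add_zero, hb' C hC,
        mem_parityPart.1 (jet_mem_parityPart _ _), mul_smul_comm, smul_smul, mul_assoc, hv,
        sgn_mul_self, mul_one, Int.cast_natCast]

omit [Fintype Φ] hS in
theorem _root_.BV.lf_eq_zero {a : LocAlg n F} : lf n F a = 0 ↔ a ∈ locFinDiv n F :=
  Submodule.Quotient.mk_eq_zero _

/-- The step of the construction of a primitive by induction on the antifield number. -/
theorem exists_correction (hP : IsProper S) {g : ℤ} {M : ℕ} (hM : 0 ≤ g + M) {a : Series n F}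
    (ha : a ∈ density n F g) (hs : antibracket a S ∈ divergence n F (g + 1))
    (h : ∀ k ≤ M, a k ∈ locFinDiv n F) : ∃ b ∈ density n F (g - 1), (∀ k ≤ M + 1, b k = 0) ∧
      ∀ k ≤ M + 1, (a - antibracket b S) k ∈ locFinDiv n F := by
  classical
  have h1 := hS.lf_brst_apply ha h
  rw [lf_eq_zero.2 (locDiv_le_locFinDiv _ _ (mem_divergence.1 hs M)), eq_comm, lf_eq_zero] at h1
  obtain ⟨β, hβ, hβ'⟩ := hS.exists_kt_sub_mem hP (g := g) (k := M + 1) (by omega)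
    (by push_cast; omega) (mem_density.1 ha (M + 1)) h1
  have hb0 : ∀ k ≤ M + 1, (Pi.single (M + 2) β : Series n F) k = 0 := fun k hk =>
    Pi.single_eq_of_ne (by omega) _
  have hb : (Pi.single (M + 2) β : Series n F) ∈ density n F (g - 1) := mem_density.2 fun k => by
    by_cases hk : k = M + 2
    · subst hk
      rw [Pi.single_eq_same]
      convert hβ using 2
      push_cast
      ring
    · rw [Pi.single_eq_of_ne hk]
      exact Submodule.zero_mem _
  refine ⟨Pi.single (M + 2) β, hb, hb0, fun k hk => ?_⟩
  have h2 := hS.lf_brst_apply hb (m := k) fun j hj => by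
    rw [hb0 j (by omega)]
    exact Submodule.zero_mem _
  rw [Pi.sub_apply, ← lf_eq, h2]
  rcases Nat.lt_or_ge k (M + 1) with hk' | hk'
  · rw [hb0 _ (by omega), map_zero, map_zero, lf_eq_zero]
    exact h k (by omega)
  · obtain rfl : k = M + 1 := by omega
    rw [Pi.single_eq_same, lf_eq]
    exact hβ'

/-- A cocycle of the BRST differential whose components up to antifield number `M` are trivial is
the coboundary of a density whose components up to antifield number `M + 1` vanish. -/
theorem exists_primitive (hP : IsProper S) {g : ℤ} {M : ℕ} (hM : 0 ≤ g + M) {a : Series n F}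
    (ha : a ∈ density n F g) (hs : antibracket a S ∈ divergence n F (g + 1))
    (h : ∀ k ≤ M, a k ∈ locFinDiv n F) : ∃ b ∈ density n F (g - 1), (∀ k ≤ M + 1, b k = 0) ∧
      a - antibracket b S ∈ divergence n F g := by
  -- `P j B`: the density `B` is a primitive up to antifield number `M + j`
  let P : ℕ → Series n F → Prop := fun j B => B ∈ density n F (g - 1) ∧ (∀ k ≤ M + 1, B k = 0) ∧
    ∀ k ≤ M + j, (a - antibracket B S) k ∈ locFinDiv n F
  have hstep : ∀ j B, P j B → ∃ B', P (j + 1) B' ∧ ∀ k ≤ M + j + 1, B' k = B k := by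
    rintro j B ⟨hB, hB0, hB'⟩
    have hsB := hS.brst_mem_density (sub_add_cancel g 1) hB
    obtain ⟨b, hb, hb0, hb'⟩ := hS.exists_correction hP (M := M + j) (by push_cast; omega)
      (Submodule.sub_mem _ ha hsB) (by
        rw [map_sub, LinearMap.sub_apply]
        exact Submodule.sub_mem _ hs (hS.brst_brst (by ring) hB)) hB'
    refine ⟨B + b, ⟨Submodule.add_mem _ hB hb, fun k hk => ?_, fun k hk => ?_⟩, fun k hk => ?_⟩
    · rw [Pi.add_apply, hB0 k hk, hb0 k (by omega), add_zero]
    · rw [map_add, LinearMap.add_apply, ← sub_sub]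
      exact hb' k (by omega)
    · rw [Pi.add_apply, hb0 k hk, add_zero]
  have h0 : P 0 0 := ⟨Submodule.zero_mem _, fun _ _ => rfl, fun k hk => by
    rw [map_zero, LinearMap.zero_apply, sub_zero]
    exact h k hk⟩
  choose! f hf hf' using hstep
  let B : ℕ → Series n F := fun j => Nat.rec 0 f j
  have hB : ∀ j, P j (B j) := fun j => by
    induction j with
    | zero => exact h0
    | succ j ih => exact hf j _ ih
  have hstab : ∀ i j k, k ≤ M + j + 1 → B (j + i) k = B j k := by
    intro i j k hk
    induction i with
    | zero => rfl
    | succ i ih => exact (hf' (j + i) _ (hB (j + i)) k (by omega)).trans ih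
  have hlim : ∀ j k, k ≤ M + j + 1 → B k k = B j k := fun j k hk => by
    rw [← hstab j k k (by omega), ← hstab k j k hk, add_comm]
  have hden : (fun k => B k k : Series n F) ∈ density n F (g - 1) :=
    mem_density.2 fun k => mem_density.1 (hB k).1 k
  refine ⟨fun k => B k k, hden, fun k hk => ?_, mem_divergence.2 fun k => ?_⟩
  · exact (hlim 0 k (by omega)).trans ((hB 0).2.1 k hk)
  · have hd := Submodule.sub_mem _ ha (hS.brst_mem_density (sub_add_cancel g 1) hden)
    refine mem_locDiv_of_mem_locFinDiv (mem_density.1 hd k) ?_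
    have h1 := hS.lf_brst_apply (Submodule.sub_mem _ hden (hB k).1) (m := k) fun j hj => by
      rw [Pi.sub_apply, sub_eq_zero.2 (hlim k j (by omega))]
      exact Submodule.zero_mem _
    have h2 : ((fun k => B k k : Series n F) - B k) (k + 1) = 0 :=
      sub_eq_zero.2 (hlim k (k + 1) (by omega))
    rw [h2, map_zero, map_zero, lf_eq_zero, map_sub, LinearMap.sub_apply] at h1
    have h3 := Submodule.sub_mem _ ((hB k).2.2 k (by omega)) h1
    simp only [Pi.sub_apply] at h3 ⊢
    convert h3 using 1
    abel

end IsMasterAction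

end

section

variable {Φ : Type u} {n : ℕ} {F : FieldContent Φ} [Fintype Φ]

/-! ### Characteristics and local functionals of antifield number one -/

theorem evo_eq_pro (X : Φ → LocAlg n F) (a : LocAlg n F) :
    evo X a = pro (Sum.elim X 0) a := by
  obtain ⟨s, hs⟩ := exists_pdL_support_mi a
  rw [pro_eq_sum_mi _ _ s hs, Fintype.sum_sum_type]
  simp only [Sum.elim_inl, Sum.elim_inr, Pi.zero_apply, map_zero, zero_mul, Finset.sum_const_zero,
    add_zero]
  refine Finset.sum_congr rfl fun A _ => ?_
  refine finsum_eq_finsetSum_of_support_subset _ fun I hI => ?_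
  by_contra hc
  exact hI (by simp only [hs _ I hc, mul_zero])

omit [Fintype Φ] in
theorem mem_characteristics {g : ℕ} {X : Φ → LocAlg n F} : X ∈ characteristics n F g ↔
    ∀ A, (F.gh A = g → X A ∈ bigraded 0 0) ∧ (F.gh A ≠ g → X A = 0) := by
  simp only [characteristics, Submodule.mem_pi, Set.mem_univ, true_implies]
  refine forall_congr' fun A => ?_
  by_cases h : F.gh A = g <;> simp [h]

omit [Fintype Φ] in
theorem characteristics_mem_bigraded {g : ℕ} {X : Φ → LocAlg n F} (hX : X ∈ characteristics n F g)
    (A : Φ) : X A ∈ bigraded 0 0 := by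
  by_cases h : F.gh A = g
  · exact (mem_characteristics.1 hX A).1 h
  · rw [(mem_characteristics.1 hX A).2 h]
    exact Submodule.zero_mem _

omit [Fintype Φ] in
theorem elim_mem_locFin {X : Φ → LocAlg n F} (hX : ∀ A, X A ∈ bigraded 0 0) (z : Var Φ) :
    (Sum.elim X 0 : Var Φ → LocAlg n F) z ∈ locFin n F := by
  rcases z with A | A
  · exact bigraded_le_locFin _ _ (hX A)
  · exact Submodule.zero_mem _

theorem lf_evo {X : Φ → LocAlg n F} (hX : ∀ A, X A ∈ bigraded 0 0) {a : LocAlg n F}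
    (ha : a ∈ locFin n F) :
    lf n F (evo X a) = lf n F (∑ A, X A * eulerL (Sum.inl A) a) := by
  rw [evo_eq_pro, lf_pro (elim_mem_locFin hX) ha, Fintype.sum_sum_type]
  simp only [Sum.elim_inl, Sum.elim_inr, Pi.zero_apply, zero_mul, Finset.sum_const_zero, add_zero]

/-- Evolutionary vector fields of antifield number zero commute with the Euler-Lagrange derivatives
with respect to the antifields. -/
theorem eulerR_evo {X : Φ → LocAlg n F} (hX : ∀ A, X A ∈ bigraded 0 0) (i : Φ) (a : LocAlg n F) :
    eulerR (Sum.inr i) (evo X a) = evo X (eulerR (Sum.inr i) a) := by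
  rw [evo_eq_pro, evo_eq_pro, eulerR_pro]
  rintro J (A | A) I
  · exact bigraded_eq_zero_of_af (by simp only [FieldContent.vaf]; omega)
      (pdL_mem_bigraded (totalDI_mem_bigraded (hX A) I) (Sum.inr i) J)
  · rw [Sum.elim_inr, Pi.zero_apply, map_zero, map_zero]

/-- `charOf` as a linear map. -/
def charMap : LocAlg n F →ₗ[ℝ] (Φ → LocAlg n F) where
  toFun := charOf
  map_add' a b := by
    funext A
    simp only [charOf, Pi.add_apply, map_add]
    split_ifs
    · abel
    · rw [add_zero]
  map_smul' r a := by
    funext A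
    simp only [charOf, Pi.smul_apply, map_smul, RingHom.id_apply]
    split_ifs
    · rw [smul_neg]
    · rw [smul_zero]

omit [Fintype Φ] in
theorem charMap_apply (a : LocAlg n F) : charMap a = charOf a := rfl

omit [Fintype Φ] in
theorem charMap_of_mem_locFinDiv {a : LocAlg n F} (ha : a ∈ locFinDiv n F) : charMap a = 0 := by
  funext A
  rw [charMap_apply, charOf, eulerR_of_mem_locFinDiv _ ha, neg_zero, ite_self, Pi.zero_apply]

omit [Fintype Φ] in
theorem charMap_congr {a b : LocAlg n F} (h : lf n F a = lf n F b) :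
    (charMap a : Φ → LocAlg n F) = charMap b := by
  rw [← sub_eq_zero, ← map_sub]
  exact charMap_of_mem_locFinDiv (lf_eq.1 h)

omit [Fintype Φ] in
theorem charOf_eq {a : LocAlg n F} (ha : a ∈ bigraded (-1) 1) (A : Φ) :
    charOf a A = -eulerR (Sum.inr A) a := by
  by_cases h : F.gh A = 0
  · rw [charOf, if_pos h]
  · rw [charOf, if_neg h, bigraded_eq_zero_of_af (by simp only [FieldContent.vaf]; omega)
      (eulerR_mem_bigraded ha (Sum.inr A)), neg_zero]

omit [Fintype Φ] in
theorem charOf_mem_characteristics {a : LocAlg n F} (ha : a ∈ bigraded (-1) 1) :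
    charOf a ∈ characteristics n F 0 := by
  refine mem_characteristics.2 fun A => ⟨fun h => ?_, fun h => if_neg h⟩
  rw [charOf_eq ha]
  have := eulerR_mem_bigraded ha (Sum.inr A)
  simp only [FieldContent.vaf, FieldContent.vgh, h, Nat.cast_zero] at this
  exact Submodule.neg_mem _ this

/-- The local functional `∫ X^i φ*_i` associated with a characteristic, up to sign. -/
def antifieldTerm (X : Φ → LocAlg n F) : LocAlg n F := -∑ A, X A * jet (Sum.inr A) 0

theorem antifieldTerm_mem_bigraded {X : Φ → LocAlg n F} (hX : X ∈ characteristics n F 0) :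
    antifieldTerm X ∈ bigraded (-1) 1 := by
  refine Submodule.neg_mem _ (Submodule.sum_mem _ fun A _ => ?_)
  by_cases h : F.gh A = 0
  · have := mul_mem_bigraded (characteristics_mem_bigraded hX A) (jet_mem_bigraded (Sum.inr A) 0)
    simpa only [FieldContent.vaf, FieldContent.vgh, h, Nat.cast_zero, neg_zero, zero_sub, zero_add]
      using this
  · rw [(mem_characteristics.1 hX A).2 h, zero_mul]
    exact Submodule.zero_mem _

theorem antifieldTerm_mem_parityPart {p : ZMod 2} {X : Φ → LocAlg n F} (hX : X ∈ charParity p) :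
    antifieldTerm X ∈ parityPart (p + 1) := by
  refine Submodule.neg_mem _ (Submodule.sum_mem _ fun A _ => ?_)
  have h1 : X A ∈ parityPart (p + F.par A) := hX A (Set.mem_univ A)
  have h2 := mul_mem_parityPart h1 (jet_mem_parityPart (Sum.inr A) 0)
  have h3 : p + F.par A + F.vpar (Sum.inr A) = p + 1 := by
    change p + F.par A + (F.par A + 1) = p + 1
    rw [add_assoc, ← add_assoc (F.par A), CharTwo.add_self_eq_zero, zero_add]
  rwa [h3] at h2

omit [Fintype Φ] in
theorem eulerR_mul_jet {b : LocAlg n F} (hb : b ∈ bigraded 0 0) (i j : Φ) [Decidable (j = i)] :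
    eulerR (Sum.inr i) (b * jet (Sum.inr j) 0) = if j = i then b else 0 := by
  classical
  have h : ∀ I, pdL (Sum.inr i) I (b * jet (Sum.inr j) 0) =
      if j = i ∧ I = 0 then tw (F.vpar (Sum.inr i)) b else 0 := by
    intro I
    rw [pdL_mul, bigraded_eq_zero_of_af (by simp only [FieldContent.vaf]; omega)
      (pdL_mem_bigraded hb (Sum.inr i) I), zero_mul, zero_add, pdL_jet]
    simp only [Sum.inr.injEq, eq_comm (a := (0 : MI n)), mul_ite, mul_one, mul_zero]
  rw [eulerR_eq, eulerL_eq_sum _ _ {0} fun I hI => by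
    rw [h, if_neg (fun hc => hI (Finset.mem_singleton.2 hc.2))], Finset.sum_singleton, h,
    adjDI_zero]
  by_cases hji : j = i
  · rw [if_pos ⟨hji, rfl⟩, if_pos hji, tw_tw]
  · rw [if_neg (fun hc => hji hc.1), if_neg hji, map_zero]

omit [Fintype Φ] in
open Classical in
theorem charMap_mul_jet {b : LocAlg n F} (hb : b ∈ bigraded 0 0) {j : Φ} (hj : F.gh j = 0) :
    charMap (b * jet (Sum.inr j) 0) = -(Pi.single j b : Φ → LocAlg n F) := by
  funext i
  rw [charMap_apply, charOf, eulerR_mul_jet hb, Pi.neg_apply, Pi.single_apply]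
  by_cases h : i = j
  · subst h
    rw [if_pos hj, if_pos rfl]
  · rw [if_neg (Ne.symm h), if_neg h, neg_zero, ite_self]

theorem charOf_antifieldTerm {X : Φ → LocAlg n F} (hX : X ∈ characteristics n F 0) :
    charOf (antifieldTerm X) = X := by
  classical
  funext i
  rw [charOf_eq (antifieldTerm_mem_bigraded hX), antifieldTerm, map_neg, neg_neg, map_sum]
  simp only [eulerR_mul_jet (characteristics_mem_bigraded hX _)]
  rw [Finset.sum_ite_eq' Finset.univ i, if_pos (Finset.mem_univ i)]

/-- A local functional of ghost number `-1` and antifield number one is determined by its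
characteristic. -/
theorem lf_antifieldTerm {a : LocAlg n F} (ha : a ∈ bigraded (-1) 1) :
    lf n F a = lf n F (antifieldTerm (charOf a)) := by
  have h1 := lf_weightOp F.vaf (bigraded_le_locFin _ _ ha)
  rw [(mem_bigraded.1 ha).2, Int.cast_one, one_smul, Fintype.sum_sum_type] at h1
  rw [h1, antifieldTerm, ← Finset.sum_neg_distrib]
  simp only [FieldContent.vaf, Int.cast_zero, zero_smul, Finset.sum_const_zero, zero_add]
  congr 1
  refine Finset.sum_congr rfl fun A _ => ?_
  rw [charOf_eq ha, neg_mul, neg_neg]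
  by_cases h : F.gh A = 0
  · rw [h, Nat.cast_zero, zero_add, Int.cast_one, one_smul]
  · rw [bigraded_eq_zero_of_af (by simp only [FieldContent.vaf]; omega)
      (eulerR_mem_bigraded ha (Sum.inr A)), zero_mul, smul_zero]

omit [Fintype Φ] in
theorem charOf_mem_charParity {p : ZMod 2} {a : LocAlg n F} (ha : a ∈ parityPart (p + 1)) :
    charOf a ∈ charParity p := by
  intro A _
  change charOf a A ∈ parityPart (p + F.par A)
  rw [charOf]
  split_ifs
  · rw [eulerR_eq, tw_of_mem (eulerL_mem_parityPart ha _)]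
    refine Submodule.neg_mem _ (Submodule.smul_mem _ _ ?_)
    have h1 := eulerL_mem_parityPart ha (Sum.inr A)
    have h2 : p + 1 + F.vpar (Sum.inr A) = p + F.par A := by
      change p + 1 + (F.par A + 1) = p + F.par A
      exact zmod_two_add_add _ _ _
    rwa [h2] at h1
  · exact Submodule.zero_mem _

/-! ### The bracket of characteristics -/

theorem lp_eq_zero_of_le {A : Φ} {k l : ℕ} {u v : LocAlg n F}
    (hu : u ∈ bigraded (-1) k) (hv : v ∈ bigraded (-1) l) (h : k ≤ F.gh A ∨ l ≤ F.gh A) :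
    lp A u v = 0 := by
  rw [lp_apply]
  rcases h with h | h
  · rw [eulerR_eq, eulerR_eq, bigraded_eq_zero_of_pgh
      (by simp only [FieldContent.vaf, FieldContent.vgh]; omega)
      (eulerL_mem_bigraded hu (Sum.inl A)),
      bigraded_eq_zero_of_af (by simp only [FieldContent.vaf]; omega)
      (eulerL_mem_bigraded hu (Sum.inr A)), map_zero, map_zero, zero_mul, zero_mul, sub_zero]
  · rw [bigraded_eq_zero_of_pgh
      (by simp only [FieldContent.vaf, FieldContent.vgh]; omega)
      (eulerL_mem_bigraded hv (Sum.inl A)),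
      bigraded_eq_zero_of_af (by simp only [FieldContent.vaf]; omega)
      (eulerL_mem_bigraded hv (Sum.inr A)), mul_zero, mul_zero, sub_zero]

/-- The antibracket of two local functionals of ghost number `-1` corresponds to the commutator of
their characteristics. -/
theorem charOf_antibracket {p q : ZMod 2} {a b : Series n F} (ha : a ∈ density n F (-1))
    (hb : b ∈ density n F (-1)) (ha' : a ∈ seriesParity n F (p + 1))
    (hb' : b ∈ seriesParity n F (q + 1)) :
    charOf (antibracket a b 1) = charComm p q (charOf (a 1)) (charOf (b 1)) := by
  have ha1 : a 1 ∈ bigraded (-1) 1 := mem_density.1 ha 1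
  have hb1 : b 1 ∈ bigraded (-1) 1 := mem_density.1 hb 1
  -- only the components of antifield number one contribute
  have h1 : antibracket a b 1 = ∑ A, lp A (a 1) (b 1) := by
    rw [antibracket_apply]
    refine Finset.sum_congr rfl fun A _ => ?_
    rcases Nat.eq_zero_or_pos (F.gh A) with hA | hA
    · rw [Finset.sum_eq_single (1, 1)]
      · rintro ⟨k, l⟩ hkl hne
        rw [Finset.HasAntidiagonal.mem_antidiagonal] at hkl
        refine lp_eq_zero_of_le (mem_density.1 ha k) (mem_density.1 hb l) ?_
        dsimp only at hkl
        by_contra hc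
        exact hne (Prod.ext (by dsimp only; omega) (by dsimp only; omega))
      · intro h
        exact absurd (Finset.HasAntidiagonal.mem_antidiagonal.2 (by dsimp only; omega)) h
    · rw [lp_eq_zero_of_le (mem_density.1 ha 1) (mem_density.1 hb 1) (Or.inl hA)]
      refine Finset.sum_eq_zero ?_
      rintro ⟨k, l⟩ hkl
      rw [Finset.HasAntidiagonal.mem_antidiagonal] at hkl
      refine lp_eq_zero_of_le (mem_density.1 ha k) (mem_density.1 hb l) ?_
      dsimp only at hkl
      omega
  -- the two terms of the antibracket are the two terms of the commutator
  have h2 : ∀ A, lp A (a 1) (b 1) = charOf (a 1) A * eulerL (Sum.inl A) (b 1) -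
      sgn (p * q) • (charOf (b 1) A * eulerL (Sum.inl A) (a 1)) := by
    intro A
    have hl : F.vpar (Sum.inl A) = F.par A := rfl
    have hr : F.vpar (Sum.inr A) = F.par A + 1 := rfl
    have e1 := eulerL_mem_parityPart (mem_seriesParity.1 ha' 1) (Sum.inl A)
    have e2 := eulerL_mem_parityPart (mem_seriesParity.1 hb' 1) (Sum.inr A)
    rw [lp_apply, charOf_eq ha1, charOf_eq hb1, eulerR_eq (Sum.inl A), eulerR_eq (Sum.inr A) (b 1),
      tw_of_mem e1, tw_of_mem e2, smul_mul_assoc, mul_comm_of_mem e1 e2, neg_mul, neg_mul,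
      smul_mul_assoc, smul_neg, sub_neg_eq_add, smul_smul, smul_smul, ← sgn_add, ← sgn_add, hl, hr,
      sub_eq_neg_add]
    have aux : ∀ p q A : ZMod 2, A * (p + 1 + A) + (p + 1 + A) * (q + 1 + (A + 1)) =
        p * q + (A + 1) * (q + 1 + (A + 1)) := by decide
    rw [aux]
  have hX := characteristics_mem_bigraded (charOf_mem_characteristics ha1)
  have hY := characteristics_mem_bigraded (charOf_mem_characteristics hb1)
  have h3 : lf n F (antibracket a b 1) =
      lf n F (evo (charOf (a 1)) (b 1) - sgn (p * q) • evo (charOf (b 1)) (a 1)) := by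
    rw [h1, map_sub, map_smul, lf_evo hX (bigraded_le_locFin _ _ hb1),
      lf_evo hY (bigraded_le_locFin _ _ ha1), ← map_smul, ← map_sub, Finset.smul_sum,
      ← Finset.sum_sub_distrib]
    congr 1
    exact Finset.sum_congr rfl fun A _ => h2 A
  rw [← charMap_apply, charMap_congr h3]
  funext i
  rw [charMap_apply, charComm, ksgn_eq]
  by_cases hi : F.gh i = 0
  · rw [charOf, if_pos hi, map_sub, map_smul, eulerR_evo hX, eulerR_evo hY, charOf_eq ha1,
      charOf_eq hb1, map_neg, map_neg, smul_neg, neg_sub, sub_neg_eq_add, neg_add_eq_sub]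
  · simp only [charOf, if_neg hi, map_zero, smul_zero, sub_zero]

/-! ### Koszul-Tate boundaries and trivial symmetries -/

namespace IsMasterAction

variable {S : Series n F} (hS : IsMasterAction S)
include hS

/-- The invariance of the Lagrangian is the lowest component of the cocycle condition. -/
theorem lf_evo_charOf {a : LocAlg n F} (ha : a ∈ bigraded (-1) 1) :
    lf n F (evo (charOf a) (S 0)) = lf n F (kt S a) := by
  rw [lf_evo (characteristics_mem_bigraded (charOf_mem_characteristics ha))
    (bigraded_le_locFin _ _ (hS.comp_mem_bigraded 0)), hS.lf_kt (bigraded_le_locFin _ _ ha),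
    ← Finset.sum_neg_distrib]
  congr 1
  refine Finset.sum_congr rfl fun A _ => ?_
  rw [charOf_eq ha, neg_mul]
  by_cases h : F.gh A = 0
  · rw [h]
  · rw [bigraded_eq_zero_of_af (by simp only [FieldContent.vaf]; omega)
      (eulerR_mem_bigraded ha (Sum.inr A)), zero_mul, zero_mul]

/-- Koszul-Tate boundaries linear in the antifields of the ghosts generate gauge symmetries. -/
theorem charMap_kt_gauge {f : Φ → LocAlg n F} (hf : f ∈ characteristics n F 1) :
    charMap (kt S (∑ A, f A * jet (Sum.inr A) 0)) = -gaugeSym S f := by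
  have hf' := characteristics_mem_bigraded hf
  have h1 : kt S (∑ A, f A * jet (Sum.inr A) 0) = -∑ A, f A * eulerL (Sum.inl A) (S 1) := by
    rw [map_sum, ← Finset.sum_neg_distrib]
    refine Finset.sum_congr rfl fun A _ => ?_
    rw [hS.kt_mul, kt_of_bigraded_zero (hf' A), zero_mul, zero_add, kt_jet_inr, totalDI_zero]
    by_cases h : F.gh A = 1
    · rw [h, mul_neg]
    · rw [(mem_characteristics.1 hf A).2 h, zero_mul, zero_mul, neg_zero]
  have h2 : lf n F (kt S (∑ A, f A * jet (Sum.inr A) 0)) = lf n F (-evo f (S 1)) := by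
    rw [h1, map_neg, map_neg, lf_evo hf' (bigraded_le_locFin _ _ (hS.comp_mem_bigraded 1))]
  rw [charMap_congr h2]
  funext i
  rw [charMap_apply, Pi.neg_apply, gaugeSym, charOf, charOf]
  split_ifs
  · rw [map_neg, map_neg, eulerR_evo hf']
  · rw [map_zero, neg_zero]

theorem kt_mul_jet_mul_jet {i j : Φ} (hi : F.gh i = 0) (hj : F.gh j = 0) (J : MI n)
    {b : LocAlg n F} (hb : b ∈ bigraded 0 0) :
    kt S (b * (jet (Sum.inr i) 0 * jet (Sum.inr j) J)) =
      sgn (F.par j) • (b * eulerL (Sum.inl i) (S 0) * totalDI J (jet (Sum.inr j) 0)) -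
        sgn (F.par i * F.par j + F.par j) •
          (b * totalDI J (eulerL (Sum.inl j) (S 0)) * jet (Sum.inr i) 0) := by
  have hvi : F.vpar (Sum.inr i) = F.par i + 1 := rfl
  have hvj : F.vpar (Sum.inr j) = F.par j + 1 := rfl
  have hLp := totalDI_mem_parityPart (hS.eulerL_comp_mem_parityPart j) J
  rw [hj] at hLp
  have h1 : jet (Sum.inr i) 0 * totalDI J (eulerL (Sum.inl j) (S 0)) =
      sgn (F.par i * F.par j + F.par j) •
        (totalDI J (eulerL (Sum.inl j) (S 0)) * jet (Sum.inr i) 0) := by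
    rw [mul_comm_of_mem (jet_mem_parityPart (Sum.inr i) 0) hLp, hvi, add_mul, one_mul]
  have h2 : kt S (jet (Sum.inr i) 0 * jet (Sum.inr j) J) =
      sgn (F.par j) • (eulerL (Sum.inl i) (S 0) * totalDI J (jet (Sum.inr j) 0)) -
        sgn (F.par i * F.par j + F.par j) •
          (totalDI J (eulerL (Sum.inl j) (S 0)) * jet (Sum.inr i) 0) := by
    rw [hS.kt_mul, kt_jet_inr, kt_jet_inr, hi, hj, totalDI_zero, totalDI_jet,
      mem_parityPart.1 (jet_mem_parityPart (Sum.inr j) J), hvj, sgn_add, sgn_one, mul_neg_one,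
      neg_smul, mul_neg, neg_mul, neg_neg, mul_neg, h1, mul_smul_comm, ← sub_eq_add_neg]
  rw [hS.kt_mul, kt_of_bigraded_zero hb, zero_mul, zero_add, h2, mul_sub, mul_smul_comm,
    mul_smul_comm, ← mul_assoc, ← mul_assoc]

theorem eulerL_lagrangian_mem {i : Φ} (hi : F.gh i = 0) :
    eulerL (Sum.inl i) (S 0) ∈ bigraded 0 0 := by
  have := hS.eulerL_comp_mem_bigraded i
  rwa [hi, Nat.cast_zero, neg_zero] at this

/-- Koszul-Tate boundaries quadratic in the antifields of the original fields generate on-shell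
vanishing symmetries, one antifield yielding the equation of motion, the other the component of the
characteristic. -/
theorem charMap_kt_onShell {i j : Φ} (hi : F.gh i = 0) (hj : F.gh j = 0) (J : MI n)
    {b : LocAlg n F} (hb : b ∈ bigraded 0 0) :
    charMap (kt S (b * (jet (Sum.inr i) 0 * jet (Sum.inr j) J))) =
      sgn (F.par i * F.par j + F.par j) • onShellTrivial S i j J b := by
  have hbL : b * totalDI J (eulerL (Sum.inl j) (S 0)) ∈ bigraded 0 0 := by
    have := mul_mem_bigraded hb (totalDI_mem_bigraded (hS.eulerL_lagrangian_mem hj) J)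
    rwa [add_zero] at this
  have hbLi : b * eulerL (Sum.inl i) (S 0) ∈ bigraded 0 0 := by
    have := mul_mem_bigraded hb (hS.eulerL_lagrangian_mem hi)
    rwa [add_zero] at this
  have h2 : lf n F (b * eulerL (Sum.inl i) (S 0) * totalDI J (jet (Sum.inr j) 0)) =
      lf n F (adjDI J (b * eulerL (Sum.inl i) (S 0)) * jet (Sum.inr j) 0) :=
    lf_eq.2 (mul_totalDI_sub_mem J (bigraded_le_locFin _ _ hbLi) (jet_mem_locFin _ _))
  have h3 := charMap_congr h2
  rw [charMap_mul_jet (adjDI_mem_bigraded hbLi J) hj] at h3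
  rw [hS.kt_mul_jet_mul_jet hi hj J hb, map_sub, map_smul, map_smul, h3, charMap_mul_jet hbL hi,
    onShellTrivial, ksgn_eq, smul_sub, smul_smul, sgn_add, mul_right_comm, sgn_mul_self, one_mul,
    smul_neg, smul_neg, sub_neg_eq_add, neg_add_eq_sub]

end IsMasterAction

end

section

variable {Φ : Type u} {n : ℕ} {F : FieldContent Φ} [Fintype Φ] {S : Series n F}

/-! ### Characteristics of Koszul-Tate boundaries -/

namespace IsMasterAction

variable (hS : IsMasterAction S)
include hS

theorem charMap_kt_congr {a b : LocAlg n F} (h : lf n F a = lf n F b) :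
    (charMap (kt S a) : Φ → LocAlg n F) = charMap (kt S b) := by
  refine charMap_congr (lf_eq.2 ?_)
  rw [← map_sub]
  exact kt_mem_locFinDiv hS (lf_eq.1 h)

/-- The Koszul-Tate boundaries quadratic in the antifields of the original fields generate on-shell
vanishing symmetries. -/
theorem charMap_kt_mul_jet_mem {v : LocAlg n F} (hv : v ∈ bigraded (-1) 1) {i : Φ}
    (hi : F.gh i = 0) : charMap (kt S (v * jet (Sum.inr i) 0)) ∈ trivialSym S := by
  obtain ⟨s, hs⟩ := exists_pdL_support v
  have h1 : v = ∑ q ∈ s, ((F.vaf q.1 : ℝ) • jet q.1 q.2) * pdL q.1 q.2 v := by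
    have := (mem_bigraded.1 hv).2
    rwa [Int.cast_one, one_smul, weightOp_eq_vf, vf_eq_sum _ v s hs, eq_comm] at this
  rw [h1, Finset.sum_mul, map_sum, map_sum]
  refine Submodule.sum_mem _ ?_
  rintro ⟨j | j, J⟩ _
  · simp only [FieldContent.vaf, Int.cast_zero, zero_smul, zero_mul, map_zero]
    exact Submodule.zero_mem _
  · dsimp only
    have hc := pdL_mem_bigraded hv (Sum.inr j) J
    by_cases hj : F.gh j = 0
    · simp only [FieldContent.vaf, FieldContent.vgh, hj, Nat.cast_zero, neg_zero, zero_sub,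
        zero_add,
        sub_self] at hc
      have hc' := tw_mem_bigraded (F.vpar (Sum.inr j)) hc
      rw [smul_mul_assoc, smul_mul_assoc, mul_eq_tw_mul (jet_mem_parityPart (Sum.inr j) J),
        mul_assoc,
        mul_comm_of_mem (jet_mem_parityPart (Sum.inr j) J) (jet_mem_parityPart (Sum.inr i) 0),
        mul_smul_comm, map_smul, map_smul, map_smul, map_smul, hS.charMap_kt_onShell hi hj J hc']
      exact Submodule.smul_mem _ _ (Submodule.smul_mem _ _ (Submodule.smul_mem _ _
        (Submodule.subset_span (Or.inr ⟨i, j, J, _, hc', hi, hj, rfl⟩))))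
    · rw [bigraded_eq_zero_of_af (by simp only [FieldContent.vaf]; omega) hc, mul_zero, zero_mul,
        map_zero, map_zero]
      exact Submodule.zero_mem _

/-- Koszul-Tate boundaries generate trivial symmetries. -/
theorem charMap_kt_mem_trivialSym {b : LocAlg n F} (hb : b ∈ bigraded (-2) 2) :
    charMap (kt S b) ∈ trivialSym S := by
  classical
  have hE : ∀ A, eulerR (Sum.inr A) b ∈ bigraded (-2 - (-(F.gh A : ℤ) - 1)) (2 - (F.gh A + 1)) :=
    fun A => eulerR_mem_bigraded hb (Sum.inr A)
  have h1 := lf_weightOp F.vaf (bigraded_le_locFin _ _ hb)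
  rw [(mem_bigraded.1 hb).2, Fintype.sum_sum_type] at h1
  simp only [FieldContent.vaf, Int.cast_zero, zero_smul, Finset.sum_const_zero, zero_add] at h1
  -- antifields of ghosts contribute gauge symmetries, those of the original fields on-shell
  -- vanishing ones
  set f : Φ → LocAlg n F := fun A => if F.gh A = 1 then (2 : ℝ) • eulerR (Sum.inr A) b else 0
    with hf
  have hf' : f ∈ characteristics n F 1 := by
    refine mem_characteristics.2 fun A => ⟨fun h => ?_, fun h => if_neg h⟩
    have := hE A
    simp only [h, Nat.cast_one] at this
    rw [hf]
    dsimp only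
    rw [if_pos h]
    exact Submodule.smul_mem _ _ this
  have h2 : ∑ A, ((F.gh A + 1 : ℤ) : ℝ) • (eulerR (Sum.inr A) b * jet (Sum.inr A) 0) =
      ∑ A, f A * jet (Sum.inr A) 0 +
        ∑ A, if F.gh A = 0 then eulerR (Sum.inr A) b * jet (Sum.inr A) 0 else 0 := by
    rw [← Finset.sum_add_distrib]
    refine Finset.sum_congr rfl fun A _ => ?_
    rw [hf]
    dsimp only
    rcases Nat.lt_or_ge 1 (F.gh A) with h | h
    · rw [if_neg (by omega), if_neg (by omega), bigraded_eq_zero_of_af (by omega) (hE A), zero_mul,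
        smul_zero, add_zero]
    · rcases Nat.le_one_iff_eq_zero_or_eq_one.1 h with h | h
      · rw [if_neg (by omega), if_pos h, h, zero_mul, zero_add, Nat.cast_zero, zero_add,
          Int.cast_one, one_smul]
      · rw [if_pos h, if_neg (by omega), h, add_zero, smul_mul_assoc]
        norm_num
  rw [h2] at h1
  have h3 := hS.charMap_kt_congr h1
  have h4 : charMap (kt S (((2 : ℤ) : ℝ) • b)) ∈ trivialSym S := by
    rw [h3, map_add, map_add, hS.charMap_kt_gauge hf', map_sum, map_sum]
    refine Submodule.add_mem _ (Submodule.neg_mem _ (Submodule.subset_span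
      (Or.inl ⟨f, hf', rfl⟩))) (Submodule.sum_mem _ fun A _ => ?_)
    split_ifs with h
    · refine hS.charMap_kt_mul_jet_mem ?_ h
      have := hE A
      simp only [h, Nat.cast_zero] at this
      exact this
    · rw [map_zero, map_zero]
      exact Submodule.zero_mem _
  rw [map_smul, map_smul] at h4
  have h5 := Submodule.smul_mem _ (((2 : ℤ) : ℝ)⁻¹) h4
  rwa [smul_smul, inv_mul_cancel₀ (by norm_num), one_smul] at h5

/-- Trivial symmetries are generated by Koszul-Tate boundaries. -/
theorem exists_charMap_kt_eq {X : Φ → LocAlg n F} (hX : X ∈ trivialSym S) :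
    ∃ b ∈ bigraded (n := n) (F := F) (-2) 2, charMap (kt S b) = X := by
  have key : trivialSym S ≤ (bigraded (-2) 2).map (charMap ∘ₗ kt S) := by
    refine Submodule.span_le.2 ?_
    rintro _ (⟨f, hf, rfl⟩ | ⟨i, j, J, b, hb, hi, hj, rfl⟩)
    · refine ⟨-∑ A, f A * jet (Sum.inr A) 0,
        Submodule.neg_mem _ (Submodule.sum_mem _ fun A _ => ?_), ?_⟩
      · by_cases h : F.gh A = 1
        · have := mul_mem_bigraded (characteristics_mem_bigraded hf A)
            (jet_mem_bigraded (Sum.inr A) 0)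
          simp only [FieldContent.vaf, FieldContent.vgh, h, Nat.cast_one, zero_add] at this
          exact this
        · rw [(mem_characteristics.1 hf A).2 h, zero_mul]
          exact Submodule.zero_mem _
      · rw [LinearMap.comp_apply, map_neg, map_neg, hS.charMap_kt_gauge hf, neg_neg]
    · refine ⟨sgn (F.par i * F.par j + F.par j) • (b * (jet (Sum.inr i) 0 * jet (Sum.inr j) J)),
        Submodule.smul_mem _ _ ?_, ?_⟩
      · have := mul_mem_bigraded hb (mul_mem_bigraded (jet_mem_bigraded (Sum.inr i) 0)
          (jet_mem_bigraded (Sum.inr j) J))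
        simp only [FieldContent.vaf, FieldContent.vgh, hi, hj, Nat.cast_zero, neg_zero, zero_sub,
          zero_add] at this
        exact this
      · rw [LinearMap.comp_apply, map_smul, map_smul, hS.charMap_kt_onShell hi hj J hb, smul_smul,
          sgn_mul_self, one_smul]
  exact Submodule.mem_map.1 (key hX)

/-! ### Symmetries and cohomology in ghost number `-1` -/

omit [Fintype Φ] hS in
theorem _root_.BV.density_apply_eq_zero [Fintype Φ] {g : ℤ} {a : Series n F}
    (ha : a ∈ density n F g)
    {k : ℕ} (h : g + k < 0) : a k = 0 := bigraded_eq_zero_of_pgh h (mem_density.1 ha k)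

theorem evo_mem_bigraded {X : Φ → LocAlg n F} (hX : X ∈ characteristics n F 0) :
    evo X (S 0) ∈ bigraded 0 0 := by
  have h : ∀ z, (Sum.elim X 0 : Var Φ → LocAlg n F) z ∈ bigraded (F.vgh z + 0) (F.vaf z + 0) := by
    rintro (A | A)
    · rw [Sum.elim_inl]
      by_cases h : F.gh A = 0
      · have hg : F.vgh (Sum.inl A) + 0 = 0 := by
          rw [FieldContent.vgh, h, Nat.cast_zero, add_zero]
        have hk : F.vaf (Sum.inl A) + 0 = 0 := by rw [FieldContent.vaf, add_zero]
        rw [hg, hk]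
        exact characteristics_mem_bigraded hX A
      · rw [(mem_characteristics.1 hX A).2 h]
        exact Submodule.zero_mem _
    · rw [Sum.elim_inr]
      exact Submodule.zero_mem _
  rw [evo_eq_pro]
  have := pro_mem_bigraded h (hS.comp_mem_bigraded 0)
  rwa [Nat.cast_zero, add_zero] at this

theorem mem_varSym {X : Φ → LocAlg n F} : X ∈ varSym S ↔
    X ∈ characteristics n F 0 ∧ lf n F (evo X (S 0)) = 0 := by
  have h1 : X ∈ varSym S ↔ X ∈ characteristics n F 0 ∧ evo X (S 0) ∈ locDiv n F 0 0 := Iff.rfl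
  rw [h1]
  refine and_congr_right fun hX => ?_
  rw [lf_eq_zero]
  exact ⟨fun h => locDiv_le_locFinDiv _ _ h,
    fun h => mem_locDiv_of_mem_locFinDiv (hS.evo_mem_bigraded hX) h⟩

theorem charMap_mem_varSym {a : Series n F} (ha : a ∈ cocycles S (-1)) :
    charMap (a 1) ∈ varSym S := by
  rw [mem_cocycles] at ha
  have ha1 : a 1 ∈ bigraded (-1) 1 := mem_density.1 ha.1 1
  refine hS.mem_varSym.2 ⟨charOf_mem_characteristics ha1, ?_⟩
  have h := hS.lf_brst_apply ha.1 (m := 0) fun k hk => by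
    rw [density_apply_eq_zero ha.1 (by omega)]
    exact Submodule.zero_mem _
  rw [charMap_apply, hS.lf_evo_charOf ha1, ← h, lf_eq_zero]
  exact locDiv_le_locFinDiv _ _ (mem_divergence.1 ha.2 0)

omit [Fintype Φ] hS in
open Classical in
theorem _root_.BV.single_mem_density {g : ℤ} {k : ℕ} {a : LocAlg n F} (ha : a ∈ bigraded g k) :
    (Pi.single k a : Series n F) ∈ density n F g := mem_density.2 fun j => by
  by_cases hj : j = k
  · subst hj
    rwa [Pi.single_eq_same]
  · rw [Pi.single_eq_of_ne hj]
    exact Submodule.zero_mem _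

/-- Every variational symmetry of a proper solution extends to a cocycle. -/
theorem exists_cocycle (hP : IsProper S) {X : Φ → LocAlg n F} (hX : X ∈ varSym S) :
    ∃ a ∈ cocycles S (-1), a 1 = antifieldTerm X := by
  classical
  obtain ⟨hX, hX'⟩ := hS.mem_varSym.1 hX
  have hK := antifieldTerm_mem_bigraded hX
  have hd : (Pi.single (M := fun _ => LocAlg n F) (1 : ℕ) (antifieldTerm X) : Series n F) ∈
      density n F (-1) := single_mem_density (by rwa [Nat.cast_one])
  have h0 := hS.lf_brst_apply hd (m := 0) fun k hk => by
    rw [density_apply_eq_zero hd (by omega)]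
    exact Submodule.zero_mem _
  rw [zero_add, Pi.single_eq_same, ← hS.lf_evo_charOf hK, charOf_antifieldTerm hX, hX'] at h0
  obtain ⟨b, hb, hb0, hb'⟩ := hS.exists_primitive hP (g := 0) (M := 0) (by norm_num)
    (hS.brst_mem_density (by norm_num) hd) (hS.brst_brst (by norm_num) hd) fun k hk => by
      rw [Nat.le_zero.1 hk]
      exact lf_eq_zero.1 h0
  refine ⟨Pi.single (M := fun _ => LocAlg n F) (1 : ℕ) (antifieldTerm X) - b,
    mem_cocycles.2 ⟨Submodule.sub_mem _ hd hb, ?_⟩, ?_⟩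
  · rw [map_sub, LinearMap.sub_apply]
    exact hb'
  · rw [Pi.sub_apply, Pi.single_eq_same, hb0 1 le_rfl, sub_zero]

theorem exists_cocycle_of_parity (hP : IsProper S) {X : Φ → LocAlg n F} (hX : X ∈ varSym S)
    {p : ZMod 2} (hp : X ∈ charParity p) :
    ∃ a ∈ cocycles S (-1), a ∈ seriesParity n F (p + 1) ∧ charMap (a 1) = X := by
  obtain ⟨a, ha, ha'⟩ := hS.exists_cocycle hP hX
  refine ⟨serProj (p + 1) a, hS.serProj_mem_cocycles _ ha, serProj_mem _ _, ?_⟩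
  rw [serProj_apply, ha', parProj_of_mem (antifieldTerm_mem_parityPart hp), charMap_apply,
    charOf_antifieldTerm (hS.mem_varSym.1 hX).1]

theorem charMap_mem_trivialSym {a : Series n F} (ha : a ∈ coboundaries S (-1)) :
    charMap (a 1) ∈ trivialSym S := by
  obtain ⟨b, hb, h⟩ := mem_coboundaries.1 ha
  have h1 : lf n F (a 1) = lf n F (antibracket b S 1) :=
    lf_eq.2 (locDiv_le_locFinDiv _ _ (mem_divergence.1 h 1))
  rw [hS.lf_brst_apply hb fun k hk => by
    rw [density_apply_eq_zero hb (by omega)]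
    exact Submodule.zero_mem _] at h1
  rw [charMap_congr h1]
  exact hS.charMap_kt_mem_trivialSym (mem_density.1 hb 2)

/-- For a proper solution, a cocycle that generates a trivial symmetry is a coboundary. -/
theorem mem_coboundaries_of_trivialSym (hP : IsProper S) {a : Series n F}
    (ha : a ∈ cocycles S (-1)) (h : charMap (a 1) ∈ trivialSym S) : a ∈ coboundaries S (-1) := by
  classical
  obtain ⟨β, hβ, hβ'⟩ := hS.exists_charMap_kt_eq h
  rw [mem_cocycles] at ha
  obtain ⟨c, hc, hd⟩ : ∃ c : Series n F, c 2 = β ∧ c ∈ density n F (-1 - 1) :=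
    ⟨Pi.single 2 β, Pi.single_eq_same _ _, single_mem_density (by
      rw [Nat.cast_ofNat, show (-1 - 1 : ℤ) = -2 from rfl]
      exact hβ)⟩
  have hsd := hS.brst_mem_density (by norm_num : (-1 - 1 : ℤ) + 1 = -1) hd
  have h1 := hS.lf_brst_apply hd (m := 1) fun k hk => by
    rw [density_apply_eq_zero hd (by omega)]
    exact Submodule.zero_mem _
  rw [hc] at h1
  have hsub := Submodule.sub_mem _ ha.1 hsd
  have h2 : (a - antibracket c S) 1 ∈ locFinDiv n F := by
    have h3 : (a - antibracket c S) 1 ∈ bigraded (-1) 1 := by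
      have := mem_density.1 hsub 1
      rwa [Nat.cast_one] at this
    rw [← lf_eq_zero, lf_antifieldTerm h3, ← charMap_apply, Pi.sub_apply, map_sub, charMap_congr h1,
      hβ', sub_self, antifieldTerm]
    simp only [Pi.zero_apply, zero_mul, Finset.sum_const_zero, neg_zero, map_zero]
  -- after subtraction of `s c` the cocycle starts in antifield number two
  obtain ⟨b, hb, -, hb'⟩ := hS.exists_primitive hP (g := -1) (M := 1) (by norm_num) hsub
    (by
      rw [map_sub, LinearMap.sub_apply]
      exact Submodule.sub_mem _ ha.2 (hS.brst_brst (by norm_num) hd)) fun k hk => by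
      rcases Nat.le_one_iff_eq_zero_or_eq_one.1 hk with rfl | rfl
      · rw [density_apply_eq_zero hsub (by norm_num)]
        exact Submodule.zero_mem _
      · exact h2
  refine mem_coboundaries.2 ⟨b + c, Submodule.add_mem _ hb hd, ?_⟩
  rw [map_add, LinearMap.add_apply, add_comm, ← sub_sub]
  exact hb'

end IsMasterAction

end

section

variable {Φ : Type u} {n : ℕ} {F : FieldContent Φ} [Fintype Φ] {S : Series n F}

/-! ### The isomorphism of Lie algebras -/

/-- Transport of a graded Lie algebra structure along a linear equivalence. -/
theorem IsGradedLie.transport {L L' : Type u} [AddCommGroup L] [Module ℝ L] [AddCommGroup L']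
    [Module ℝ L'] {par : ZMod 2 → Submodule ℝ L} {par' : ZMod 2 → Submodule ℝ L'}
    {br : L →ₗ[ℝ] L →ₗ[ℝ] L} {br' : L' →ₗ[ℝ] L' →ₗ[ℝ] L'} (h : IsGradedLie par br) (e : L ≃ₗ[ℝ] L')
    (hpar : ∀ p x, e x ∈ par' p ↔ x ∈ par p) (hbr : ∀ x y, e (br x y) = br' (e x) (e y)) :
    IsGradedLie par' br' where
  decomp := by
    have hmap : ∀ p, par' p = (par p).map e.toLinearMap := fun p => by
      ext y
      obtain ⟨x, rfl⟩ := e.surjective y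
      rw [hpar]
      exact ⟨fun hx => ⟨x, hx, rfl⟩, fun ⟨x', hx', h'⟩ => e.injective h' ▸ hx'⟩
    rw [hmap, hmap]
    exact h.decomp.map (Submodule.orderIsoMapComap e)
  bracket_mem p q x y hx hy := by
    obtain ⟨x, rfl⟩ := e.surjective x
    obtain ⟨y, rfl⟩ := e.surjective y
    rw [hpar] at hx hy
    rw [← hbr, hpar]
    exact h.bracket_mem p q x y hx hy
  skew p q x y hx hy := by
    obtain ⟨x, rfl⟩ := e.surjective x
    obtain ⟨y, rfl⟩ := e.surjective y
    rw [hpar] at hx hy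
    rw [← hbr, ← hbr, ← map_smul, ← map_neg, h.skew p q x y hx hy]
  jacobi p q x y z hx hy := by
    obtain ⟨x, rfl⟩ := e.surjective x
    obtain ⟨y, rfl⟩ := e.surjective y
    obtain ⟨z, rfl⟩ := e.surjective z
    rw [hpar] at hx hy
    rw [← hbr, ← hbr, ← hbr, ← hbr, ← hbr, ← hbr, ← map_smul, ← map_add,
      h.jacobi p q x y z hx hy]

theorem symCls_eq_zero {X : varSym S} :
    symCls S X = 0 ↔ (X : Φ → LocAlg n F) ∈ trivialSym S :=
  (Submodule.Quotient.mk_eq_zero _).trans Iff.rfl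

theorem symCls_surjective (x : SymClass S) : ∃ X, symCls S X = x := Submodule.mkQ_surjective _ x

theorem mem_symParity {p : ZMod 2} {x : SymClass S} : x ∈ symParity S p ↔
    ∃ X : varSym S, (X : Φ → LocAlg n F) ∈ charParity p ∧ symCls S X = x := Iff.rfl

namespace IsMasterAction

variable (hS : IsMasterAction S)
include hS

/-- The variational symmetry generated by a cocycle of ghost number `-1`. -/
def symOf : cocycles S (-1) →ₗ[ℝ] varSym S :=
  { toFun := fun a => ⟨charMap ((a : Series n F) 1), hS.charMap_mem_varSym a.2⟩
    map_add' := fun a b => Subtype.ext (map_add charMap ((a : Series n F) 1) ((b : Series n F) 1))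
    map_smul' := fun r a => Subtype.ext (map_smul charMap r ((a : Series n F) 1)) }

theorem coe_symOf (a : cocycles S (-1)) :
    (hS.symOf a : Φ → LocAlg n F) = charOf ((a : Series n F) 1) := rfl

theorem ker_le_ker : (coboundaries S (-1)).comap (cocycles S (-1)).subtype ≤
    ((trivialSym S).comap (varSym S).subtype).comap hS.symOf := by
  intro a ha
  have ha' : (a : Series n F) ∈ coboundaries S (-1) := ha
  have h : (hS.symOf a : Φ → LocAlg n F) ∈ trivialSym S := hS.charMap_mem_trivialSym ha'
  exact h

/-- The map from the cohomology in ghost number `-1` to the classes of variational symmetries. -/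
def symHom : H S (-1) →ₗ[ℝ] SymClass S :=
  Submodule.mapQ ((coboundaries S (-1)).comap (cocycles S (-1)).subtype)
    ((trivialSym S).comap (varSym S).subtype) hS.symOf hS.ker_le_ker

theorem symHom_cls (a : cocycles S (-1)) : hS.symHom (cls S (-1) a) = symCls S (hS.symOf a) := rfl

theorem symHom_bijective (hP : IsProper S) : Function.Bijective hS.symHom := by
  constructor
  · rw [injective_iff_map_eq_zero]
    intro x hx
    obtain ⟨a, rfl⟩ := cls_surjective (-1) x
    rw [symHom_cls, symCls_eq_zero, coe_symOf] at hx
    rw [cls_eq_zero]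
    exact hS.mem_coboundaries_of_trivialSym hP a.2 hx
  · intro y
    obtain ⟨X, rfl⟩ := symCls_surjective y
    obtain ⟨a, ha, ha'⟩ := hS.exists_cocycle hP X.2
    refine ⟨cls S (-1) ⟨a, ha⟩, ?_⟩
    rw [symHom_cls]
    congr 1
    ext1
    rw [coe_symOf]
    dsimp only
    rw [ha', charOf_antifieldTerm (hS.mem_varSym.1 X.2).1]

/-- The cohomology in ghost number `-1` is isomorphic to the space of classes of variational
symmetries. -/
def symEquiv (hP : IsProper S) : H S (-1) ≃ₗ[ℝ] SymClass S :=
  LinearEquiv.ofBijective hS.symHom (hS.symHom_bijective hP)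

theorem symEquiv_cls (hP : IsProper S) (a : cocycles S (-1)) :
    hS.symEquiv hP (cls S (-1) a) = symCls S (hS.symOf a) := rfl

theorem exists_cls_of_parity (hP : IsProper S) {X : varSym S} {p : ZMod 2}
    (hp : (X : Φ → LocAlg n F) ∈ charParity p) : ∃ a : cocycles S (-1),
      (a : Series n F) ∈ seriesParity n F (p + 1) ∧ hS.symOf a = X := by
  obtain ⟨a, ha, hap, ha'⟩ := hS.exists_cocycle_of_parity hP X.2 hp
  exact ⟨⟨a, ha⟩, hap, Subtype.ext ha'⟩

theorem symEquiv_mem_symParity (hP : IsProper S) (p : ZMod 2) (x : H S (-1)) :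
    hS.symEquiv hP x ∈ symParity S p ↔ x ∈ shiftedParity S p := by
  constructor
  · intro h
    obtain ⟨X, hX, hX'⟩ := mem_symParity.1 h
    obtain ⟨a, ha, rfl⟩ := hS.exists_cls_of_parity hP hX
    rw [← hS.symEquiv_cls hP] at hX'
    rw [← (hS.symEquiv hP).injective hX']
    exact mem_parityH.2 ⟨a, ha, rfl⟩
  · intro h
    obtain ⟨a, ha, rfl⟩ := mem_parityH.1 h
    rw [symEquiv_cls]
    refine mem_symParity.2 ⟨_, ?_, rfl⟩
    rw [coe_symOf]
    exact charOf_mem_charParity (mem_seriesParity.1 ha 1)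

/-- The Lie bracket of classes of variational symmetries. -/
def symBracket (hP : IsProper S) : SymClass S →ₗ[ℝ] SymClass S →ₗ[ℝ] SymClass S :=
  ((hS.cohomBracket (by norm_num : (-1 : ℤ) + -1 + 1 = -1)).compl₁₂
    (hS.symEquiv hP).symm.toLinearMap (hS.symEquiv hP).symm.toLinearMap).compr₂
      (hS.symEquiv hP).toLinearMap

theorem symBracket_apply (hP : IsProper S) (x y : SymClass S) : hS.symBracket hP x y =
    hS.symEquiv hP (hS.cohomBracket (by norm_num : (-1 : ℤ) + -1 + 1 = -1)
      ((hS.symEquiv hP).symm x) ((hS.symEquiv hP).symm y)) := rfl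

theorem symEquiv_bracket (hP : IsProper S) (x y : H S (-1)) :
    hS.symEquiv hP (hS.cohomBracket (by norm_num : (-1 : ℤ) + -1 + 1 = -1) x y) =
      hS.symBracket hP (hS.symEquiv hP x) (hS.symEquiv hP y) := by
  rw [symBracket_apply, LinearEquiv.symm_apply_apply, LinearEquiv.symm_apply_apply]

theorem symBracket_symCls (hP : IsProper S) {p q : ZMod 2} {X Y : varSym S}
    (hX : (X : Φ → LocAlg n F) ∈ charParity p) (hY : (Y : Φ → LocAlg n F) ∈ charParity q) :
    ∃ hc : charComm p q (X : Φ → LocAlg n F) Y ∈ varSym S,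
      hS.symBracket hP (symCls S X) (symCls S Y) = symCls S ⟨_, hc⟩ := by
  obtain ⟨a, ha, rfl⟩ := hS.exists_cls_of_parity hP hX
  obtain ⟨b, hb, rfl⟩ := hS.exists_cls_of_parity hP hY
  have h1 := charOf_antibracket (mem_cocycles.1 a.2).1 (mem_cocycles.1 b.2).1 ha hb
  have h2 := hS.antibracket_mem_cocycles (by norm_num : (-1 : ℤ) + -1 + 1 = -1) a.2 b.2
  have h3 := hS.charMap_mem_varSym h2
  rw [charMap_apply, h1] at h3
  refine ⟨h3, ?_⟩
  rw [← hS.symEquiv_cls hP, ← hS.symEquiv_cls hP, ← hS.symEquiv_bracket, cohomBracket_cls,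
    symEquiv_cls]
  congr 1
  ext1
  exact h1

end IsMasterAction

end

end BV

end

theorem proposition1 {n : ℕ} {Φ : Type*} [Fintype Φ] (F : BV.FieldContent Φ)
    (S : BV.Series n F) (hS : BV.IsMasterAction S) :
    (∀ g : ℤ, BV.coboundaries S g ≤ BV.cocycles S g) ∧
    ∃ br : ∀ g₁ g₂ g₃ : ℤ, g₁ + g₂ + 1 = g₃ → (BV.H S g₁ →ₗ[ℝ] BV.H S g₂ →ₗ[ℝ] BV.H S g₃),
      -- `br` is induced by the antibracket of representatives
      (∀ (g₁ g₂ g₃ : ℤ) (h : g₁ + g₂ + 1 = g₃) (a : BV.cocycles S g₁) (b : BV.cocycles S g₂),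
        ∃ hc : BV.antibracket (a : BV.Series n F) b ∈ BV.cocycles S g₃,
          br g₁ g₂ g₃ h (BV.cls S g₁ a) (BV.cls S g₂ b) = BV.cls S g₃ ⟨_, hc⟩) ∧
      -- `H^{-1}(s)` is a graded Lie algebra
      BV.IsGradedLie (BV.shiftedParity S) (br (-1) (-1) (-1) (by norm_num)) ∧
      -- `H^g(s)` is a module over every subalgebra of `H^{-1}(s)`
      (∀ (g : ℤ) (𝔤 : BV.GradedSubalgebra (BV.shiftedParity S) (br (-1) (-1) (-1) (by norm_num))),
        BV.IsGradedModule 𝔤 (BV.parityH S g)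
          ((br (-1) g g (by ring)).domRestrict 𝔤.carrier)) ∧
      -- for a proper solution `S`: the Lie algebra of equivalence classes of variational symmetries
      (BV.IsProper S →
        ∃ (vb : BV.SymClass S →ₗ[ℝ] BV.SymClass S →ₗ[ℝ] BV.SymClass S)
          (Θ : BV.H S (-1) ≃ₗ[ℝ] BV.SymClass S),
          -- its bracket is the commutator of symmetries
          (∀ (p q : ZMod 2) (X Y : BV.varSym S),
            (X : Φ → BV.LocAlg n F) ∈ BV.charParity p → (Y : Φ → BV.LocAlg n F) ∈ BV.charParity q →
            ∃ hc : BV.charComm p q (X : Φ → BV.LocAlg n F) Y ∈ BV.varSym S,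
              vb (BV.symCls S X) (BV.symCls S Y) = BV.symCls S ⟨_, hc⟩) ∧
          BV.IsGradedLie (BV.symParity S) vb ∧
          -- `Θ` sends `[K]` to the class of the symmetry generated by `K`, and is an isomorphism
          (∀ a : BV.cocycles S (-1),
            ∃ hc : BV.charOf ((a : BV.Series n F) 1) ∈ BV.varSym S,
              Θ (BV.cls S (-1) a) = BV.symCls S ⟨_, hc⟩) ∧
          (∀ (p : ZMod 2) (x : BV.H S (-1)), x ∈ BV.shiftedParity S p → Θ x ∈ BV.symParity S p) ∧
          (∀ x y : BV.H S (-1),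
            Θ (br (-1) (-1) (-1) (by norm_num) x y) = vb (Θ x) (Θ y)) ∧
          -- `H^g(s)` is a module over every subalgebra of it
          (∀ (g : ℤ) (𝔥 : BV.GradedSubalgebra (BV.symParity S) vb),
            BV.IsGradedModule 𝔥 (BV.parityH S g)
              ((br (-1) g g (by ring) ∘ₗ Θ.symm.toLinearMap).domRestrict 𝔥.carrier))) := by
  refine ⟨hS.coboundaries_le_cocycles, fun _ _ _ h => hS.cohomBracket h,
    fun _ _ _ h a b => ⟨hS.antibracket_mem_cocycles h a.2 b.2, hS.cohomBracket_cls h a b⟩,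
    hS.isGradedLie,
    fun g 𝔤 => hS.isGradedModule LinearMap.id (fun _ _ hx => hx) (fun _ _ => rfl) g _ 𝔤,
    fun hP => ⟨hS.symBracket hP, hS.symEquiv hP, fun _ _ _ _ hX hY => hS.symBracket_symCls hP hX hY,
      hS.isGradedLie.transport (hS.symEquiv hP) (hS.symEquiv_mem_symParity hP)
        (hS.symEquiv_bracket hP),
      fun a => ⟨hS.charMap_mem_varSym a.2, hS.symEquiv_cls hP a⟩,
      fun p x hx => (hS.symEquiv_mem_symParity hP p x).2 hx, hS.symEquiv_bracket hP,
      fun g 𝔥 => hS.isGradedModule _ (fun p x hx => ?_) (fun x y => ?_) g _ 𝔥⟩⟩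
  · rw [← hS.symEquiv_mem_symParity hP]
    exact ((hS.symEquiv hP).apply_symm_apply x).symm ▸ hx
  · exact (hS.symEquiv hP).symm_apply_apply _
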